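/- **Setting.** Let $p$ be a prime and let $F/\mathbb{Q}_p$ be a finite extension with ring of integers $\mathcal{O}$, uniformizer $\pi$, ramification index $e$ (so $p\mathcal{O}=\pi^e\mathcal{O}$) and residue field $\mathbb{F}_q=\mathcal{O}/(\pi)$, $q=p^f$. Let $\overline{\mathbb{F}}_p$ be an algebraic closure of $\mathbb{F}_q$, and for $\lambda\in\mathbb{F}_q$ let $[\lambda]\in\mathcal{O}$ be its Teichmüller lift. Put $G=\mathrm{GL}_2(F)$, $K=\mathrm{GL}_2(\mathcal{O})$, let $Z$ be the center of $G$, let $I\subseteq K$ be the Iwahori subgroup of matrices that are upper triangular modulo $\pi$, and $I(1)\subseteq I$ the subgroup of matrices that moreover have both diagonal entries $\equiv 1$ modulo $\pi$. Let $w\ge 0$ and let $r_0,\dots,r_{f-1}$ be integers with $2<r_j<p-3$ for all $j$. Let $\sigma=\det^w\otimes\bigotimes_{j=0}^{f-1}\mathrm{Sym}^{r_j}\overline{\mathbb{F}}_p^2$, with basis $\bigotimes_j x_j^{r_j-i_j}y_j^{i_j}$ $(0\le i_j\le r_j)$ of its space $V_\sigma$, on which $K$ acts through the reduction of its entries to $\mathbb{F}_q$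 by $$\sigma\begin{pmatrix}a&b\\c&d\end{pmatrix}\Big(\bigotimes_j x_j^{r_j-i_j}y_j^{i_j}\Big)=(ad-bc)^w\bigotimes_j (a^{p^j}x_j+c^{p^j}y_j)^{r_j-i_j}(b^{p^j}x_j+d^{p^j}y_j)^{i_j},$$ extended to $KZ$ by letting the scalar matrix $\pi$ act trivially. Let $\mathrm{ind}_{KZ}^G\sigma$ be the space of functions $\varphi:G\to V_\sigma$ with $\varphi(hg)=\sigma(h)\varphi(g)$ for $h\in KZ$, $g\in G$, whose support is a finite union of cosets $KZg$; $G$ acts by $(g\varphi)(x)=\varphi(xg)$. For $g\in G$ and $v\in V_\sigma$ let $g\otimes v\in\mathrm{ind}_{KZ}^G\sigma$ be the function supported on $KZg^{-1}$ with $(g\otimes v)(x)=\sigma(xg)v$ there. Put $$\alpha=\begin{pmatrix}1&0\\0&\pi\end{pmatrix},\qquad \beta=\begin{pmatrix}0&1\\\pi&0\end{pmatrix}.$$ Let $T$ be the standard Hecke operator, i.e. the $G$-equivariant endomorphism of $\mathrm{ind}_{KZ}^G\sigma$ such that, for $v=\sum_{\vec i}c_{\vec i}\bigotimes_j x_j^{r_j-i_j}y_j^{i_j}$,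 $$T(\mathrm{Id}\otimes v)=\sum_{\lambda\in\mathbb{F}_q}\begin{pmatrix}\pi&[\lambda]\\0&1\end{pmatrix}\otimes\Big(\sum_{\vec i}c_{\vec i}(-\lambda)^{\sum_j i_jp^j}\Big)\bigotimes_j x_j^{r_j}\;+\;\alpha\otimes c_{\vec r}\bigotimes_j y_j^{r_j},$$ and let $(T)$ be its image. For $n\ge1$ let $I_n=\{\sum_{i=0}^{n-1}\pi^i[\mu_i]:\mu_i\in\mathbb{F}_q\}$ and, for integers $k\ge 0$ in the first formula and $0\le k\le f-1$ in the second, $$s_n^k=\sum_{\mu\in I_n}\begin{pmatrix}\pi^n&\mu\\0&1\end{pmatrix}\otimes\mu_{n-1}^k\bigotimes_{j}x_j^{r_j},\qquad t_n^k=\sum_{\mu\in I_n}\begin{pmatrix}\pi^n&\mu\\0&1\end{pmatrix}\otimes x_k^{r_k-1}y_k\otimes\bigotimes_{j\ne k}x_j^{r_j}.$$ For $m\ge1$ put $$\mathcal{S}_m=\bigcup_{l=0}^{f-1}\{s_n^{p^l(r_l+1)},\ \beta s_n^{p^l(r_l+1)}\}_{n\ge m},\qquad \mathcal{T}_m=\bigcup_{k=0}^{f-1}\{t_n^k,\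 \beta t_n^k\}_{n\ge m}.$$ **Theorem.** The images in $\mathrm{ind}_{KZ}^G\sigma/(T)$ of the elements of the following set form an $I$-eigenbasis of the $\overline{\mathbb{F}}_p$-vector space $(\mathrm{ind}_{KZ}^G\sigma/(T))^{I(1)}$ of $I(1)$-invariants, that is, $I$ acts on each of them through a character, they are linearly independent (in particular, the listed elements are pairwise distinct), and they span the space of $I(1)$-invariants: $$\begin{aligned} &\{\mathrm{Id}\otimes x_0^{r_0},\ \alpha\otimes y_0^{r_0}\} && \text{if } e=1,\ f=1;\\ &\mathcal{S}_2\cup\{\mathrm{Id}\otimes x_0^{r_0},\ \alpha\otimes y_0^{r_0}\}\cup\mathcal{T}_1 && \text{if } e>1,\ f=1;\\ &\mathcal{S}_1\cup\Big\{\mathrm{Id}\otimes\bigotimes_j x_j^{r_j},\ \alpha\otimes\bigotimes_j y_j^{r_j}\Big\} && \text{if } e=1,\ f>1;\\ &\mathcal{S}_1\cup\Big\{\mathrm{Id}\otimes\bigotimes_j x_j^{r_j},\ \alpha\otimes\bigotimes_j y_j^{r_j}\Big\}\cup\mathcal{T}_1 && \text{if } e>1,\ f>1. \end{aligned}$$ 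-/

import Mathlib

open scoped ValuativeRel MatrixGroups

namespace ModPGL2
open Matrix MvPolynomial IsLocalRing

noncomputable section

set_option linter.unusedSectionVars false

section Residue

variable {R : Type*} [CommRing R] [HenselianLocalRing R]

theorem exists_teich [Finite (ResidueField R)] (x : ResidueField R) :
    ∃ y : R, residue R y = x ∧ y ^ Nat.card (ResidueField R) = y := by
  have : Fintype (ResidueField R) := Fintype.ofFinite _
  set q := Nat.card (ResidueField R) with hq
  have hq' : q = Fintype.card (ResidueField R) := Nat.card_eq_fintype_card
  have hq1 : 1 < q := by rw [hq']; exact Fintype.one_lt_card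
  have T := ((HenselianLocalRing.TFAE R).out 0 1).1 ‹HenselianLocalRing R›
  have H := T (Polynomial.X ^ q - Polynomial.X)
    (Polynomial.monic_X_pow_sub (by rw [Polynomial.degree_X]; exact_mod_cast hq1)) x
    (by simp [hq', FiniteField.pow_card]) (by
      have h0 : (q : ResidueField R) = 0 := by rw [hq']; exact FiniteField.cast_card_eq_zero _
      simp [Polynomial.derivative_X_pow, h0])
  obtain ⟨a, ha, hx⟩ := H
  refine ⟨a, hx, ?_⟩
  simpa [Polynomial.IsRoot, sub_eq_zero] using ha

/-- The Teichmüller lift `[x]` of an element `x` of the residue field with `q` elements: the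
(unique) lift of `x` with `[x] ^ q = [x]`. -/
def teich [Finite (ResidueField R)] (x : ResidueField R) : R := (exists_teich x).choose

theorem residue_teich [Finite (ResidueField R)] (x : ResidueField R) :
    residue R (teich x) = x := (exists_teich x).choose_spec.1

end Residue

/-- The ring of integers of a nonarchimedean local field is Henselian (being complete), so that
Teichmüller lifts exist in it. -/
instance henselian_integer (F : Type*) [Field F] [ValuativeRel F] [TopologicalSpace F]
    [IsNonarchimedeanLocalField F] : HenselianLocalRing 𝒪[F] := by
  let := IsTopologicalAddGroup.rightUniformSpace F
  have := isUniformAddGroup_of_addCommGroup (G := F)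
  have h : HenselianRing 𝒪[F] 𝓂[F] := inferInstance
  refine ⟨fun f hf a h1 h2 => h.is_henselian f hf a h1 (h2.map _)⟩

section Weight

variable {R : Type*} [CommRing R] [IsLocalRing R] (E : Type*) [Field E] [Algebra (ResidueField R) E]

/-- The reduction map `R → 𝔽_q → E`, where `E` is an algebraic closure of `𝔽_q`. -/
def red : R →+* E := (algebraMap (ResidueField R) E).comp (residue R)

variable (p : ℕ) [Fact p.Prime] [CharP E p] {f : ℕ} (r : Fin f → ℕ) (w : ℕ)

/-- The polynomials in the variables `x_j = X (j, 0)`, `y_j = X (j, 1)`, `j < f`, that are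
homogeneous of degree `r j` in each pair `x_j, y_j`; this is a model of
`Sym^{r_0} E² ⊗ ⋯ ⊗ Sym^{r_{f-1}} E²`. -/
abbrev SymV : Submodule E (MvPolynomial (Fin f × Fin 2) E) :=
  weightedHomogeneousSubmodule E (fun v : Fin f × Fin 2 => (Pi.single v.1 1 : Fin f → ℕ)) r

/-- The space `V_σ = ⨂_j Sym^{r_j} E²`, as a type. -/
def Weight : Type _ := SymV E r

instance : AddCommGroup (Weight E r) := inferInstanceAs (AddCommGroup (SymV E r))

instance : Module E (Weight E r) := inferInstanceAs (Module E (SymV E r))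

/-- The polynomial underlying an element of `V_σ`. -/
def toPoly : Weight E r →ₗ[E] MvPolynomial (Fin f × Fin 2) E := (SymV E r).subtype

/-- A multihomogeneous polynomial as an element of `V_σ`. -/
def ofPoly (q : MvPolynomial (Fin f × Fin 2) E) (hq : q ∈ SymV E r) : Weight E r := ⟨q, hq⟩

theorem toPoly_ofPoly (q : MvPolynomial (Fin f × Fin 2) E) (hq : q ∈ SymV E r) :
    toPoly E r (ofPoly E r q hq) = q := rfl

theorem toPoly_mem (v : Weight E r) : toPoly E r v ∈ SymV E r := v.2

theorem toPoly_injective : Function.Injective (toPoly E r) := Subtype.val_injective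

/-- The substitution `x_j ↦ a^(p^j) x_j + c^(p^j) y_j`, `y_j ↦ b^(p^j) x_j + d^(p^j) y_j` attached
to a matrix `k = (a b; c d)`, whose entries are reduced to `𝔽_q ⊆ E`. -/
def subst (f : ℕ) (k : Matrix (Fin 2) (Fin 2) R) :
    MvPolynomial (Fin f × Fin 2) E →ₐ[E] MvPolynomial (Fin f × Fin 2) E :=
  aeval fun v => C (red E (k 0 v.2) ^ p ^ (v.1 : ℕ)) * X (v.1, 0) +
    C (red E (k 1 v.2) ^ p ^ (v.1 : ℕ)) * X (v.1, 1)

theorem subst_one : subst (R := R) E p f 1 = AlgHom.id E _ := by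
  ext v : 1
  obtain ⟨j, i⟩ := v
  have : p ^ (j : ℕ) ≠ 0 := pow_ne_zero _ (Fact.out : p.Prime).ne_zero
  fin_cases i <;> simp [subst, zero_pow this]

theorem subst_mul (k l : Matrix (Fin 2) (Fin 2) R) :
    subst E p f (k * l) = (subst E p f k).comp (subst E p f l) := by
  ext v : 1
  obtain ⟨j, i⟩ := v
  have h : ∀ a b : E, (a + b) ^ p ^ (j : ℕ) = a ^ p ^ (j : ℕ) + b ^ p ^ (j : ℕ) :=
    fun a b => add_pow_char_pow a b p _
  simp only [subst, Matrix.mul_apply, Fin.sum_univ_two, map_add, map_mul, h, mul_pow,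
    AlgHom.comp_apply, aeval_X, aeval_C, MvPolynomial.algebraMap_eq]
  ring

theorem subst_mem (k : Matrix (Fin 2) (Fin 2) R) {v : MvPolynomial (Fin f × Fin 2) E}
    (hv : v ∈ SymV E r) : subst E p f k v ∈ SymV E r := by
  rw [mem_weightedHomogeneousSubmodule] at hv
  rw [v.as_sum, map_sum]
  refine Submodule.sum_mem _ fun d hd => ?_
  rw [mem_weightedHomogeneousSubmodule, subst, aeval_monomial, MvPolynomial.algebraMap_eq]
  have hd' := hv (mem_support_iff.1 hd)
  rw [← hd', ← zero_add (Finsupp.weight _ d)]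
  refine (isWeightedHomogeneous_C _ _).mul ?_
  rw [Finsupp.prod, Finsupp.weight_apply, Finsupp.sum]
  refine IsWeightedHomogeneous.prod _ _ _ fun i _ => ?_
  refine IsWeightedHomogeneous.pow ?_ _
  refine IsWeightedHomogeneous.add ?_ ?_ <;>
  exact IsWeightedHomogeneous.C_mul (isWeightedHomogeneous_X _ _ _) _

/-- The action of `k ∈ GL₂(R)` on `V_σ`: the substitution above times `det(k) ^ w`. -/
def sigmaMap (k : GL (Fin 2) R) : Weight E r →ₗ[E] Weight E r where
  toFun v := ofPoly E r (red E k.val.det ^ w • subst E p f k.val (toPoly E r v))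
    (Submodule.smul_mem _ _ (subst_mem E p r k.val (toPoly_mem E r v)))
  map_add' v v' := toPoly_injective E r (by
    simp only [map_add, toPoly_ofPoly, smul_add])
  map_smul' c v := toPoly_injective E r (by
    simp only [map_smul, toPoly_ofPoly, RingHom.id_apply, smul_comm c])

theorem sigmaMap_coe (k : GL (Fin 2) R) (v : Weight E r) :
    toPoly E r (sigmaMap E p r w k v) =
      red E k.val.det ^ w • subst E p f k.val (toPoly E r v) := rfl

/-- The weight `σ = det^w ⊗ ⨂_j Sym^{r_j} E²`, as a representation of `K = GL₂(R)` on `V_σ`; the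
`j`-th factor is twisted by the `j`-th power of Frobenius. -/
def sigma : Representation E (GL (Fin 2) R) (Weight E r) where
  toFun := sigmaMap E p r w
  map_one' := by
    ext1 v
    apply toPoly_injective
    simp [sigmaMap_coe, subst_one]
  map_mul' k l := by
    ext1 v
    apply toPoly_injective
    rw [Module.End.mul_apply, sigmaMap_coe, sigmaMap_coe, sigmaMap_coe, Units.val_mul, det_mul,
      map_mul, mul_pow, subst_mul, AlgHom.comp_apply, map_smul, mul_smul]

theorem sigma_coe (k : GL (Fin 2) R) (v : Weight E r) :
    toPoly E r (sigma E p r w k v) =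
      red E k.val.det ^ w • subst E p f k.val (toPoly E r v) := rfl

/-- The basis vector `⨂_j x_j^{r_j - i_j} y_j^{i_j}` of `V_σ`, for `0 ≤ i_j ≤ r_j`. -/
def mono (i : (j : Fin f) → Fin (r j + 1)) : Weight E r :=
  ofPoly E r (∏ j, X (j, 0) ^ (r j - i j) * X (j, 1) ^ (i j : ℕ)) (by
    have h : ∑ j, ((r j - i j) • (Pi.single j 1 : Fin f → ℕ) + (i j : ℕ) • Pi.single j 1) = r := by
      ext l
      have := (i l).is_le
      simp only [← add_nsmul]
      simp [Finset.sum_apply, Pi.single_apply]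
      omega
    have H := IsWeightedHomogeneous.prod (Finset.univ : Finset (Fin f)) _ _ fun j _ =>
      ((isWeightedHomogeneous_X E (fun v : Fin f × Fin 2 => (Pi.single v.1 1 : Fin f → ℕ))
        (j, 0)).pow (r j - i j)).mul ((isWeightedHomogeneous_X E _ (j, 1)).pow (i j : ℕ))
    rw [h] at H
    exact H)

/-- The vector `⨂_j x_j^{r_j}`. -/
def xTop : Weight E r := mono E r 0

/-- The vector `⨂_j y_j^{r_j}`. -/
def yTop : Weight E r := mono E r fun j => Fin.last (r j)

/-- The vector `x_k^{r_k - 1} y_k ⊗ ⨂_{j ≠ k} x_j^{r_j}` (for `r_k ≥ 1`). -/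
def xyTop (k : Fin f) : Weight E r := mono E r (Pi.single k 1)

/-- The coefficient of `∏_j x_j^{r_j}` in an element of `V_σ`, i.e. its value at `x = 1, y = 0`. -/
def evX : Weight E r →ₗ[E] E :=
  (aeval fun v : Fin f × Fin 2 => if v.2 = 0 then (1 : E) else 0).toLinearMap ∘ₗ toPoly E r

/-- The coefficient of `∏_j y_j^{r_j}` in an element of `V_σ`, i.e. its value at `x = 0, y = 1`. -/
def evY : Weight E r →ₗ[E] E :=
  (aeval fun v : Fin f × Fin 2 => if v.2 = 0 then (0 : E) else 1).toLinearMap ∘ₗ toPoly E r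

/-- The projection of `V_σ` onto the line of `⨂_j x_j^{r_j}` along the other monomials. -/
def projX : Weight E r →ₗ[E] Weight E r := (evX E r).smulRight (xTop E r)
/-- The projection of `V_σ` onto the line of `⨂_j y_j^{r_j}` along the other monomials. -/
def projY : Weight E r →ₗ[E] Weight E r := (evY E r).smulRight (yTop E r)

theorem xTop_coe : toPoly E r (xTop E r) = ∏ j, X (j, 0) ^ r j := by
  simp [xTop, mono, toPoly_ofPoly]

theorem sigma_xTop (k : GL (Fin 2) R) (hk : red E (k 1 0) = 0) :
    sigma E p r w k (xTop E r) =
      (red E (k.val.det) ^ w * ∏ j : Fin f, (red E (k 0 0) ^ p ^ (j : ℕ)) ^ r j) • xTop E r := by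
  have h (j : Fin f) : p ^ (j : ℕ) ≠ 0 := pow_ne_zero _ (Fact.out : p.Prime).ne_zero
  apply toPoly_injective
  rw [sigma_coe, map_smul, mul_smul, xTop_coe]
  congr 1
  rw [map_prod, smul_eq_C_mul, map_prod, ← Finset.prod_mul_distrib]
  refine Finset.prod_congr rfl fun j _ => ?_
  rw [map_pow, subst, aeval_X]
  simp only [hk, zero_pow (h j), map_zero, zero_mul, add_zero, mul_pow, map_pow]

theorem evX_sigma (k : GL (Fin 2) R) (hk : red E (k 0 1) = 0) (v : Weight E r) :
    evX E r (sigma E p r w k v) =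
      (red E (k.val.det) ^ w * ∏ j : Fin f, (red E (k 0 0) ^ p ^ (j : ℕ)) ^ r j) * evX E r v := by
  have h (j : Fin f) : p ^ (j : ℕ) ≠ 0 := pow_ne_zero _ (Fact.out : p.Prime).ne_zero
  have hv := (mem_weightedHomogeneousSubmodule E _ _ _).1 (toPoly_mem E r v)
  change aeval _ (toPoly E r (sigma E p r w k v)) = _ * aeval _ (toPoly E r v)
  rw [sigma_coe, map_smul, smul_eq_mul, mul_assoc]
  congr 1
  generalize toPoly E r v = v at hv
  rw [v.as_sum]
  simp only [map_sum, Finset.mul_sum]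
  refine Finset.sum_congr rfl fun d hd => ?_
  have hd' := hv (mem_support_iff.1 hd)
  simp only [subst, aeval_monomial, MvPolynomial.algebraMap_eq, map_mul, aeval_C,
    Algebra.algebraMap_self, RingHom.id_apply]
  rw [mul_left_comm]
  congr 1
  rw [Finsupp.prod_fintype _ _ (by simp), Finsupp.prod_fintype _ _ (by simp)]
  rw [map_prod, Fintype.prod_prod_type, Fintype.prod_prod_type, ← Finset.prod_mul_distrib]
  refine Finset.prod_congr rfl fun j _ => ?_
  have hj : r j = d (j, 0) + d (j, 1) := by
    rw [← hd', Finsupp.weight_apply, Finsupp.sum_fintype _ _ (by simp), Fintype.sum_prod_type]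
    simp [Finset.sum_apply, Pi.single_apply, Finset.sum_add_distrib]
  rcases Nat.eq_zero_or_pos (d (j, 1)) with h0 | h0
  · simp [hk, hj, zero_pow (h _), h0]
  · simp [hk, hj, zero_pow (h _), zero_pow h0.ne']

end Weight

section Group

variable {R : Type*} [CommRing R] [IsDomain R] [IsDiscreteValuationRing R]
  (F : Type*) [Field F] [Algebra R F] [IsFractionRing R F] (ϖ : R) [hϖ : Fact (Irreducible ϖ)]

theorem unif_ne_zero : algebraMap R F ϖ ≠ 0 := by
  simpa using hϖ.out.ne_zero

variable (R) in
/-- The embedding of `K = GL₂(R)` into `G = GL₂(F)`. -/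
def inclK : GL (Fin 2) R →* GL (Fin 2) F := GeneralLinearGroup.map (algebraMap R F)

/-- The scalar matrix `ϖ`. -/
def piScalar : GL (Fin 2) F :=
  GeneralLinearGroup.mkOfDetNeZero !![algebraMap R F ϖ, 0; 0, algebraMap R F ϖ]
    (by simp [unif_ne_zero F ϖ])

/-- `α = (1 0; 0 ϖ)`. -/
def alpha : GL (Fin 2) F :=
  GeneralLinearGroup.mkOfDetNeZero !![1, 0; 0, algebraMap R F ϖ] (by simp [unif_ne_zero F ϖ])

/-- `β = α (0 1; 1 0) = (0 1; ϖ 0)`. -/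
def beta : GL (Fin 2) F :=
  GeneralLinearGroup.mkOfDetNeZero !![0, 1; algebraMap R F ϖ, 0] (by simp [unif_ne_zero F ϖ])

/-- `(ϖ^n μ; 0 1)`. -/
def gMat (n : ℕ) (μ : R) : GL (Fin 2) F :=
  GeneralLinearGroup.mkOfDetNeZero !![algebraMap R F ϖ ^ n, algebraMap R F μ; 0, 1]
    (by simp [unif_ne_zero F ϖ])

/-- The element `ϖ^n k` of `KZ`. Since `Fˣ = ϖ^ℤ × Rˣ`, every element of `KZ` has this form, for
unique `k ∈ K` and `n ∈ ℤ`. -/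
def kz (k : GL (Fin 2) R) (n : ℤ) : GL (Fin 2) F := piScalar F ϖ ^ n * inclK R F k

theorem piScalar_comm (g : GL (Fin 2) F) : piScalar F ϖ * g = g * piScalar F ϖ := by
  ext i j
  fin_cases i <;> fin_cases j <;>
    simp [piScalar, Matrix.mul_apply, Fin.sum_univ_two, mul_comm]

theorem piScalar_zpow_comm (n : ℤ) (g : GL (Fin 2) F) :
    piScalar F ϖ ^ n * g = g * piScalar F ϖ ^ n :=
  ((show Commute (piScalar F ϖ) g from piScalar_comm F ϖ g).zpow_left n)

theorem inclK_mul_kz (k l : GL (Fin 2) R) (n : ℤ) :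
    inclK R F k * kz F ϖ l n = kz F ϖ (k * l) n := by
  rw [kz, kz, map_mul, ← mul_assoc, ← mul_assoc, piScalar_zpow_comm]

theorem kz_mul (k l : GL (Fin 2) R) (n m : ℤ) :
    kz F ϖ k n * kz F ϖ l m = kz F ϖ (k * l) (n + m) := by
  rw [kz, mul_assoc, inclK_mul_kz, kz, ← mul_assoc, ← _root_.zpow_add, kz]

theorem kz_one : kz F ϖ (1 : GL (Fin 2) R) 0 = 1 := by simp [kz]

theorem kz_inv (k : GL (Fin 2) R) (n : ℤ) : (kz F ϖ k n)⁻¹ = kz F ϖ k⁻¹ (-n) := by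
  rw [inv_eq_iff_mul_eq_one, kz_mul]
  simp [kz_one]

theorem inclK_injective : Function.Injective (inclK R F) := by
  intro k l h
  ext i j
  have := congrArg (fun g : GL (Fin 2) F => g i j) h
  simpa [inclK] using this

theorem kz_injective {k l : GL (Fin 2) R} {n m : ℤ} (h : kz F ϖ k n = kz F ϖ l m) : k = l := by
  have h1 : kz F ϖ (l⁻¹ * k) (n - m) = 1 := by
    have h2 : (kz F ϖ l m)⁻¹ * kz F ϖ k n = 1 := by rw [h, inv_mul_cancel]
    rw [kz_inv, kz_mul] at h2
    rw [← h2]; congr 1; ring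
  suffices l⁻¹ * k = 1 from (inv_mul_eq_one.1 this).symm
  generalize l⁻¹ * k = x at h1
  generalize n - m = j at h1
  have hu : IsUnit x.val.det := (GeneralLinearGroup.det x).isUnit
  have h2 : algebraMap R F ϖ ^ (2 * j) * algebraMap R F x.val.det = 1 := by
    have h3 := congrArg (fun g : GL (Fin 2) F => (GeneralLinearGroup.det g : F)) h1
    have h4 : (GeneralLinearGroup.det (piScalar F ϖ) : F) = algebraMap R F ϖ ^ (2 : ℤ) := by
      simp [piScalar, sq]
    have h5 : (GeneralLinearGroup.det (inclK R F x) : F) = algebraMap R F x.val.det := by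
      simp [inclK, det_fin_two]
    simp only [kz, map_mul, map_zpow, Units.val_mul, Units.val_zpow_eq_zpow_val, h4, h5, map_one,
      Units.val_one] at h3
    rwa [_root_.zpow_mul]
  have hF := unif_ne_zero F ϖ
  have key : ∀ m : ℕ, IsUnit (ϖ ^ (2 * m)) → m = 0 := fun m hm => by
    by_contra h0
    exact hϖ.out.not_isUnit ((isUnit_pow_iff (by omega)).1 hm)
  have hj : j = 0 := by
    obtain ⟨m, rfl | rfl⟩ := j.eq_nat_or_neg
    · have : ϖ ^ (2 * m) * x.val.det = 1 := by
        apply IsFractionRing.injective R F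
        rw [map_mul, map_pow, map_one, ← h2]
        norm_cast
      rw [key m (IsUnit.of_mul_eq_one _ this), Nat.cast_zero]
    · have : ϖ ^ (2 * m) = x.val.det := by
        apply IsFractionRing.injective R F
        rw [map_pow]
        rw [mul_neg, _root_.zpow_neg, inv_mul_eq_one₀ (zpow_ne_zero _ hF)] at h2
        rw [← h2]
        norm_cast
      rw [key m (this ▸ hu), Nat.cast_zero, neg_zero]
  rw [kz, hj, zpow_zero, one_mul] at h1
  exact inclK_injective F (by rw [h1, map_one])

variable (E : Type*) [Field E] [Algebra (ResidueField R) E] (p : ℕ) [Fact p.Prime] [CharP E p]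
  {f : ℕ} (r : Fin f → ℕ) (w : ℕ)

/-- The compact induction of `σ` from `KZ` to `G`: the functions `φ : G → V_σ` that satisfy
`φ (h g) = σ(h) φ(g)` for `h ∈ KZ`, and whose support is a finite union of cosets `KZ s`. Here `σ`
is extended from `K` to `KZ` by letting the scalar matrix `ϖ` act trivially. -/
def ind : Submodule E (GL (Fin 2) F → Weight E r) where
  carrier := {φ | (∀ (k : GL (Fin 2) R) (n : ℤ) (g : GL (Fin 2) F),
      φ (kz F ϖ k n * g) = sigma E p r w k (φ g)) ∧
    ∃ S : Finset (GL (Fin 2) F), ∀ g, φ g ≠ 0 →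
      ∃ s ∈ S, ∃ (k : GL (Fin 2) R) (n : ℤ), g = kz F ϖ k n * s}
  zero_mem' := ⟨by simp, ∅, by simp⟩
  add_mem' := by
    classical
    rintro φ ψ ⟨hφ, S, hS⟩ ⟨hψ, S', hS'⟩
    refine ⟨fun k n g => by simp [hφ, hψ], S ∪ S', fun g hg => ?_⟩
    by_cases h : φ g = 0
    · obtain ⟨s, hs, h'⟩ := hS' g (by simpa [h] using hg)
      exact ⟨s, Finset.mem_union_right _ hs, h'⟩
    · obtain ⟨s, hs, h'⟩ := hS g h
      exact ⟨s, Finset.mem_union_left _ hs, h'⟩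
  smul_mem' := by
    rintro c φ ⟨hφ, S, hS⟩
    exact ⟨fun k n g => by simp [hφ], S, fun g hg => hS g fun h => hg (by simp [h])⟩

/-- The action of `G` on the compact induction: `(g • φ)(x) = φ(x g)`. -/
def indRep : Representation E (GL (Fin 2) F) (ind F ϖ E p r w) where
  toFun g := LinearMap.restrict (LinearMap.funLeft E (Weight E r) (· * g)) (by
    rintro φ ⟨hφ, S, hS⟩
    classical
    refine ⟨fun k n x => by simp [LinearMap.funLeft_apply, mul_assoc, hφ],
      S.image (· * g⁻¹), fun x hx => ?_⟩
    obtain ⟨s, hs, k, n, h⟩ := hS _ hx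
    exact ⟨s * g⁻¹, Finset.mem_image_of_mem _ hs, k, n, by rw [← mul_assoc, ← h]; simp⟩)
  map_one' := by
    ext φ x
    simp [LinearMap.funLeft_apply]
  map_mul' g h := by
    ext φ x
    simp [LinearMap.funLeft_apply, mul_assoc]

open Classical in
/-- The function on `G` that is `σ` on `KZ` (with `ϖ` acting trivially) and `0` elsewhere. -/
def sigmaKZ (g : GL (Fin 2) F) : Weight E r →ₗ[E] Weight E r :=
  if h : ∃ (k : GL (Fin 2) R) (n : ℤ), g = kz F ϖ k n then sigma E p r w h.choose else 0

theorem sigmaKZ_kz (k : GL (Fin 2) R) (n : ℤ) :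
    sigmaKZ F ϖ E p r w (kz F ϖ k n) = sigma E p r w k := by
  have h : ∃ (k' : GL (Fin 2) R) (n' : ℤ), kz F ϖ k n = kz F ϖ k' n' := ⟨k, n, rfl⟩
  rw [sigmaKZ, dif_pos h]
  obtain ⟨n', h'⟩ := h.choose_spec
  rw [← kz_injective F ϖ h']

/-- The function `g ⊗ v` in the compact induction, supported on `KZ g⁻¹`, with
`(g ⊗ v)(x) = σ(x g) v` there. -/
def tens (g : GL (Fin 2) F) (v : Weight E r) : ind F ϖ E p r w :=
  ⟨fun x => sigmaKZ F ϖ E p r w (x * g) v, by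
    refine ⟨fun k n x => ?_, {g⁻¹}, fun x hx => ?_⟩
    · by_cases h : ∃ (l : GL (Fin 2) R) (m : ℤ), x * g = kz F ϖ l m
      · obtain ⟨l, m, h⟩ := h
        simp only [mul_assoc, h]
        rw [kz_mul, sigmaKZ_kz, sigmaKZ_kz, map_mul, Module.End.mul_apply]
      · have h' : ¬ ∃ (l : GL (Fin 2) R) (m : ℤ), kz F ϖ k n * x * g = kz F ϖ l m := by
          rintro ⟨l, m, h'⟩
          refine h ⟨k⁻¹ * l, -n + m, ?_⟩
          rw [← kz_mul, ← h', ← kz_inv]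
          group
        simp only [sigmaKZ, dif_neg h', dif_neg h]
        simp
    · by_cases h : ∃ (l : GL (Fin 2) R) (m : ℤ), x * g = kz F ϖ l m
      · obtain ⟨l, m, h⟩ := h
        exact ⟨g⁻¹, by simp, l, m, by rw [← h]; group⟩
      · simp [sigmaKZ, dif_neg h] at hx⟩

end Group

section Hecke

variable {R : Type*} [CommRing R] [IsDomain R] [IsDiscreteValuationRing R]
  [HenselianLocalRing R] [Finite (ResidueField R)]
  (F : Type*) [Field F] [Algebra R F] [IsFractionRing R F] (ϖ : R) [hϖ : Fact (Irreducible ϖ)]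
  (E : Type*) [Field E] [Algebra (ResidueField R) E] (p : ℕ) [Fact p.Prime] [CharP E p]
  {f : ℕ} (r : Fin f → ℕ) (w : ℕ)

instance : Fintype (ResidueField R) := Fintype.ofFinite _

/-- `(1 b; 0 1)`. -/
def upper (b : R) : GL (Fin 2) R := GeneralLinearGroup.mk'' !![1, b; 0, 1] (by simp)

variable (R) in
/-- `(0 1; 1 0)`. -/
def weyl : GL (Fin 2) R := GeneralLinearGroup.mk'' !![0, 1; 1, 0] (by simp)

/-- Representatives `α` and `(ϖ [c]; 0 1)`, `c ∈ 𝔽_q`, of the cosets of `KZ` in `KZ α KZ`, indexed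
by the projective line over the residue field. -/
def nbr : OnePoint (ResidueField R) → GL (Fin 2) F
  | OnePoint.infty => alpha F ϖ
  | OnePoint.some c => gMat F ϖ 1 (teich c)

/-- The values at these representatives of the function `ψ : KZ α KZ → End V_σ` with
`ψ(h g h') = σ(h) ψ(g) σ(h')` that takes the value `projX` at `α`. -/
def kern : OnePoint (ResidueField R) → Weight E r →ₗ[E] Weight E r
  | OnePoint.infty => projX E r
  | OnePoint.some c => sigma E p r w (upper (teich c)) ∘ₗ projY E r

/-- `nbr i = aMat i * α * bMat i`. -/
def aMat : OnePoint (ResidueField R) → GL (Fin 2) R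
  | OnePoint.infty => 1
  | OnePoint.some c => upper (teich c) * weyl R

/-- `nbr i = aMat i * α * bMat i`. -/
def bMat : OnePoint (ResidueField R) → GL (Fin 2) R
  | OnePoint.infty => 1
  | OnePoint.some _ => weyl R

theorem nbr_eq (i : OnePoint (ResidueField R)) :
    nbr F ϖ i = inclK R F (aMat i) * alpha F ϖ * inclK R F (bMat i) := by
  match i with
  | OnePoint.infty => simp [nbr, aMat, bMat]
  | OnePoint.some c =>
    ext i j
    fin_cases i <;> fin_cases j <;>
    simp [nbr, aMat, bMat, inclK, gMat, alpha, upper, weyl, Matrix.mul_apply, Fin.sum_univ_two]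

theorem red_eq_zero_iff (x : R) : red E x = 0 ↔ ϖ ∣ x := by
  simp [red, residue_eq_zero_iff, hϖ.out.maximalIdeal_eq, Ideal.mem_span_singleton]

theorem proj_weyl (v : Weight E r) :
    sigma E p r w (weyl R) (projX E r (sigma E p r w (weyl R) v)) = projY E r v := by
  simp only [projX, projY, LinearMap.smulRight_apply, map_smul]
  have h1 : sigma E p r w (weyl R) (xTop E r) = ((-1 : E) ^ w) • yTop E r := by
    apply toPoly_injective
    rw [sigma_coe, map_smul]
    have h (j : Fin f) : p ^ (j : ℕ) ≠ 0 := pow_ne_zero _ (Fact.out : p.Prime).ne_zero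
    simp [weyl, xTop, yTop, mono, toPoly_ofPoly, subst, zero_pow (h _)]
  have h2 : evX E r (sigma E p r w (weyl R) v) = (-1) ^ w * evY E r v := by
    change aeval _ (toPoly E r (sigma E p r w (weyl R) v)) = _ * aeval _ (toPoly E r v)
    rw [sigma_coe, map_smul, smul_eq_mul]
    congr 1
    · simp [weyl]
    · rw [← AlgHom.comp_apply]
      congr 1
      ext ⟨j, i⟩
      have : p ^ (j : ℕ) ≠ 0 := pow_ne_zero _ (Fact.out : p.Prime).ne_zero
      fin_cases i <;> simp [subst, weyl, zero_pow this]
  rw [h1, h2, smul_smul, mul_right_comm, ← mul_pow]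
  simp

theorem kern_eq (i : OnePoint (ResidueField R)) (v : Weight E r) :
    kern E p r w i v =
      sigma E p r w (aMat i) (projX E r (sigma E p r w (bMat i) v)) := by
  match i with
  | OnePoint.infty => simp [kern, aMat, bMat]
  | OnePoint.some c =>
    simp only [kern, aMat, bMat, map_mul, Module.End.mul_apply, proj_weyl, LinearMap.comp_apply]

theorem exists_conj (n : GL (Fin 2) R) (hn : ϖ ∣ n 1 0) :
    ∃ n' : GL (Fin 2) R, inclK R F n * alpha F ϖ = alpha F ϖ * inclK R F n' ∧
      ∀ v, sigma E p r w n (projX E r v) = projX E r (sigma E p r w n' v) := by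
  obtain ⟨c, hc⟩ := hn
  have hdet : IsUnit n.val.det := (GeneralLinearGroup.det n).isUnit
  refine ⟨GeneralLinearGroup.mk'' !![n 0 0, ϖ * n 0 1; c, n 1 1] ?_, ?_, fun v => ?_⟩
  · convert! hdet using 1
    rw [det_fin_two, det_fin_two]
    simp [hc]; ring_nf
  · ext i j
    fin_cases i <;> fin_cases j <;>
    simp [inclK, alpha, Matrix.mul_apply, Fin.sum_univ_two, hc, mul_comm]
  · have h1 : red E (n 1 0) = 0 := (red_eq_zero_iff ϖ E _).2 ⟨c, hc⟩
    rw [projX, LinearMap.smulRight_apply, LinearMap.smulRight_apply, map_smul, sigma_xTop _ _ _ _ _ h1,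
      evX_sigma, smul_smul, mul_comm]
    · congr 4
      rw [GeneralLinearGroup.val_mk'', det_fin_two, det_fin_two_of]
      rw [hc]; ring_nf
    · exact (red_eq_zero_iff ϖ E _).2 ⟨n 0 1, by simp⟩

open Classical in
theorem aMat_smul (i : OnePoint (ResidueField R)) :
    (GeneralLinearGroup.map (residue R) (aMat i)) • (OnePoint.infty : OnePoint (ResidueField R)) = i := by
  match i with
  | OnePoint.infty => simp [aMat]
  | OnePoint.some c =>
    rw [OnePoint.smul_infty_eq_ite]
    simp [aMat, upper, weyl, Matrix.mul_apply, Fin.sum_univ_two, residue_teich]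

open Classical in
theorem nbr_perm (k : GL (Fin 2) R) (i : OnePoint (ResidueField R)) :
    ∃ m : GL (Fin 2) R,
      inclK R F k * nbr F ϖ i =
        nbr F ϖ (GeneralLinearGroup.map (residue R) k • i) * inclK R F m ∧
      ∀ v, sigma E p r w k (kern E p r w i v) =
        kern E p r w (GeneralLinearGroup.map (residue R) k • i) (sigma E p r w m v) := by
  set j := GeneralLinearGroup.map (residue R) k • i with hj
  have h : ϖ ∣ ((aMat j)⁻¹ * k * aMat i : GL (Fin 2) R) 1 0 := by
    rw [← red_eq_zero_iff ϖ (ResidueField R)]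
    have : (GeneralLinearGroup.map (residue R) ((aMat j)⁻¹ * k * aMat i)) •
        (OnePoint.infty : OnePoint (ResidueField R)) = OnePoint.infty := by
      rw [map_mul, map_mul, mul_smul, mul_smul, aMat_smul, ← hj, map_inv, inv_smul_eq_iff, aMat_smul]
    rw [OnePoint.smul_infty_eq_self_iff] at this
    have h2 : (GeneralLinearGroup.map (residue R) ((aMat j)⁻¹ * k * aMat i)) 1 0 =
        residue R (((aMat j)⁻¹ * k * aMat i : GL (Fin 2) R) 1 0) := rfl
    rw [h2] at this
    exact this
  obtain ⟨n', h1, h2⟩ := exists_conj F ϖ E p r w _ h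
  refine ⟨(bMat j)⁻¹ * n' * bMat i, ?_, fun v => ?_⟩
  · rw [nbr_eq, nbr_eq]
    simp only [map_mul, map_inv] at h1 ⊢
    have h3 : inclK R F k * inclK R F (aMat i) * alpha F ϖ =
        inclK R F (aMat j) * (alpha F ϖ * inclK R F n') := by
      rw [← h1]; group
    rw [← mul_assoc, ← mul_assoc, h3]
    group
  · rw [kern_eq, kern_eq]
    have h3 := h2 (sigma E p r w (bMat i) v)
    simp only [map_mul, Module.End.mul_apply] at h3 ⊢
    rw [← Module.End.mul_apply (sigma E p r w (bMat j)), ← map_mul, mul_inv_cancel, map_one,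
      Module.End.one_apply, ← h3, ← Module.End.mul_apply (sigma E p r w (aMat j)), ← map_mul, mul_inv_cancel, map_one,
      Module.End.one_apply]

/-- The formula of the Hecke operator `T`: with `ψ : G → End V_σ` supported on `KZ α KZ`, satisfying
`ψ(h g h') = σ(h) ψ(g) σ(h')` for `h, h' ∈ KZ`, and equal to the projection onto `⨂_j x_j^{r_j}`
at `α` (so to the projection onto `⨂_j y_j^{r_j}` at `α⁻¹` and at `(ϖ 0; 0 1)`), it is
`(T φ)(g) = ∑_{h ∈ G/KZ} ψ(h) φ(h⁻¹ g)`, a sum over `h = (ϖ [c]; 0 1)`, `c ∈ 𝔽_q`, and `h = α`. -/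
def heckeFun (φ : GL (Fin 2) F → Weight E r) (g : GL (Fin 2) F) : Weight E r :=
  ∑ c : ResidueField R, sigma E p r w (upper (teich c)) (projY E r (φ ((gMat F ϖ 1 (teich c))⁻¹ * g))) +
    projX E r (φ ((alpha F ϖ)⁻¹ * g))

theorem heckeFun_eq (φ : GL (Fin 2) F → Weight E r) (g : GL (Fin 2) F) :
    heckeFun F ϖ E p r w φ g = ∑ i, kern E p r w i (φ ((nbr F ϖ i)⁻¹ * g)) := by
  rw [heckeFun, add_comm]
  have h := Fintype.sum_option (fun i : Option (ResidueField R) =>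
    kern E p r w i (φ ((nbr F ϖ i)⁻¹ * g)))
  exact h.symm

theorem alpha_weyl_alpha : alpha F ϖ * inclK R F (weyl R) * alpha F ϖ =
    piScalar F ϖ * inclK R F (weyl R) := by
  have h : (inclK R F (weyl R)).val = !![0, 1; 1, 0] := by
    ext i j
    fin_cases i <;> fin_cases j <;> simp [inclK, weyl]
  refine Units.ext ?_
  rw [Units.val_mul, Units.val_mul, Units.val_mul, h]
  simp [alpha, piScalar]
  exact Algebra.algebraMap_eq_smul_one _

theorem heckeFun_mem {φ : GL (Fin 2) F → Weight E r} (hφ : φ ∈ ind F ϖ E p r w) :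
    heckeFun F ϖ E p r w φ ∈ ind F ϖ E p r w := by
  classical
  obtain ⟨h1, S, hS⟩ := hφ
  refine ⟨fun k n g => ?_, ((Finset.univ : Finset (OnePoint (ResidueField R))) ×ˢ S).image
    fun x => (nbr F ϖ x.1)⁻¹ * x.2, fun g hg => ?_⟩
  · rw [heckeFun_eq, heckeFun_eq, map_sum]
    rw [← Equiv.sum_comp (MulAction.toPerm (GeneralLinearGroup.map (residue R) k))]
    refine Finset.sum_congr rfl fun i _ => ?_
    obtain ⟨m, hm, hm'⟩ := nbr_perm F ϖ E p r w k i
    rw [MulAction.toPerm_apply, hm', ← h1 m n]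
    congr 2
    rw [kz, kz]
    have h3 : (nbr F ϖ (GeneralLinearGroup.map (residue R) k • i))⁻¹ * inclK R F k =
        inclK R F m * (nbr F ϖ i)⁻¹ := by
      rw [inv_mul_eq_iff_eq_mul, ← mul_assoc, ← hm, mul_inv_cancel_right]
    have h4 : (nbr F ϖ (GeneralLinearGroup.map (residue R) k • i))⁻¹ * kz F ϖ k n =
        kz F ϖ m n * (nbr F ϖ i)⁻¹ := by
      rw [kz, kz, ← mul_assoc, ← piScalar_zpow_comm, mul_assoc, h3, mul_assoc]
    change _ * (kz F ϖ k n * g) = kz F ϖ m n * _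
    rw [← mul_assoc, h4, mul_assoc]
  · rw [heckeFun_eq] at hg
    obtain ⟨i, -, hi⟩ := Finset.exists_ne_zero_of_sum_ne_zero hg
    obtain ⟨s, hs, k, n, h⟩ := hS _ (fun h => hi (by rw [h, map_zero]))
    obtain ⟨m, hm, -⟩ := nbr_perm F ϖ E p r w
      (k⁻¹ * (bMat i)⁻¹ * weyl R) (OnePoint.infty : OnePoint (ResidueField R))
    set j := GeneralLinearGroup.map (residue R) (k⁻¹ * (bMat i)⁻¹ * weyl R) •
      (OnePoint.infty : OnePoint (ResidueField R)) with hj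
    refine ⟨(nbr F ϖ j)⁻¹ * s, Finset.mem_image.2 ⟨(j, s), by simp [hs], rfl⟩,
      aMat i * weyl R * m⁻¹, n + 1, ?_⟩
    have h5 : inclK R F (bMat i) * inclK R F k =
        inclK R F (weyl R) * alpha F ϖ * (inclK R F m)⁻¹ * (nbr F ϖ j)⁻¹ := by
      rw [eq_mul_inv_iff_mul_eq, eq_mul_inv_iff_mul_eq, mul_assoc _ (nbr F ϖ j), ← hm]
      simp only [map_mul, map_inv, nbr]
      group
    have h6 : g = nbr F ϖ i * (kz F ϖ k n * s) := by rw [← h]; group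
    have h7 : nbr F ϖ i * kz F ϖ k n = kz F ϖ (aMat i * weyl R * m⁻¹) (n + 1) * (nbr F ϖ j)⁻¹ := by
      rw [kz, nbr_eq, ← mul_assoc, ← piScalar_zpow_comm, mul_assoc, mul_assoc _ _ (inclK R F k), h5,
        kz, _root_.zpow_add, zpow_one, mul_assoc (piScalar F ϖ ^ n), mul_assoc (piScalar F ϖ ^ n)]
      congr 1
      simp only [map_mul, map_inv, ← mul_assoc]
      rw [mul_assoc (inclK R F (aMat i)), mul_assoc (inclK R F (aMat i)), alpha_weyl_alpha F ϖ,
        ← mul_assoc, ← piScalar_comm]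
    rw [h6, ← mul_assoc, h7, mul_assoc]

theorem heckeFun_add (φ ψ : GL (Fin 2) F → Weight E r) :
    heckeFun F ϖ E p r w (φ + ψ) = heckeFun F ϖ E p r w φ + heckeFun F ϖ E p r w ψ := by
  funext g
  simp only [heckeFun, Pi.add_apply, map_add, Finset.sum_add_distrib]
  exact add_add_add_comm _ _ _ _

theorem heckeFun_smul (c : E) (φ : GL (Fin 2) F → Weight E r) :
    heckeFun F ϖ E p r w (c • φ) = c • heckeFun F ϖ E p r w φ := by
  funext g
  simp only [heckeFun, Pi.smul_apply, map_smul, Finset.smul_sum, smul_add]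

/-- The Hecke operator `T`, the generator of `End_G(ind σ) ≅ E[T]`. -/
def hecke : ind F ϖ E p r w →ₗ[E] ind F ϖ E p r w where
  toFun φ := ⟨heckeFun F ϖ E p r w φ.1, heckeFun_mem F ϖ E p r w φ.2⟩
  map_add' φ ψ := Subtype.ext (heckeFun_add F ϖ E p r w φ.1 ψ.1)
  map_smul' c φ := Subtype.ext (heckeFun_smul F ϖ E p r w c φ.1)

theorem hecke_indRep (g : GL (Fin 2) F) (φ : ind F ϖ E p r w) :
    hecke F ϖ E p r w (indRep F ϖ E p r w g φ) = indRep F ϖ E p r w g (hecke F ϖ E p r w φ) := by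
  refine Subtype.ext (funext fun x => ?_)
  change heckeFun F ϖ E p r w (fun y => φ.1 (y * g)) x = heckeFun F ϖ E p r w φ.1 (x * g)
  simp only [heckeFun, mul_assoc]

end Hecke

section Iwahori

variable (R : Type*) [CommRing R] [IsLocalRing R]

/-- The Iwahori subgroup `I`: the matrices in `GL₂(R)` that are upper triangular modulo `ϖ`. -/
def iwahori : Subgroup (GL (Fin 2) R) where
  carrier := {k | residue R (k 1 0) = 0}
  one_mem' := by simp
  mul_mem' {k l} hk hl := by
    simp only [Set.mem_ofPred_eq] at hk hl ⊢
    simp [Matrix.mul_apply, Fin.sum_univ_two, hk, hl]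
  inv_mem' {k} hk := by
    simp only [Set.mem_ofPred_eq] at hk ⊢
    rw [coe_units_inv, inv_def, adjugate_fin_two]
    simp [hk]

/-- The pro-`p` Iwahori subgroup `I(1)`: the matrices in `GL₂(R)` that are upper triangular with
diagonal entries `1` modulo `ϖ`. -/
def iwahoriOne : Subgroup (GL (Fin 2) R) where
  carrier := {k | residue R (k 1 0) = 0 ∧ residue R (k 0 0) = 1 ∧ residue R (k 1 1) = 1}
  one_mem' := by simp
  mul_mem' {k l} hk hl := by
    simp only [Set.mem_ofPred_eq] at hk hl ⊢
    simp [Matrix.mul_apply, Fin.sum_univ_two, hk, hl]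
  inv_mem' {k} hk := by
    have h0 : residue R (k⁻¹ 1 0) = 0 := (iwahori R).inv_mem (x := k) hk.1
    have h1 : k⁻¹.val * k.val = 1 := by simp
    have h2 : k.val * k⁻¹.val = 1 := by simp
    have h3 := congrArg (residue R) (congrFun (congrFun h1 0) 0)
    have h4 := congrArg (residue R) (congrFun (congrFun h2 1) 1)
    simp only [Set.mem_ofPred_eq] at hk ⊢
    simp only [Matrix.mul_apply, Fin.sum_univ_two, map_add, map_mul, hk] at h3 h4
    refine ⟨h0, ?_, ?_⟩
    · simpa using h3
    · simpa using h4

end Iwahori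

section Invariants

variable {R : Type*} [CommRing R] [IsDomain R] [IsDiscreteValuationRing R]
  [HenselianLocalRing R] [Finite (ResidueField R)]
  (F : Type*) [Field F] [Algebra R F] [IsFractionRing R F] (ϖ : R) [hϖ : Fact (Irreducible ϖ)]
  (E : Type*) [Field E] [Algebra (ResidueField R) E] (p : ℕ) [Fact p.Prime] [CharP E p]
  {f : ℕ} (r : Fin f → ℕ) (w : ℕ)

/-- The quotient of the compact induction by the image of `T`. -/
abbrev indModT : Type _ := ind F ϖ E p r w ⧸ LinearMap.range (hecke F ϖ E p r w)

/-- The action of `G` on this quotient. -/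
def indModTRep : Representation E (GL (Fin 2) F) (indModT F ϖ E p r w) :=
  (indRep F ϖ E p r w).quotient (LinearMap.range (hecke F ϖ E p r w)) (by
    rintro g _ ⟨φ, rfl⟩
    exact ⟨indRep F ϖ E p r w g φ, hecke_indRep F ϖ E p r w g φ⟩)

/-- The element `μ = ∑_{i < n} ϖ^i [μ_i]` of `I_n` with the digits `μ_i = d i`. -/
def digitElt {n : ℕ} (d : Fin n → ResidueField R) : R := ∑ i : Fin n, ϖ ^ (i : ℕ) * teich (d i)

/-- The last digit `μ_{n-1}` (for `n ≥ 1`). -/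
def lastDigit {n : ℕ} (d : Fin n → ResidueField R) : ResidueField R :=
  if h : 0 < n then d ⟨n - 1, Nat.sub_lt h one_pos⟩ else 0

/-- `s_n^k = ∑_{μ ∈ I_n} (ϖ^n μ; 0 1) ⊗ μ_{n-1}^k ⨂_j x_j^{r_j}`, for `n ≥ 1`. -/
def sElt (n k : ℕ) : ind F ϖ E p r w :=
  ∑ d : Fin n → ResidueField R, tens F ϖ E p r w (gMat F ϖ n (digitElt ϖ d))
    (algebraMap (ResidueField R) E (lastDigit d) ^ k • xTop E r)

/-- `t_n^k = ∑_{μ ∈ I_n} (ϖ^n μ; 0 1) ⊗ (x_k^{r_k-1} y_k ⊗ ⨂_{j ≠ k} x_j^{r_j})`, for `n ≥ 1`. -/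
def tElt (n : ℕ) (k : Fin f) : ind F ϖ E p r w :=
  ∑ d : Fin n → ResidueField R, tens F ϖ E p r w (gMat F ϖ n (digitElt ϖ d)) (xyTop E r k)

/-- Labels for the elements of the families from which the bases are built. -/
inductive Label (f : ℕ)
  | s (n : ℕ) (l : Fin f)
  | bs (n : ℕ) (l : Fin f)
  | t (n : ℕ) (k : Fin f)
  | bt (n : ℕ) (k : Fin f)
  | one
  | alpha

/-- The element with a given label: `s_n^{p^l (r_l+1)}`, `β s_n^{p^l (r_l+1)}`, `t_n^k`, `β t_n^k`,
`Id ⊗ ⨂_j x_j^{r_j}` or `α ⊗ ⨂_j y_j^{r_j}`. -/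
def basisElt : Label f → ind F ϖ E p r w
  | .s n l => sElt F ϖ E p r w n (p ^ (l : ℕ) * (r l + 1))
  | .bs n l => indRep F ϖ E p r w (beta F ϖ) (sElt F ϖ E p r w n (p ^ (l : ℕ) * (r l + 1)))
  | .t n k => tElt F ϖ E p r w n k
  | .bt n k => indRep F ϖ E p r w (beta F ϖ) (tElt F ϖ E p r w n k)
  | .one => tens F ϖ E p r w 1 (xTop E r)
  | .alpha => tens F ϖ E p r w (alpha F ϖ) (yTop E r)

variable (f) in
/-- `𝒮_m`: all `s_n^{p^l (r_l+1)}` and `β s_n^{p^l (r_l+1)}` with `n ≥ m`. -/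
def labelsS (m : ℕ) : Set (Label f) :=
  {i | ∃ n, m ≤ n ∧ ∃ l, i = Label.s n l ∨ i = Label.bs n l}

variable (f) in
/-- `𝒯_m`: all `t_n^k` and `β t_n^k` with `n ≥ m`. -/
def labelsT (m : ℕ) : Set (Label f) :=
  {i | ∃ n, m ≤ n ∧ ∃ k, i = Label.t n k ∨ i = Label.bt n k}

/-- The images in `ind σ / (T)` of the elements labelled by `A` are an `I`-eigenbasis of the space
of `I(1)`-invariants: `I` acts on each of them through a character, they are linearly independent
(in particular pairwise distinct), and they span the space of `I(1)`-invariants. -/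
def IsIwahoriEigenbasis (A : Set (Label f)) : Prop :=
  let v : Label f → indModT F ϖ E p r w := fun i => Submodule.Quotient.mk (basisElt F ϖ E p r w i)
  let ρ : Representation E (GL (Fin 2) R) (indModT F ϖ E p r w) :=
    (indModTRep F ϖ E p r w).comp (inclK R F)
  (∀ i ∈ A, ∃ χ : iwahori R →* Eˣ, ∀ k : iwahori R, ρ k (v i) = (χ k : E) • v i) ∧
    LinearIndepOn E v A ∧
    Submodule.span E (v '' A) =
      Representation.invariants (ρ.comp (iwahoriOne R).subtype)

end Invariants
end
end ModPGL2

/-!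
# Invariants of the pro-`p` Iwahori subgroup in a supersingular quotient

The vertices of the tree of `GL₂(F)` fall into two halves, interchanged by `β` (`flip`), and the
half containing the base vertex consists of the vertices `(ϖ ^ n, μ; 0, 1)`, with `μ` modulo `ϖ ^
n`. An element `φ` of the compact induction is determined by the two families of *sections* `hat φ
n : R → V_σ` and `hat (flip φ) n` of its values there. A weight vector is in turn identified,
through `genFun`, with a function on the residue field that is a combination of the monomials `a ↦
a ^ (∑ i_j p ^ j)`, `i_j ≤ r_j`. In these terms (`hat_hecke_succ`, `hat_hecke_zero`) the Hecke
operator is the sum of two maps: `outward` carries a section `ψ` of level `n` to the multiple of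
`⨂ x_j ^ r_j` given by the values of its polynomials at the last digit, and is injective; `inward`
only sees the coefficient `evY` of `⨂ y_j ^ r_j`. Hence `T` moves the outermost level of an
element outwards by exactly one (`hat_eq_zero_of_hecke`).

*Eigenvectors.* An element of the Iwahori subgroup acts on levels by a fractional linear
transformation `mob` of `μ`. It changes the last digit of `μ` by an affine map whose constant term
depends on the lower digits; in the ramified case, where Teichmüller representatives add without
carry modulo `ϖ ^ 2`, this constant term is a quadratic function of the last but one digit
(`exists_digit_mob_eq_quadratic`). Accordingly `s_n^{p^l (r_l + 1)}` and `t_n^k` change, up to a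
scalar, by the outward image of a section `ψ`, and this image is `T ψ` as soon as the inward part
of `ψ` vanishes (`sub_mem_range_of_outward`, `isEigen_sElt`, `isEigen_tElt`).

*Spanning.* Let `φ` be invariant modulo `T`, with outermost level `N + 1`. Invariance under the
unipotent elements `(1, b; 0, 1)` says that the translates of this level differ from it by outward
images. Comparing coefficients of polynomial functions on the residue field shows that it is an
outward image plus a combination of `s_{N+1}^{p^l (r_l + 1)}` and `t_{N+1}^k`
(`exists_eq_outward_add`): the exponents `p ^ l * (r l + 1)` are exactly the minimal ones, for the
digitwise order, which are not in the span of the allowed monomials. In the unramified case the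
`t`-part is excluded by the carry `a, b ↦ ∑ (p choose i) / p * a ^ i * b ^ (p - i)`, which is too
large a polynomial to be a coboundary modulo allowed monomials (`eq_zero_of_translate_sub_carry`).
For `f = 1`, the translates of an `s`-part differ from it by the outward image of a section with
nonzero `evY`. On level one this contradicts invariance on the other half of the tree; on higher
levels of the unramified case, `T` has an inward part two levels below, a sum over carries that
does not vanish (`coeff_sSec_zero_eq_zero`, `coeff_sSec_eq_zero_of_unramified`). Subtracting what
was found lowers the support (`exists_sub_vanishesBeyond`), and an induction on both halves of the
tree ends with the two elements of level zero (`mem_of_mem_invMod`).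

*Independence.* If a combination of the listed elements equals `T ψ`, then on each positive level
the outward image of a section is a combination of `s` and `t`. This forces both to vanish
(`eq_zero_of_outward_eq`), by the same comparison of coefficients, so `ψ = 0`
(`linearIndepOn_basisElt`). Each of the four cases is then an instance of
`isIwahoriEigenbasis_levelSet`.
-/

open scoped ValuativeRel MatrixGroups

namespace ModPGL2

open Matrix MvPolynomial IsLocalRing

noncomputable section

set_option linter.unusedSectionVars false

/-! ### Teichmüller digits -/

section Digits

variable {R : Type*} [CommRing R] [IsDomain R] [IsDiscreteValuationRing R]
  [HenselianLocalRing R] [Finite (ResidueField R)] (ϖ : R) [hϖ : Fact (Irreducible ϖ)]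

theorem teich_pow_card (x : ResidueField R) :
    (teich x : R) ^ Nat.card (ResidueField R) = teich x := (exists_teich x).choose_spec.2

theorem natCast_card_residue : residue R (Nat.card (ResidueField R) : R) = 0 := by
  rw [map_natCast, Nat.card_eq_fintype_card, FiniteField.cast_card_eq_zero]

/-- Two roots of `X ^ q - X` with the same residue agree, because the derivative of this polynomial
is a unit. -/
theorem eq_of_pow_card_eq {y z : R} (hy : y ^ Nat.card (ResidueField R) = y)
    (hz : z ^ Nat.card (ResidueField R) = z) (h : residue R y = residue R z) : y = z := by
  set q := Nat.card (ResidueField R) with hq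
  have h1 := Commute.geom_sum₂_mul (Commute.all y z) q
  rw [hy, hz] at h1
  have h2 : residue R (∑ i ∈ Finset.range q, y ^ i * z ^ (q - 1 - i)) = 0 := by
    rw [map_sum]
    have : ∀ i ∈ Finset.range q, residue R (y ^ i * z ^ (q - 1 - i)) = residue R y ^ (q - 1) := by
      intro i hi
      rw [map_mul, map_pow, map_pow, ← h, ← pow_add]
      congr 1
      have := Finset.mem_range.1 hi
      omega
    rw [Finset.sum_congr rfl this, Finset.sum_const, Finset.card_range, nsmul_eq_mul,
      ← map_natCast (residue R), natCast_card_residue, zero_mul]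
  have h3 : IsUnit (1 - ∑ i ∈ Finset.range q, y ^ i * z ^ (q - 1 - i)) := by
    rw [← residue_ne_zero_iff_isUnit, map_sub, h2]
    simp
  have h4 : (y - z) * (1 - ∑ i ∈ Finset.range q, y ^ i * z ^ (q - 1 - i)) = 0 := by
    rw [mul_sub, mul_comm (y - z) (∑ i ∈ _, _), h1]; ring
  exact sub_eq_zero.1 ((mul_eq_zero.1 h4).resolve_right h3.ne_zero)

theorem teich_mul (x y : ResidueField R) : (teich (x * y) : R) = teich x * teich y :=
  eq_of_pow_card_eq (teich_pow_card _) (by rw [mul_pow, teich_pow_card, teich_pow_card])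
    (by simp [residue_teich])

theorem teich_pow (x : ResidueField R) (n : ℕ) : (teich (x ^ n) : R) = teich x ^ n :=
  eq_of_pow_card_eq (teich_pow_card _) (by rw [← pow_mul, mul_comm, pow_mul, teich_pow_card])
    (by simp [residue_teich])

theorem residue_eq_zero_iff_dvd (x : R) : residue R x = 0 ↔ ϖ ∣ x := by
  simp [residue_eq_zero_iff, hϖ.out.maximalIdeal_eq, Ideal.mem_span_singleton]

theorem residue_unif : residue R ϖ = 0 := (residue_eq_zero_iff_dvd ϖ ϖ).2 dvd_rfl

theorem exists_shift (x : R) : ∃ y, x = teich (residue R x) + ϖ * y := by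
  obtain ⟨y, hy⟩ := (residue_eq_zero_iff_dvd ϖ (x - teich (residue R x))).1
    (by simp [residue_teich])
  exact ⟨y, by rw [← hy]; ring⟩

/-- Removal of the lowest Teichmüller digit: `x = [x mod ϖ] + ϖ * shift x`. -/
def shift (x : R) : R := (exists_shift ϖ x).choose

theorem shift_spec (x : R) : x = teich (residue R x) + ϖ * shift ϖ x :=
  (exists_shift ϖ x).choose_spec

theorem shift_eq {x y : R} {a : ResidueField R} (h : x = teich a + ϖ * y) : shift ϖ x = y := by
  have ha : residue R x = a := by rw [h]; simp [residue_teich, residue_unif]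
  have h1 := shift_spec ϖ x
  rw [ha] at h1
  exact mul_left_cancel₀ hϖ.out.ne_zero (add_left_cancel (h1.symm.trans h))

theorem shift_teich (a : ResidueField R) : shift ϖ (teich a) = 0 :=
  shift_eq ϖ (a := a) (by rw [mul_zero, add_zero])

theorem shift_add_mul (x y : R) : shift ϖ (x + ϖ * y) = shift ϖ x + y :=
  shift_eq ϖ (a := residue R x) (by
    conv_lhs => rw [shift_spec ϖ x]
    ring)

/-- `x` without its lowest `n` digits. -/
def tail (n : ℕ) (x : R) : R := (shift ϖ)^[n] x

/-- The Teichmüller digit of `x` at `ϖ ^ n`. -/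
def digit (n : ℕ) (x : R) : ResidueField R := residue R (tail ϖ n x)

/-- The element of `I_n` congruent to `x` modulo `ϖ ^ n`. -/
def low (n : ℕ) (x : R) : R := digitElt ϖ fun i : Fin n => digit ϖ i x

@[simp] theorem tail_zero (x : R) : tail ϖ 0 x = x := rfl

theorem tail_succ (n : ℕ) (x : R) : tail ϖ (n + 1) x = shift ϖ (tail ϖ n x) :=
  Function.iterate_succ_apply' _ _ _

theorem tail_tail (n m : ℕ) (x : R) : tail ϖ n (tail ϖ m x) = tail ϖ (n + m) x :=
  (Function.iterate_add_apply _ _ _ _).symm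

theorem digit_tail (n m : ℕ) (x : R) : digit ϖ n (tail ϖ m x) = digit ϖ (n + m) x := by
  rw [digit, tail_tail, digit]

theorem digit_zero (x : R) : digit ϖ 0 x = residue R x := rfl

theorem low_zero (x : R) : low ϖ 0 x = 0 := by simp [low, digitElt]

theorem low_succ (n : ℕ) (x : R) :
    low ϖ (n + 1) x = low ϖ n x + ϖ ^ n * teich (digit ϖ n x) := by
  simp [low, digitElt, Fin.sum_univ_castSucc]

theorem low_add_tail (n : ℕ) (x : R) : low ϖ n x + ϖ ^ n * tail ϖ n x = x := by
  induction n with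
  | zero => simp [low_zero]
  | succ n ih =>
    rw [low_succ, tail_succ, pow_succ, add_assoc, mul_assoc, ← mul_add, digit, ← shift_spec, ih]

theorem tail_add_mul (n : ℕ) (x y : R) : tail ϖ n (x + ϖ ^ n * y) = tail ϖ n x + y := by
  induction n generalizing y with
  | zero => simp
  | succ n ih => rw [tail_succ, pow_succ, mul_assoc, ih, shift_add_mul, ← tail_succ]

theorem digit_add_mul (n : ℕ) (x y : R) :
    digit ϖ n (x + ϖ ^ n * y) = digit ϖ n x + residue R y := by
  rw [digit, tail_add_mul, map_add, digit]

theorem digit_add_mul_of_lt {i n : ℕ} (h : i < n) (x y : R) :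
    digit ϖ i (x + ϖ ^ n * y) = digit ϖ i x := by
  obtain ⟨m, rfl⟩ := Nat.exists_eq_add_of_lt h
  rw [show ϖ ^ (i + m + 1) * y = ϖ ^ i * (ϖ ^ (m + 1) * y) by ring, digit_add_mul]
  simp [residue_unif]

theorem low_add_mul (n : ℕ) (x y : R) : low ϖ n (x + ϖ ^ n * y) = low ϖ n x := by
  simp only [low]
  congr 1
  funext i
  exact digit_add_mul_of_lt ϖ i.2 x y

theorem low_low (n : ℕ) (x : R) : low ϖ n (low ϖ n x) = low ϖ n x := by
  conv_rhs => rw [← low_add_tail ϖ n x, low_add_mul]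

theorem tail_digitElt {n : ℕ} (d : Fin n → ResidueField R) :
    tail ϖ n (digitElt ϖ d) = 0 ∧ ∀ i : Fin n, digit ϖ i (digitElt ϖ d) = d i := by
  induction n with
  | zero => simp [digitElt]
  | succ n ih =>
    obtain ⟨h1, h2⟩ := ih fun i => d i.castSucc
    have h : digitElt ϖ d = digitElt ϖ (fun i : Fin n => d i.castSucc) +
        ϖ ^ n * teich (d (Fin.last n)) := by simp [digitElt, Fin.sum_univ_castSucc]
    refine ⟨by rw [h, tail_succ, tail_add_mul, h1, zero_add, shift_teich], fun i => ?_⟩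
    refine Fin.lastCases ?_ (fun i => ?_) i
    · rw [h, Fin.val_last, digit_add_mul, digit, h1]; simp [residue_teich]
    · rw [h, Fin.val_castSucc, digit_add_mul_of_lt ϖ i.2, h2]

theorem digit_digitElt {n : ℕ} (d : Fin n → ResidueField R) (i : Fin n) :
    digit ϖ i (digitElt ϖ d) = d i := (tail_digitElt ϖ d).2 i

theorem digit_self_digitElt {n : ℕ} (d : Fin n → ResidueField R) :
    digit ϖ n (digitElt ϖ d) = 0 := by rw [digit, (tail_digitElt ϖ d).1, map_zero]

theorem tail_low (n : ℕ) (x : R) : tail ϖ n (low ϖ n x) = 0 := (tail_digitElt ϖ _).1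

theorem digit_low (n : ℕ) (x : R) : digit ϖ n (low ϖ n x) = 0 := by
  rw [digit, tail_low, map_zero]

theorem low_eq_iff (n : ℕ) (x y : R) : low ϖ n x = low ϖ n y ↔ ϖ ^ n ∣ x - y := by
  constructor
  · intro h
    rw [← low_add_tail ϖ n x, ← low_add_tail ϖ n y, h, add_sub_add_left_eq_sub, ← mul_sub]
    exact dvd_mul_right _ _
  · rintro ⟨z, hz⟩
    rw [sub_eq_iff_eq_add'.1 hz, low_add_mul]

theorem low_digitElt {n : ℕ} (d : Fin n → ResidueField R) :
    low ϖ n (digitElt ϖ d) = digitElt ϖ d := by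
  simp only [low, digit_digitElt]

theorem digitElt_eq_iff {n : ℕ} (d : Fin n → ResidueField R) (x : R) :
    ϖ ^ n ∣ x - digitElt ϖ d ↔ d = fun i : Fin n => digit ϖ i x := by
  rw [← low_eq_iff, low_digitElt]
  constructor
  · intro h
    funext i
    rw [← digit_digitElt ϖ d i, ← h, low, digit_digitElt]
  · rintro rfl
    rfl

/-! ### The second digit of a sum and of a product -/

/-- The digit carried to place one when `[a]` and `[b]` are added. -/
def carry (a b : ResidueField R) : ResidueField R := digit ϖ 1 (teich a + teich b)

theorem digit_one (x : R) : digit ϖ 1 x = residue R (shift ϖ x) := rfl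

theorem digit_one_teich (a : ResidueField R) : digit ϖ 1 (teich a : R) = 0 := by
  rw [digit_one, shift_teich, map_zero]

theorem digit_one_add_mul (x y : R) : digit ϖ 1 (x + ϖ * y) = digit ϖ 1 x + residue R y := by
  rw [digit_one, shift_add_mul, map_add, digit_one]

theorem digit_one_add (x y : R) :
    digit ϖ 1 (x + y) = digit ϖ 1 x + digit ϖ 1 y + carry ϖ (residue R x) (residue R y) := by
  have h : x + y = teich (residue R x) + teich (residue R y) + ϖ * (shift ϖ x + shift ϖ y) := by
    conv_lhs => rw [shift_spec ϖ x, shift_spec ϖ y]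
    ring
  rw [h, digit_one_add_mul, map_add, carry, digit_one, digit_one, digit_one]
  ring

theorem digit_one_mul (x y : R) :
    digit ϖ 1 (x * y) = residue R x * digit ϖ 1 y + residue R y * digit ϖ 1 x := by
  have h : x * y = teich (residue R x * residue R y) + ϖ * (teich (residue R x) * shift ϖ y +
      teich (residue R y) * shift ϖ x + ϖ * (shift ϖ x * shift ϖ y)) := by
    rw [teich_mul]
    conv_lhs => rw [shift_spec ϖ x, shift_spec ϖ y]
    ring
  rw [h, digit_one_add_mul, digit_one_teich]
  simp [residue_teich, residue_unif, digit_one]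

theorem exists_add_pow_eq (p : ℕ) (hp : ϖ ∣ (p : R)) (x z : R) :
    ∃ t, (x + ϖ * z) ^ p = x ^ p + ϖ * (ϖ * t) := by
  obtain ⟨k, hk⟩ := Polynomial.binomExpansion (Polynomial.X ^ p : Polynomial R) x (ϖ * z)
  obtain ⟨u, hu⟩ := hp
  simp only [Polynomial.eval_pow, Polynomial.eval_X, Polynomial.derivative_X_pow,
    Polynomial.eval_mul, Polynomial.eval_C] at hk
  refine ⟨u * x ^ (p - 1) * z + k * z ^ 2, ?_⟩
  rw [hk, hu]
  ring

/-- The carry is given by the Witt polynomial `((X + Y) ^ p - X ^ p - Y ^ p) / p`, evaluated at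
the `p`-th roots of `a` and `b`. -/
theorem carry_eq (p f : ℕ) [hp : Fact p.Prime] [CharP (ResidueField R) p] (hf : 0 < f)
    (hq : Nat.card (ResidueField R) = p ^ f) (ε : R) (hε : (p : R) = ϖ * ε)
    (a b : ResidueField R) :
    carry ϖ a b = -residue R ε * ∑ i ∈ Finset.Ioo 0 p,
      (a ^ p ^ (f - 1)) ^ i * (b ^ p ^ (f - 1)) ^ (p - i) * ((p.choose i / p : ℕ) :
        ResidueField R) := by
  set a' := a ^ p ^ (f - 1) with ha'
  set b' := b ^ p ^ (f - 1) with hb'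
  have hroot : ∀ c : ResidueField R, (c ^ p ^ (f - 1)) ^ p = c := fun c => by
    rw [← pow_mul, ← pow_succ, Nat.sub_add_cancel hf, ← hq, Nat.card_eq_fintype_card,
      FiniteField.pow_card]
  have ha : a' ^ p = a := hroot a
  have hb : b' ^ p = b := hroot b
  have hab : (a' + b') ^ p = a + b := by rw [add_pow_char, ha, hb]
  have h1 : residue R (teich a' + teich b') = a' + b' := by simp [residue_teich]
  have h2 := shift_spec ϖ (teich a' + teich b')
  rw [h1] at h2
  obtain ⟨t, ht⟩ := exists_add_pow_eq ϖ p ⟨ε, hε⟩ (teich (a' + b'))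
    (shift ϖ (teich a' + teich b'))
  rw [← h2, ← teich_pow, hab, add_pow_prime_eq hp.out, ← teich_pow, ha, ← teich_pow, hb, hε] at ht
  have hsum : (teich a' : R) * teich b' * ∑ k ∈ Finset.Ioo 0 p,
      teich a' ^ (k - 1) * teich b' ^ (p - k - 1) * ((p.choose k / p : ℕ) : R) =
      ∑ k ∈ Finset.Ioo 0 p, teich a' ^ k * teich b' ^ (p - k) * ((p.choose k / p : ℕ) : R) := by
    rw [Finset.mul_sum]
    refine Finset.sum_congr rfl fun k hk => ?_
    obtain ⟨h0, h1⟩ := Finset.mem_Ioo.1 hk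
    rw [← pow_sub_one_mul h0.ne' (teich a'), ← pow_sub_one_mul (Nat.sub_pos_of_lt h1).ne'
      (teich b')]
    ring
  have h3 : (teich a + teich b : R) = teich (a + b) + ϖ * (ϖ * t - ε *
      ∑ k ∈ Finset.Ioo 0 p, teich a' ^ k * teich b' ^ (p - k) * ((p.choose k / p : ℕ) : R)) := by
    rw [← hsum]
    linear_combination ht
  rw [carry, h3, digit_one_add_mul, digit_one_teich]
  simp [residue_teich, residue_unif]

theorem carry_eq_zero (p f : ℕ) [hp : Fact p.Prime] [CharP (ResidueField R) p] (hf : 0 < f)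
    (hq : Nat.card (ResidueField R) = p ^ f) (ε : R) (hε : (p : R) = ϖ * ε)
    (h0 : residue R ε = 0) (a b : ResidueField R) : carry ϖ a b = 0 := by
  rw [carry_eq ϖ p f hf hq ε hε, h0, neg_zero, zero_mul]

end Digits

/-! ### Functions on a finite field -/

section Functions

variable {k : Type*} [Field k] [Fintype k] (E : Type*) [Field E] [Algebra k E] (p : ℕ)
  [hp : Fact p.Prime] [CharP E p] {f : ℕ}

/-- The function `a ↦ ∏_m (a ^ (p ^ m)) ^ (i m)` on the finite field `k`, with values in `E`. -/
def monom (i : Fin f → ℕ) (a : k) : E := ∏ m : Fin f, (algebraMap k E a ^ p ^ (m : ℕ)) ^ i m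

theorem monom_zero (a : k) : monom E p (0 : Fin f → ℕ) a = 1 := by simp [monom]

theorem monom_single (l : Fin f) (n : ℕ) (a : k) :
    monom E p (Pi.single l n) a = (algebraMap k E a ^ p ^ (l : ℕ)) ^ n := by
  rw [monom, Finset.prod_eq_single l]
  · simp
  · intro m _ hm
    simp [hm]
  · simp

theorem monom_neg (i : Fin f → ℕ) (a : k) :
    monom E p i (-a) = (-1) ^ (∑ m, i m) * monom E p i a := by
  have h : ∀ m : Fin f, (-1 : E) ^ p ^ (m : ℕ) = -1 := fun m => by
    rw [← iterateFrobenius_def, map_neg, map_one]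
  simp only [monom, map_neg]
  rw [← Finset.prod_pow_eq_pow_sum, ← Finset.prod_mul_distrib]
  refine Finset.prod_congr rfl fun m _ => ?_
  rw [← mul_pow, neg_pow (algebraMap k E a), h]

theorem monom_eq_pow (i : Fin f → Fin p) (a : k) :
    monom E p (fun m => (i m : ℕ)) a = algebraMap k E a ^ (finFunctionFinEquiv i : ℕ) := by
  rw [finFunctionFinEquiv_apply, ← Finset.prod_pow_eq_pow_sum]
  exact Finset.prod_congr rfl fun m _ => by rw [← pow_mul, mul_comm]

variable (f) in
/-- The `q = p ^ f` functions `monom i` with `0 ≤ i m < p` form a basis of the functions on the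
field with `q` elements (a Vandermonde determinant is nonzero). -/
theorem linearIndependent_monom (hq : Nat.card k = p ^ f) :
    LinearIndependent E fun (i : Fin f → Fin p) => (monom E p (fun m => (i m : ℕ)) : k → E) := by
  rw [Fintype.linearIndependent_iff]
  intro g hg
  have e : Fin (p ^ f) ≃ k := (Fintype.equivFinOfCardEq
    (by rw [← hq, Nat.card_eq_fintype_card])).symm
  have h := Matrix.eq_zero_of_forall_index_sum_pow_mul_eq_zero
    (f := fun j => algebraMap k E (e j)) (v := fun j => g (finFunctionFinEquiv.symm j))
    ((algebraMap k E).injective.comp e.injective) (fun j => by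
      have h1 := congrFun hg (e j)
      rw [Finset.sum_apply] at h1
      rw [← Equiv.sum_comp finFunctionFinEquiv]
      refine Eq.trans (Finset.sum_congr rfl fun i _ => ?_) h1
      rw [Pi.smul_apply, smul_eq_mul, monom_eq_pow, Equiv.symm_apply_apply, mul_comm])
  intro i
  have := congrFun h (finFunctionFinEquiv i)
  simpa using this

variable (hq : Nat.card k = p ^ f)

/-- The basis of the functions on `k` that consists of the functions `monom i`, `0 ≤ i m < p`. -/
def monomBasis : Module.Basis (Fin f → Fin p) E (k → E) :=
  have : Nonempty (Fin f → Fin p) := ⟨fun _ => ⟨0, hp.out.pos⟩⟩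
  basisOfLinearIndependentOfCardEqFinrank (linearIndependent_monom E p f hq) (by
    rw [Module.finrank_fintype_fun_eq_card, ← Nat.card_eq_fintype_card (α := k), hq]
    simp)

theorem monomBasis_apply (i : Fin f → Fin p) :
    monomBasis E p hq i = monom E p (fun m => (i m : ℕ)) := by
  simp [monomBasis]

/-- The coefficient of `monom i` in a function on `k`. -/
def coef (i : Fin f → Fin p) : (k → E) →ₗ[E] E := (monomBasis E p hq).coord i

theorem eq_sum_coef (h : k → E) (a : k) :
    h a = ∑ i : Fin f → Fin p, coef E p hq i h * monom E p (fun m => (i m : ℕ)) a := by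
  conv_lhs => rw [← (monomBasis E p hq).sum_repr h]
  rw [Finset.sum_apply]
  exact Finset.sum_congr rfl fun i _ => by rw [Pi.smul_apply, monomBasis_apply]; rfl

open Classical in
theorem coef_monom (i j : Fin f → Fin p) :
    coef E p hq i (monom E p fun m => (j m : ℕ) : k → E) = if j = i then 1 else 0 := by
  rw [← monomBasis_apply E p hq, coef, Module.Basis.coord_apply, Module.Basis.repr_self,
    Finsupp.single_apply]

theorem coef_eq {h : k → E} {c : (Fin f → Fin p) → E}
    (H : ∀ a, h a = ∑ i : Fin f → Fin p, c i * monom E p (fun m => (i m : ℕ)) a)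
    (i : Fin f → Fin p) : coef E p hq i h = c i := by
  classical
  have : h = ∑ i : Fin f → Fin p, c i • monom E p (fun m => (i m : ℕ)) := by
    funext a
    rw [H, Finset.sum_apply]
    rfl
  rw [this, map_sum]
  simp [coef_monom]

theorem eq_of_coef_eq {h h' : k → E} (H : ∀ i, coef E p hq i h = coef E p hq i h') : h = h' := by
  funext a
  rw [eq_sum_coef E p hq h, eq_sum_coef E p hq h']
  simp only [H]

theorem coef_const (i : Fin f → Fin p) (c : E) :
    coef E p hq i (fun _ : k => c) = if ∀ m, (i m : ℕ) = 0 then c else 0 := by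
  classical
  have h : (fun _ : k => c) = c •
      monom E p
        (fun m : Fin f => (((fun _ => ⟨0, hp.out.pos⟩ : Fin f → Fin p) m : Fin p) : ℕ)) := by
    funext b
    exact ((congrArg (c * ·) (monom_zero E p b)).trans (mul_one c)).symm
  rw [h, map_smul, coef_monom, smul_eq_mul, mul_ite, mul_one, mul_zero]
  congr 1
  rw [eq_iff_iff, funext_iff]
  exact forall_congr' fun m => by rw [Fin.ext_iff, eq_comm]

/-- The functions `a ↦ (a ^ (p ^ l)) ^ n` with `n < p` have a single coefficient. -/
theorem coef_pow (l : Fin f) {n : ℕ} (hn : n < p) (i : Fin f → Fin p) :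
    coef E p hq i (fun a : k => (algebraMap k E a ^ p ^ (l : ℕ)) ^ n) =
      if (fun m => (i m : ℕ)) = Pi.single l n then 1 else 0 := by
  classical
  have h : (fun m => (((Pi.single l n : Fin f → ℕ) m : ℕ))) = fun m => (((fun m =>
      ⟨(Pi.single l n : Fin f → ℕ) m, by
        by_cases hm : m = l
        · subst hm; simpa using hn
        · simpa [hm] using hp.out.pos⟩ : Fin f → Fin p) m : ℕ)) := rfl
  have h2 : (fun a : k => (algebraMap k E a ^ p ^ (l : ℕ)) ^ n) =
      monom E p (fun m => ((Pi.single l n : Fin f → ℕ) m : ℕ)) := by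
    funext a
    exact (monom_single E p l n a).symm
  rw [h2, h, coef_monom]
  congr 1
  rw [eq_iff_iff, funext_iff, funext_iff]
  refine forall_congr' fun m => ?_
  rw [Fin.ext_iff, eq_comm]

theorem monom_translate (j : Fin f → ℕ) (hj : ∀ m, j m < p) (a b : k) :
    monom E p j (a + b) = ∑ i : Fin f → Fin p, (∏ m, ((j m).choose (i m) : E)) *
      monom E p (fun m => j m - i m) b * monom E p (fun m => (i m : ℕ)) a := by
  have h : ∀ m : Fin f, (algebraMap k E (a + b) ^ p ^ (m : ℕ)) ^ j m =
      ∑ i : Fin p, ((j m).choose i : E) * (algebraMap k E b ^ p ^ (m : ℕ)) ^ (j m - i) *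
        (algebraMap k E a ^ p ^ (m : ℕ)) ^ (i : ℕ) := fun m => by
    rw [map_add, add_pow_char_pow, add_pow, Fin.sum_univ_eq_sum_range (fun i =>
      ((j m).choose i : E) * (algebraMap k E b ^ p ^ (m : ℕ)) ^ (j m - i) *
        (algebraMap k E a ^ p ^ (m : ℕ)) ^ i) p]
    refine Finset.sum_subset_zero_on_sdiff (Finset.range_mono (hj m)) (fun i hi => ?_)
      (fun i _ => by ring)
    have : j m < i := by simpa using (Finset.mem_sdiff.1 hi).2
    simp [Nat.choose_eq_zero_of_lt this]
  rw [monom, Finset.prod_congr rfl fun m _ => h m, Finset.prod_univ_sum]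
  simp only [Fintype.piFinset_univ, Finset.prod_mul_distrib]
  rfl

theorem coef_translate (h : k → E) (b : k) (i : Fin f → Fin p) :
    coef E p hq i (fun a => h (a + b)) = ∑ j : Fin f → Fin p, coef E p hq j h *
      ((∏ m, ((j m : ℕ).choose (i m) : E)) * monom E p (fun m => (j m : ℕ) - i m) b) := by
  refine coef_eq (c := fun i => ∑ j : Fin f → Fin p, coef E p hq j h *
      ((∏ m, ((j m : ℕ).choose (i m) : E)) * monom E p (fun m => (j m : ℕ) - i m) b))
    E p hq (fun a => ?_) i
  rw [eq_sum_coef E p hq h]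
  simp only [monom_translate E p _ (fun m => (Fin.is_lt _)), Finset.mul_sum, Finset.sum_mul]
  rw [Finset.sum_comm]
  refine Finset.sum_congr rfl fun i _ => Finset.sum_congr rfl fun j _ => ?_
  ring

theorem choose_ne_zero {i j : ℕ} (hij : i ≤ j) (hj : j < p) : ((j.choose i : ℕ) : E) ≠ 0 := by
  rw [Ne, CharP.cast_eq_zero_iff E p]
  intro h
  have h1 : p ∣ j.factorial := by
    rw [← Nat.choose_mul_factorial_mul_factorial hij, mul_assoc]
    exact dvd_mul_of_dvd_left h _
  exact absurd ((hp.out.dvd_factorial).1 h1) (by omega)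

/-- If the coefficient of `monom i` is unchanged by all translations of `h`, then the coefficients
of `h` at all larger exponents vanish. -/
theorem coef_eq_zero_of_translate (h : k → E) (i : Fin f → Fin p)
    (H : ∀ b, coef E p hq i (fun a => h (a + b)) = coef E p hq i h) (j : Fin f → Fin p)
    (hij : ∀ m, i m ≤ j m) (hne : i ≠ j) : coef E p hq j h = 0 := by
  classical
  set t : Fin f → Fin p := fun m => ⟨(j m : ℕ) - i m, by have := (j m).is_lt; omega⟩ with ht
  have h1 := coef_eq (h := fun b => coef E p hq i h) (i := t)
    (c := fun s => if hs : ∀ m, (s m : ℕ) + i m < p then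
      coef E p hq (fun m => ⟨s m + i m, hs m⟩) h *
        (∏ m, ((s m + i m : ℕ).choose (i m) : E)) else 0) E p hq (fun b => by
    rw [← H b, coef_translate]
    refine Finset.sum_bij_ne_zero (fun j _ _ => fun m => ⟨(j m : ℕ) - i m, by
      have := (j m).is_lt; omega⟩) (fun _ _ _ => Finset.mem_univ _) ?_ ?_ ?_
    · have hle : ∀ (j : Fin f → Fin p), coef E p hq j h * ((∏ m, ((j m : ℕ).choose (i m) : E)) *
          monom E p (fun m => (j m : ℕ) - i m) b) ≠ 0 → ∀ m, (i m : ℕ) ≤ j m := fun j hj m => by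
        by_contra hlt
        apply hj
        rw [Finset.prod_eq_zero (Finset.mem_univ m)]
        · ring
        · rw [Nat.choose_eq_zero_of_lt (by omega), Nat.cast_zero]
      intro j₁ _ h₁ j₂ _ h₂ h12
      funext m
      have := congrArg Fin.val (congrFun h12 m)
      have a1 := hle _ h₁ m
      have a2 := hle _ h₂ m
      simp only at this
      ext
      omega
    · intro s _ hs
      by_cases hs' : ∀ m, (s m : ℕ) + i m < p
      · rw [dif_pos hs'] at hs
        refine ⟨fun m => ⟨s m + i m, hs' m⟩, Finset.mem_univ _, ?_, ?_⟩
        · simp only [Nat.add_sub_cancel]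
          rwa [← mul_assoc]
        · funext m
          ext
          simp
      · rw [dif_neg hs'] at hs
        simp at hs
    · intro j _ hj
      have hle : ∀ m, (i m : ℕ) ≤ j m := fun m => by
        by_contra hlt
        apply hj
        rw [Finset.prod_eq_zero (Finset.mem_univ m)]
        · ring
        · rw [Nat.choose_eq_zero_of_lt (by omega), Nat.cast_zero]
      have h3 : ∀ m, ((j m : ℕ) - i m) + i m = j m := fun m => Nat.sub_add_cancel (hle m)
      simp only [h3]
      rw [dif_pos (fun m => (j m).is_lt)]
      ring)
  have h2 : coef E p hq t (fun _ : k => coef E p hq i h) = 0 := by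
    rw [coef_const, if_neg]
    intro h0
    apply hne
    funext m
    have := h0 m
    simp only [ht] at this
    have := Fin.le_def.1 (hij m)
    ext
    omega
  have h3 : ∀ m, ((j m : ℕ) - i m) + i m = j m := fun m => Nat.sub_add_cancel (hij m)
  rw [h2] at h1
  simp only [ht, h3] at h1
  rw [dif_pos (fun m => (j m).is_lt)] at h1
  refine (mul_eq_zero.1 h1.symm).resolve_right ?_
  exact Finset.prod_ne_zero_iff.2 fun m _ => choose_ne_zero E p (hij m) (j m).is_lt

/-- The functions on `k` that are combinations of the `monom i` with `i ≤ r`. -/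
def polySpace (r : Fin f → ℕ) : Submodule E (k → E) where
  carrier := {h | ∀ i : Fin f → Fin p, (∃ m, r m < i m) → coef E p hq i h = 0}
  zero_mem' := fun i _ => map_zero _
  add_mem' := fun ha hb i hi => by rw [map_add, ha i hi, hb i hi, add_zero]
  smul_mem' := fun c h hh i hi => by rw [map_smul, hh i hi, smul_zero]

theorem pow_mem_polySpace {r : Fin f → ℕ} {l : Fin f} {n : ℕ} (hn : n ≤ r l) (hp' : r l < p) :
    (fun a : k => (algebraMap k E a ^ p ^ (l : ℕ)) ^ n) ∈ polySpace E p hq r := by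
  rintro i ⟨m, hm⟩
  rw [coef_pow E p hq l (by omega), if_neg]
  intro h
  have : (i m : ℕ) = (Pi.single l n : Fin f → ℕ) m := congrFun h m
  by_cases hml : m = l
  · subst hml
    rw [Pi.single_eq_same] at this
    omega
  · rw [Pi.single_eq_of_ne hml] at this
    omega

/-- If all differences `h (· + b) - h` lie in `polySpace r`, then modulo `polySpace r` the function
`h` is a combination of the functions `a ↦ a ^ (p ^ l * (r l + 1))`: any other exponent `j ≰ r` lies
strictly above some exponent `i ≰ r`. -/
theorem coef_eq_zero_of_translate_sub_mem (r : Fin f → ℕ) (h : k → E)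
    (H : ∀ b, (fun a => h (a + b)) - h ∈ polySpace E p hq r) (j : Fin f → Fin p)
    (hj : ∃ m, r m < j m) (hj' : ∀ l, (fun m => (j m : ℕ)) ≠ Pi.single l (r l + 1)) :
    coef E p hq j h = 0 := by
  classical
  have key : ∀ i : Fin f → Fin p, (∃ m, r m < i m) → (∀ m, i m ≤ j m) → i ≠ j →
      coef E p hq j h = 0 := fun i hi hle hne =>
    coef_eq_zero_of_translate E p hq h i (fun b => by
      have := H b i hi
      rwa [map_sub, sub_eq_zero] at this) j hle hne
  obtain ⟨l, hl⟩ := hj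
  by_cases h0 : ∃ m, m ≠ l ∧ 0 < (j m : ℕ)
  · obtain ⟨m, hml, hm⟩ := h0
    refine key (Function.update j m ⟨0, hp.out.pos⟩) ⟨l, ?_⟩ (fun s => ?_) (fun heq => ?_)
    · rw [Function.update_of_ne hml.symm]
      exact hl
    · by_cases hs : s = m
      · subst hs
        rw [Function.update_self]
        exact Fin.le_def.2 (Nat.zero_le _)
      · rw [Function.update_of_ne hs]
    · have := congrArg Fin.val (congrFun heq m)
      rw [Function.update_self] at this
      simp only at this
      omega
  · push Not at h0
    have hlt : r l + 1 < j l := by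
      by_contra hle
      refine hj' l (funext fun m => ?_)
      by_cases hm : m = l
      · subst hm
        rw [Pi.single_eq_same]
        omega
      · rw [Pi.single_eq_of_ne hm]
        have := h0 m hm
        omega
    refine key (Function.update j l ⟨r l + 1, by have := (j l).is_lt; omega⟩) ⟨l, ?_⟩
      (fun s => ?_) (fun heq => ?_)
    · rw [Function.update_self]
      exact Nat.lt_succ_self _
    · by_cases hs : s = l
      · subst hs
        rw [Function.update_self]
        exact Fin.le_def.2 hlt.le
      · rw [Function.update_of_ne hs]
    · have := congrArg Fin.val (congrFun heq l)
      rw [Function.update_self] at this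
      simp only at this
      omega

/-- Only the monomial of degree `q - 1` has a nonzero sum over a field with `q` elements. -/
theorem sum_eval_eq (P : Polynomial E) (hP : P.natDegree ≤ Fintype.card k - 1) :
    ∑ a : k, P.eval (algebraMap k E a) = -P.coeff (Fintype.card k - 1) := by
  classical
  have hc : 1 < Fintype.card k := Fintype.one_lt_card
  simp only [Polynomial.eval_eq_sum_range' (Nat.lt_succ_of_le hP)]
  rw [Finset.sum_comm, Finset.sum_range_succ, Finset.sum_eq_zero, zero_add]
  · rw [← Finset.mul_sum]
    have h1 : ∑ a : k, algebraMap k E a ^ (Fintype.card k - 1) = -1 := by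
      have h2 : ∀ a : k, algebraMap k E a ^ (Fintype.card k - 1) = 1 - if a = 0 then 1 else 0 := by
        intro a
        by_cases ha : a = 0
        · subst ha
          rw [map_zero, zero_pow (by omega), if_pos rfl, sub_self]
        · rw [← map_pow, FiniteField.pow_card_sub_one_eq_one a ha]
          simp [ha]
      simp only [h2, Finset.sum_sub_distrib, Finset.sum_const, Finset.card_univ, nsmul_eq_mul,
        mul_one, Finset.sum_ite_eq', Finset.mem_univ, if_true]
      rw [← map_natCast (algebraMap k E), FiniteField.cast_card_eq_zero, map_zero, zero_sub]
    rw [h1]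
    ring
  · intro i hi
    rw [← Finset.mul_sum]
    have h1 : ∑ a : k, algebraMap k E a ^ i = 0 := by
      simp only [← map_pow]
      rw [← map_sum, FiniteField.sum_pow_lt_card_sub_one k i (Finset.mem_range.1 hi), map_zero]
    rw [h1, mul_zero]

end Functions

/-! ### The weight as a space of functions on the residue field -/

section WeightFunctions

variable {R : Type*} [CommRing R] [IsDomain R] [IsDiscreteValuationRing R]
  [HenselianLocalRing R] [Finite (ResidueField R)]
  (E : Type*) [Field E] [Algebra (ResidueField R) E] (p : ℕ) [hp : Fact p.Prime] [CharP E p]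
  {f : ℕ} (r : Fin f → ℕ) (w : ℕ)

theorem red_apply (x : R) : red E x = algebraMap (ResidueField R) E (residue R x) := rfl

theorem sigma_congr {k l : GL (Fin 2) R} (h : ∀ i j, residue R (k i j) = residue R (l i j)) :
    sigma E p r w k = sigma E p r w l := by
  ext1 v
  apply toPoly_injective
  simp only [sigma_coe, subst, det_fin_two, map_sub, map_mul, red_apply, h]

@[simp] theorem upper_apply (c : R) (i j : Fin 2) : (upper c) i j = !![1, c; 0, 1] i j := rfl

theorem upper_zero : upper (0 : R) = 1 := by
  ext i j
  fin_cases i <;> fin_cases j <;> simp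

theorem upper_mul (a b : R) : upper a * upper b = upper (a + b) := by
  ext i j
  fin_cases i <;> fin_cases j <;> simp [Matrix.mul_apply, Fin.sum_univ_two, add_comm]

theorem upper_inv (a : R) : (upper a)⁻¹ = upper (-a) := by
  rw [inv_eq_iff_mul_eq_one, upper_mul, add_neg_cancel, upper_zero]

theorem sigma_upper_add (a b : R) (v : Weight E r) :
    sigma E p r w (upper (a + b)) v = sigma E p r w (upper a) (sigma E p r w (upper b) v) := by
  rw [← upper_mul, map_mul, Module.End.mul_apply]

theorem sigma_upper_congr {a b : R} (h : residue R a = residue R b) :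
    sigma E p r w (upper a) = sigma E p r w (upper b) := by
  apply sigma_congr
  intro i j
  fin_cases i <;> fin_cases j <;> simp [h]

theorem sigma_upper_of_residue_eq_zero {a : R} (h : residue R a = 0) (v : Weight E r) :
    sigma E p r w (upper a) v = v := by
  rw [sigma_upper_congr E p r w (b := 0) (by rw [h, map_zero]), upper_zero, map_one,
    Module.End.one_apply]

theorem sigma_upper_xTop (c : R) : sigma E p r w (upper c) (xTop E r) = xTop E r := by
  rw [sigma_xTop _ _ _ _ _ (by simp)]
  simp [det_fin_two]

theorem evY_sigma_upper (c : R) (v : Weight E r) :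
    evY E r (sigma E p r w (upper c) v) = evY E r v := by
  change aeval _ (toPoly E r (sigma E p r w (upper c) v)) = aeval _ (toPoly E r v)
  rw [sigma_coe, map_smul, show red E (upper c).val.det = 1 by simp [det_fin_two], one_pow,
    one_smul, ← AlgHom.comp_apply]
  congr 1
  ext ⟨j, i⟩
  have : p ^ (j : ℕ) ≠ 0 := pow_ne_zero _ hp.out.ne_zero
  fin_cases i <;> simp [subst, zero_pow this]

theorem sigma_weyl_yTop : sigma E p r w (weyl R) (yTop E r) = ((-1 : E) ^ w) • xTop E r := by
  apply toPoly_injective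
  rw [sigma_coe, map_smul]
  have h (j : Fin f) : p ^ (j : ℕ) ≠ 0 := pow_ne_zero _ hp.out.ne_zero
  simp [weyl, xTop, yTop, mono, toPoly_ofPoly, subst, zero_pow (h _)]

theorem evX_sigma_weyl (v : Weight E r) :
    evX E r (sigma E p r w (weyl R) v) = (-1) ^ w * evY E r v := by
  change aeval _ (toPoly E r (sigma E p r w (weyl R) v)) = _ * aeval _ (toPoly E r v)
  rw [sigma_coe, map_smul, smul_eq_mul]
  congr 1
  · simp [weyl]
  · rw [← AlgHom.comp_apply]
    congr 1
    ext ⟨j, i⟩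
    have : p ^ (j : ℕ) ≠ 0 := pow_ne_zero _ hp.out.ne_zero
    fin_cases i <;> simp [subst, weyl, zero_pow this]

theorem mono_coe (i : (j : Fin f) → Fin (r j + 1)) :
    toPoly E r (mono E r i) = ∏ j, X (j, 0) ^ (r j - i j) * X (j, 1) ^ (i j : ℕ) := rfl

theorem mono_mem_span (v : Weight E r) : v ∈ Submodule.span E (Set.range (mono E r)) := by
  suffices h : toPoly E r v ∈ (Submodule.span E (Set.range (mono E r))).map (toPoly E r) by
    obtain ⟨v', h1, h2⟩ := h
    rwa [← toPoly_injective E r h2]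
  have hv := (mem_weightedHomogeneousSubmodule E _ _ _).1 (toPoly_mem E r v)
  rw [(toPoly E r v).as_sum]
  refine Submodule.sum_mem _ fun d hd => ?_
  have hd' := hv (mem_support_iff.1 hd)
  have hj : ∀ j, r j = d (j, 0) + d (j, 1) := fun j => by
    rw [← hd', Finsupp.weight_apply, Finsupp.sum_fintype _ _ (by simp), Fintype.sum_prod_type]
    simp [Finset.sum_apply, Pi.single_apply, Finset.sum_add_distrib]
  refine ⟨coeff d (toPoly E r v) • mono E r (fun j => ⟨d (j, 1), by rw [hj]; omega⟩),
    Submodule.smul_mem _ _ (Submodule.subset_span ⟨_, rfl⟩), ?_⟩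
  rw [map_smul, mono_coe, monomial_eq, smul_eq_C_mul,
    Finsupp.prod_fintype _ _ (by simp), Fintype.prod_prod_type]
  simp [hj]

theorem evX_mono_sigma_upper (i : (j : Fin f) → Fin (r j + 1)) (c : R) :
    evX E r (sigma E p r w (upper c) (mono E r i)) =
      monom E p (fun j => (i j : ℕ)) (residue R c) := by
  have h (j : Fin f) : p ^ (j : ℕ) ≠ 0 := pow_ne_zero _ hp.out.ne_zero
  change aeval _ (toPoly E r _) = _
  rw [sigma_coe, mono_coe, map_smul]
  simp [det_fin_two, subst, monom, red_apply, zero_pow (h _)]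

/-- The function `a ↦ evX ((1 -a; 0 1) v)` attached to `v ∈ V_σ`. It identifies `V_σ` with the
space of polynomial functions `polySpace r` on the residue field, `(1 c; 0 1)` acting by
translation. -/
def genFun : Weight E r →ₗ[E] (ResidueField R → E) :=
  LinearMap.pi fun a => evX E r ∘ₗ sigma E p r w (upper (-teich a : R))

theorem genFun_apply (v : Weight E r) (a : ResidueField R) :
    genFun E p r w v a = evX E r (sigma E p r w (upper (-teich a : R)) v) := rfl

theorem evX_sigma_upper (c : R) (v : Weight E r) :
    evX E r (sigma E p r w (upper c) v) = genFun (R := R) E p r w v (-residue R c) := by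
  rw [genFun_apply, sigma_upper_congr E p r w (a := c) (b := -teich (-residue R c))
    (by simp [residue_teich])]

theorem genFun_sigma_upper (c : R) (v : Weight E r) (a : ResidueField R) :
    genFun E p r w (sigma E p r w (upper c) v) a = genFun E p r w v (a - residue R c) := by
  rw [genFun_apply, ← sigma_upper_add, evX_sigma_upper]
  refine congrArg _ ?_
  rw [map_add, map_neg, residue_teich]
  ring

theorem genFun_mono (i : (j : Fin f) → Fin (r j + 1)) (a : ResidueField R) :
    genFun E p r w (mono E r i) a = (-1) ^ (∑ j, (i j : ℕ)) * monom E p (fun j => (i j : ℕ)) a := by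
  rw [← neg_neg a, ← residue_teich (R := R) (-a), ← evX_sigma_upper, evX_mono_sigma_upper,
    residue_teich, monom_neg]
  simp

theorem genFun_xTop (a : ResidueField R) : genFun E p r w (xTop E r) a = 1 := by
  rw [xTop, genFun_mono]
  simp [monom]

variable {r}

theorem val_single_one (hr : ∀ j, 0 < r j) (k j : Fin f) :
    (((Pi.single k 1 : (j : Fin f) → Fin (r j + 1)) j : Fin (r j + 1)) : ℕ) =
      (Pi.single k 1 : Fin f → ℕ) j := by
  by_cases h : j = k
  · subst h
    have := hr j
    rw [Pi.single_eq_same, Pi.single_eq_same, Fin.val_one', Nat.mod_eq_of_lt (by omega)]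
  · rw [Pi.single_eq_of_ne h, Pi.single_eq_of_ne h, Fin.val_zero]

theorem genFun_xyTop (hr : ∀ j, 0 < r j) (k : Fin f) (a : ResidueField R) :
    genFun E p r w (xyTop E r k) a = -(algebraMap (ResidueField R) E a ^ p ^ (k : ℕ)) := by
  rw [xyTop, genFun_mono]
  simp only [val_single_one hr]
  rw [monom_single]
  simp

theorem coef_mono (hq : Nat.card (ResidueField R) = p ^ f) (hr : ∀ j, r j < p)
    (i : (j : Fin f) → Fin (r j + 1)) (s : Fin f → Fin p) :
    coef E p hq s (genFun E p r w (mono E r i)) =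
      if (∀ j, (i j : ℕ) = s j) then (-1) ^ (∑ j, (i j : ℕ)) else 0 := by
  classical
  have h : genFun (R := R) E p r w (mono E r i) = (-1 : E) ^ (∑ j, (i j : ℕ)) •
      monom E p (fun j => (((fun j => ⟨i j, by have := (i j).is_le; have := hr j; omega⟩ :
        Fin f → Fin p) j : Fin p) : ℕ)) := by
    funext a
    rw [genFun_mono]
    rfl
  rw [h, map_smul, coef_monom, smul_eq_mul, mul_ite, mul_one, mul_zero]
  congr 1
  rw [eq_iff_iff, funext_iff]
  exact forall_congr' fun j => by rw [Fin.ext_iff]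

theorem genFun_mem (hq : Nat.card (ResidueField R) = p ^ f) (hr : ∀ j, r j < p) (v : Weight E r) :
    genFun E p r w v ∈ polySpace E p hq r := by
  have h := mono_mem_span E r v
  induction h using Submodule.span_induction with
  | mem v hv =>
    obtain ⟨i, rfl⟩ := hv
    rintro s ⟨m, hm⟩
    rw [coef_mono E p w hq hr, if_neg]
    intro h
    have := h m
    have := (i m).is_le
    omega
  | zero => rw [map_zero]; exact zero_mem _
  | add v v' _ _ h h' => rw [map_add]; exact add_mem h h'
  | smul c v _ h => rw [map_smul]; exact Submodule.smul_mem _ _ h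

/-- The inverse of `genFun`: the vector with the coefficients of a given function. -/
def vec (hq : Nat.card (ResidueField R) = p ^ f) (hr : ∀ j, r j < p) (h : ResidueField R → E) :
    Weight E r :=
  ∑ i : (j : Fin f) → Fin (r j + 1), ((-1) ^ (∑ j, (i j : ℕ)) *
    coef E p hq (fun j => ⟨i j, by have := (i j).is_le; have := hr j; omega⟩) h) • mono E r i

theorem genFun_vec (hq : Nat.card (ResidueField R) = p ^ f) (hr : ∀ j, r j < p)
    {h : ResidueField R → E} (hh : h ∈ polySpace E p hq r) :
    genFun E p r w (vec E p hq hr h) = h := by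
  apply eq_of_coef_eq E p hq
  intro s
  rw [vec, map_sum, map_sum]
  simp only [map_smul, coef_mono E p w hq hr, smul_eq_mul]
  by_cases hs : ∀ j, (s j : ℕ) ≤ r j
  · rw [Finset.sum_eq_single (fun j => ⟨s j, Nat.lt_succ_of_le (hs j)⟩)]
    · rw [if_pos (fun j => rfl), mul_right_comm, ← mul_pow]
      simp
    · intro i _ hi
      rw [if_neg, mul_zero]
      intro h'
      apply hi
      funext j
      ext
      exact h' j
    · simp
  · push Not at hs
    obtain ⟨m, hm⟩ := hs
    rw [hh s ⟨m, hm⟩]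
    refine Finset.sum_eq_zero fun i _ => ?_
    rw [if_neg, mul_zero]
    intro h'
    have := h' m
    have := (i m).is_le
    omega

theorem vec_genFun (hq : Nat.card (ResidueField R) = p ^ f) (hr : ∀ j, r j < p) (v : Weight E r) :
    vec E p hq hr (genFun E p r w v) = v := by
  have h := mono_mem_span E r v
  induction h using Submodule.span_induction with
  | mem v hv =>
    obtain ⟨i, rfl⟩ := hv
    rw [vec, Finset.sum_eq_single i]
    · rw [coef_mono E p w hq hr, if_pos (fun j => rfl), ← mul_pow]
      simp
    · intro i' _ hi
      rw [coef_mono E p w hq hr, if_neg, mul_zero, zero_smul]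
      intro h'
      apply hi
      funext j
      ext
      exact (h' j).symm
    · simp
  | zero => simp [vec]
  | add v v' _ _ h h' =>
    refine Eq.trans ?_ (congrArg₂ (· + ·) h h')
    simp only [vec, map_add, mul_add, add_smul, Finset.sum_add_distrib]
  | smul c v _ h =>
    conv_rhs => rw [← h]
    simp only [vec, map_smul, smul_eq_mul, Finset.smul_sum, smul_smul]
    exact Finset.sum_congr rfl fun i _ => by rw [mul_left_comm]

theorem genFun_injective (hq : Nat.card (ResidueField R) = p ^ f) (hr : ∀ j, r j < p) :
    Function.Injective (genFun (R := R) E p r w) :=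
  Function.LeftInverse.injective (vec_genFun E p w hq hr)

theorem evY_eq_coef (hq : Nat.card (ResidueField R) = p ^ f) (hr : ∀ j, r j < p) (v : Weight E r) :
    evY E r v = (-1) ^ (∑ j, r j) * coef E p hq (fun j => ⟨r j, hr j⟩) (genFun E p r w v) := by
  have h := mono_mem_span E r v
  induction h using Submodule.span_induction with
  | mem v hv =>
    obtain ⟨i, rfl⟩ := hv
    rw [coef_mono E p w hq hr]
    have h1 : evY E r (mono E r i) = ∏ j, (0 : E) ^ (r j - i j) := by
      change aeval _ (toPoly E r _) = _
      rw [mono_coe]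
      simp
    rw [h1]
    by_cases hi : ∀ j, (i j : ℕ) = r j
    · rw [if_pos hi]
      simp only [hi, ← mul_pow]
      simp
    · rw [if_neg hi, mul_zero]
      push Not at hi
      obtain ⟨m, hm⟩ := hi
      refine Finset.prod_eq_zero (Finset.mem_univ m) (zero_pow ?_)
      have := (i m).is_le
      omega
  | zero => simp
  | add v v' _ _ h h' => rw [map_add, map_add, map_add, h, h', mul_add]
  | smul c v _ h => rw [map_smul, map_smul, map_smul, h, smul_eq_mul, smul_eq_mul, mul_left_comm]

theorem evY_vec (hq : Nat.card (ResidueField R) = p ^ f) (hr : ∀ j, r j < p)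
    {h : ResidueField R → E} (hh : h ∈ polySpace E p hq r) :
    evY E r (vec E p hq hr h) = (-1) ^ (∑ j, r j) * coef E p hq (fun j => ⟨r j, hr j⟩) h := by
  rw [evY_eq_coef E p 0 hq hr, genFun_vec E p 0 hq hr hh]

theorem evX_xTop : evX E r (xTop E r) = 1 := by
  change aeval _ (toPoly E r _) = _
  rw [xTop_coe]
  simp

theorem evY_xTop {j : Fin f} (hj : 0 < r j) : evY E r (xTop E r) = 0 := by
  change aeval _ (toPoly E r _) = _
  rw [xTop_coe]
  simp only [map_prod, map_pow, aeval_X, if_true]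
  exact Finset.prod_eq_zero (Finset.mem_univ j) (zero_pow hj.ne')

theorem evY_yTop : evY E r (yTop E r) = 1 := by
  change aeval _ (toPoly E r _) = _
  simp [yTop, mono, toPoly_ofPoly]

/-- The vectors whose differences under the upper unipotent matrices are multiples of
`⨂_j x_j^{r_j}`. -/
theorem exists_eq_of_sigma_upper_sub (hq : Nat.card (ResidueField R) = p ^ f) (hr : ∀ j, r j < p)
    (hr0 : ∀ j, 0 < r j) (v : Weight E r)
    (H : ∀ c : R, ∃ e : E, sigma E p r w (upper c) v - v = e • xTop E r) :
    ∃ (a : E) (B : Fin f → E), v = a • xTop E r + ∑ k, B k • xyTop E r k := by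
  have h1 : ∀ b, (fun a => genFun (R := R) E p r w v (a + b)) - genFun E p r w v ∈
      polySpace E p hq (0 : Fin f → ℕ) := by
    intro b
    obtain ⟨e, he⟩ := H (-teich b)
    have h2 := congrArg (genFun (R := R) E p r w) he
    have h3 : (fun a => genFun (R := R) E p r w v (a + b)) - genFun E p r w v = fun _ => e := by
      funext a
      have := congrFun h2 a
      rw [map_sub, Pi.sub_apply, genFun_sigma_upper, map_smul, Pi.smul_apply, genFun_xTop,
        map_neg, residue_teich, sub_neg_eq_add, smul_eq_mul, mul_one] at this
      exact this
    rw [h3]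
    rintro i ⟨m, hm⟩
    rw [coef_const, if_neg fun h => hm.ne' (h m)]
  have hz := coef_eq_zero_of_translate_sub_mem E p hq 0 _ h1
  have hone : 1 < p := hp.out.one_lt
  refine ⟨coef E p hq (fun _ => ⟨0, hp.out.pos⟩) (genFun E p r w v), fun k =>
    -coef E p hq (fun m => ⟨(Pi.single k 1 : Fin f → ℕ) m, by
      by_cases h : m = k
      · subst h; simpa using hone
      · simpa [h] using hp.out.pos⟩) (genFun E p r w v), ?_⟩
  apply genFun_injective E p w hq hr
  apply eq_of_coef_eq E p hq
  intro i
  have hx : genFun (R := R) E p r w (xTop E r) = fun _ => 1 := by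
    funext a
    exact genFun_xTop E p r w a
  have hxy : ∀ k, genFun (R := R) E p r w (xyTop E r k) =
      -(fun a => (algebraMap (ResidueField R) E a ^ p ^ (k : ℕ)) ^ 1) := by
    intro k
    funext a
    rw [genFun_xyTop E p w hr0, Pi.neg_apply, pow_one]
  simp only [map_add, map_smul, map_sum, hx, hxy, map_neg, coef_const, coef_pow E p hq _ hone,
    smul_eq_mul, neg_mul_neg, mul_ite, mul_one, mul_zero]
  by_cases hi0 : ∀ m, (i m : ℕ) = 0
  · obtain rfl : i = fun _ => ⟨0, hp.out.pos⟩ := funext fun m => Fin.ext (hi0 m)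
    rw [if_pos hi0, Finset.sum_eq_zero, add_zero]
    intro k _
    rw [if_neg]
    intro h
    simpa using congrFun h k
  rw [if_neg hi0, zero_add]
  by_cases hi1 : ∃ l, (fun m => (i m : ℕ)) = Pi.single l 1
  · obtain ⟨l, hl⟩ := hi1
    rw [Finset.sum_eq_single l, if_pos hl]
    · congr 2
      funext m
      ext
      exact congrFun hl m
    · intro k _ hk
      rw [if_neg]
      rw [hl]
      intro h
      have := congrFun h k
      rw [Pi.single_eq_same, Pi.single_eq_of_ne hk] at this
      omega
    · simp
  · push Not at hi1
    rw [Finset.sum_eq_zero fun k _ => if_neg (hi1 k)]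
    apply hz
    · by_contra hall
      push Not at hall
      apply hi0
      exact fun m => Nat.le_zero.1 (hall m)
    · intro l
      simpa using hi1 l

/-- The vectors fixed by the upper unipotent matrices. -/
theorem exists_eq_smul_xTop (hq : Nat.card (ResidueField R) = p ^ f) (hr : ∀ j, r j < p)
    (v : Weight E r)
    (H : ∀ c : R, sigma E p r w (upper c) v = v) : ∃ a : E, v = a • xTop E r := by
  refine ⟨coef E p hq (fun _ => ⟨0, hp.out.pos⟩) (genFun E p r w v), ?_⟩
  apply genFun_injective E p w hq hr
  apply eq_of_coef_eq E p hq
  intro i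
  have hx : genFun (R := R) E p r w (xTop E r) = fun _ => 1 := by
    funext a
    exact genFun_xTop E p r w a
  rw [map_smul, map_smul, hx, coef_const, smul_eq_mul]
  by_cases hi0 : ∀ m, (i m : ℕ) = 0
  · obtain rfl : i = fun _ => ⟨0, hp.out.pos⟩ := funext fun m => Fin.ext (hi0 m)
    rw [if_pos hi0, mul_one]
  · rw [if_neg hi0, mul_zero]
    refine coef_eq_zero_of_translate E p hq _ (fun _ => ⟨0, hp.out.pos⟩) (fun b => ?_) i
      (fun m => Fin.le_def.2 (Nat.zero_le _)) (fun h => hi0 fun m => by rw [← h])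
    refine congrArg _ (funext fun a => ?_)
    have := congrFun (congrArg (genFun (R := R) E p r w) (H (-teich b))) a
    rw [genFun_sigma_upper, map_neg, residue_teich, sub_neg_eq_add] at this
    exact this

/-- The diagonal matrices act on `genFun` by a character and by scaling of the variable. -/
theorem genFun_sigma_diag (t : GL (Fin 2) R) (h01 : residue R (t 0 1) = 0)
    (h10 : residue R (t 1 0) = 0) (v : Weight E r) (a : ResidueField R) :
    genFun E p r w (sigma E p r w t v) a =
      (red E t.val.det ^ w * ∏ j : Fin f, (red E (t 0 0) ^ p ^ (j : ℕ)) ^ r j) *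
        genFun E p r w v (residue R (t 1 1) / residue R (t 0 0) * a) := by
  have hdet : residue R (t 0 0) * residue R (t 1 1) ≠ 0 := by
    have h : IsUnit t.val.det := (GeneralLinearGroup.det t).isUnit
    rw [← residue_ne_zero_iff_isUnit, det_fin_two] at h
    simpa [h01] using h
  have h00 := left_ne_zero_of_mul hdet
  have h : sigma E p r w (upper (-teich a)) (sigma E p r w t v) =
      sigma E p r w t (sigma E p r w
        (upper (-teich (residue R (t 1 1) / residue R (t 0 0) * a))) v) := by
    rw [← Module.End.mul_apply, ← Module.End.mul_apply, ← map_mul, ← map_mul]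
    refine congrFun (congrArg _ (sigma_congr E p r w fun i j => ?_)) v
    fin_cases i <;> fin_cases j <;>
      simp [Matrix.mul_apply, Fin.sum_univ_two, residue_teich, h01, h10]
    field_simp
  rw [genFun_apply, h, evX_sigma, genFun_apply]
  rw [red_apply, h01, map_zero]

end WeightFunctions

/-! ### Cosets of `KZ` and the vertices of the tree -/

section Cosets

variable {R : Type*} [CommRing R] [IsDomain R] [IsDiscreteValuationRing R]
  (F : Type*) [Field F] [Algebra R F] [IsFractionRing R F] (ϖ : R) [hϖ : Fact (Irreducible ϖ)]

theorem gMat_val (n : ℕ) (μ : R) :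
    (gMat F ϖ n μ).val = !![algebraMap R F ϖ ^ n, algebraMap R F μ; 0, 1] := rfl

theorem alpha_val : (alpha F ϖ).val = !![1, 0; 0, algebraMap R F ϖ] := rfl

theorem beta_val : (beta F ϖ).val = !![0, 1; algebraMap R F ϖ, 0] := rfl

theorem piScalar_val : (piScalar F ϖ).val = !![algebraMap R F ϖ, 0; 0, algebraMap R F ϖ] := rfl

variable {ϖ} in
theorem inclK_val (k : GL (Fin 2) R) : (inclK R F k).val =
    !![algebraMap R F (k 0 0), algebraMap R F (k 0 1);
      algebraMap R F (k 1 0), algebraMap R F (k 1 1)] := by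
  ext i j
  fin_cases i <;> fin_cases j <;> rfl

theorem upper_val (c : R) : (upper c).val = !![1, c; 0, 1] := rfl

theorem piScalar_zpow_val (j : ℤ) : (piScalar F ϖ ^ j).val =
    !![algebraMap R F ϖ ^ j, 0; 0, algebraMap R F ϖ ^ j] := by
  have h : piScalar F ϖ = Units.map (scalar (Fin 2)).toMonoidHom
      (Units.mk0 (algebraMap R F ϖ) (unif_ne_zero F ϖ)) := by
    refine Units.ext ?_
    rw [piScalar_val]
    ext i j
    fin_cases i <;> fin_cases j <;> simp
  rw [h, ← map_zpow, Units.coe_map, Units.val_zpow_eq_zpow_val]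
  ext i j
  fin_cases i <;> fin_cases j <;> simp

theorem kz_val (k : GL (Fin 2) R) (j : ℤ) : (kz F ϖ k j).val =
    !![algebraMap R F ϖ ^ j * algebraMap R F (k 0 0), algebraMap R F ϖ ^ j * algebraMap R F (k 0 1);
      algebraMap R F ϖ ^ j * algebraMap R F (k 1 0),
      algebraMap R F ϖ ^ j * algebraMap R F (k 1 1)] := by
  rw [kz, Units.val_mul, piScalar_zpow_val, inclK_val]
  simp

theorem gMat_add_mul (n : ℕ) (μ c : R) :
    gMat F ϖ n (μ + ϖ ^ n * c) = gMat F ϖ n μ * inclK R F (upper c) := by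
  refine Units.ext ?_
  rw [Units.val_mul, gMat_val, gMat_val, inclK_val]
  ext i j
  fin_cases i <;> fin_cases j <;> simp [upper_val, Matrix.mul_apply, Fin.sum_univ_two, add_comm,
    mul_comm]

theorem gMat_mul_gMat_one (n : ℕ) (μ c : R) :
    gMat F ϖ n μ * gMat F ϖ 1 c = gMat F ϖ (n + 1) (μ + ϖ ^ n * c) := by
  refine Units.ext ?_
  rw [Units.val_mul, gMat_val, gMat_val, gMat_val]
  ext i j
  fin_cases i <;> fin_cases j <;> simp [pow_succ, Matrix.mul_apply, Fin.sum_univ_two, add_comm,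
    mul_comm]

theorem gMat_succ_mul_alpha (n : ℕ) (μ : R) :
    gMat F ϖ (n + 1) μ * alpha F ϖ = piScalar F ϖ * gMat F ϖ n μ := by
  refine Units.ext ?_
  rw [Units.val_mul, Units.val_mul, gMat_val, gMat_val, piScalar_val, alpha_val]
  ext i j
  fin_cases i <;> fin_cases j <;> simp [pow_succ, Matrix.mul_apply, Fin.sum_univ_two, add_comm,
    mul_comm]

theorem beta_mul_weyl : beta F ϖ * inclK R F (weyl R) = alpha F ϖ := by
  refine Units.ext ?_
  rw [Units.val_mul, beta_val, alpha_val, inclK_val]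
  ext i j
  fin_cases i <;> fin_cases j <;> simp [weyl, Matrix.mul_apply, Fin.sum_univ_two, add_comm,
    mul_comm]

theorem beta_mul_beta : beta F ϖ * beta F ϖ = piScalar F ϖ := by
  refine Units.ext ?_
  rw [Units.val_mul, beta_val, piScalar_val]
  ext i j
  fin_cases i <;> fin_cases j <;> simp [Matrix.mul_apply, Fin.sum_univ_two, add_comm, mul_comm]

theorem gMat_zero (μ : R) : gMat F ϖ 0 μ = inclK R F (upper μ) := by
  refine Units.ext ?_
  rw [gMat_val, inclK_val]
  simp [upper_val]

theorem gMat_zero_mul_alpha (μ : R) :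
    gMat F ϖ 0 μ * alpha F ϖ = beta F ϖ * inclK R F (weyl R * upper (ϖ * μ)) := by
  rw [map_mul, ← mul_assoc, beta_mul_weyl]
  refine Units.ext ?_
  rw [Units.val_mul, Units.val_mul, gMat_val, alpha_val, inclK_val]
  ext i j
  fin_cases i <;> fin_cases j <;> simp [upper_val, Matrix.mul_apply, Fin.sum_univ_two, add_comm,
    mul_comm]

theorem kz_zero (k : GL (Fin 2) R) : kz F ϖ k 0 = inclK R F k := by simp [kz]

variable {ϖ} in
theorem isUnit_det' (k : GL (Fin 2) R) : IsUnit (k 0 0 * k 1 1 - k 0 1 * k 1 0) := by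
  have h : IsUnit k.val.det := (GeneralLinearGroup.det k).isUnit
  rwa [det_fin_two] at h

/-- If `ϖ ^ j` times a unit is integral, then `j ≥ 0`. -/
theorem zpow_nonneg_of_integral {v c : R} (hv : IsUnit v) {j : ℤ}
    (h : algebraMap R F ϖ ^ j * algebraMap R F v = algebraMap R F c) : 0 ≤ j := by
  by_contra hj
  push Not at hj
  obtain ⟨m, hm⟩ := Int.exists_eq_neg_ofNat hj.le
  have h0 := unif_ne_zero F ϖ
  rw [hm, _root_.zpow_neg, zpow_natCast, inv_mul_eq_iff_eq_mul₀ (pow_ne_zero _ h0), ← map_pow,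
    ← map_mul] at h
  have h1 := IsFractionRing.injective R F h
  rw [h1] at hv
  have := (isUnit_of_mul_isUnit_left hv)
  rw [isUnit_pow_iff (by omega)] at this
  exact hϖ.out.not_isUnit this

theorem zpow_eq_zero_of_isUnit {v c : R} (hv : IsUnit v) (hc : IsUnit c) {j : ℤ}
    (h : algebraMap R F ϖ ^ j * algebraMap R F v = algebraMap R F c) : j = 0 := by
  have h1 := zpow_nonneg_of_integral F ϖ hv h
  have h2 : 0 ≤ -j := by
    apply zpow_nonneg_of_integral F ϖ hc (c := v)
    rw [← h, ← mul_assoc, ← zpow_add₀ (unif_ne_zero F ϖ), neg_add_cancel, zpow_zero, one_mul]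
  omega

theorem gMat_eq_gMat_mul_kz {m n : ℕ} {μ ν : R} {k : GL (Fin 2) R} {j : ℤ}
    (h : gMat F ϖ n ν = gMat F ϖ m μ * kz F ϖ k j) : m = n ∧ ϖ ^ m ∣ ν - μ := by
  have h0 := unif_ne_zero F ϖ
  have h1 := congrArg Units.val h
  rw [Units.val_mul, gMat_val, gMat_val, kz_val] at h1
  have h00 := congrFun (congrFun h1 0) 0
  have h01 := congrFun (congrFun h1 0) 1
  have h10 := congrFun (congrFun h1 1) 0
  have h11 := congrFun (congrFun h1 1) 1
  simp only [Matrix.mul_apply, Fin.sum_univ_two, of_apply, cons_val', cons_val_zero, cons_val_one,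
    cons_val_fin_one, zero_mul, one_mul, zero_add] at h00 h01 h10 h11
  have hk10 : k 1 0 = 0 := by
    have := (mul_eq_zero.1 h10.symm).resolve_left (zpow_ne_zero _ h0)
    simpa using this
  have hdet := isUnit_det' k
  rw [hk10, mul_zero, sub_zero, IsUnit.mul_iff] at hdet
  have hj : j = 0 := zpow_eq_zero_of_isUnit F ϖ hdet.2 isUnit_one (by rw [map_one, ← h11])
  subst hj
  rw [zpow_zero, one_mul, one_mul, hk10, map_zero, mul_zero, add_zero] at h00
  rw [zpow_zero, one_mul] at h11
  rw [zpow_zero, one_mul, one_mul, ← h11, mul_one] at h01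
  have hmn : (n : ℤ) - m = 0 := by
    apply zpow_eq_zero_of_isUnit F ϖ isUnit_one hdet.1
    rw [map_one, mul_one, zpow_sub₀ h0, zpow_natCast, zpow_natCast, h00]
    field_simp
  refine ⟨by omega, k 0 1, ?_⟩
  apply IsFractionRing.injective R F
  rw [map_sub, map_mul, map_pow, h01]
  ring

theorem beta_mul_gMat_ne {m n : ℕ} {μ ν : R} {k : GL (Fin 2) R} {j : ℤ} :
    beta F ϖ * gMat F ϖ n ν ≠ gMat F ϖ m μ * kz F ϖ k j := by
  intro h
  have h0 := unif_ne_zero F ϖ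
  have h1 := congrArg Units.val h
  have hd := congrArg Matrix.det h1
  rw [Units.val_mul, Units.val_mul, gMat_val, gMat_val, beta_val, kz_val] at h1
  have h01 := congrFun (congrFun h1 0) 1
  have h10 := congrFun (congrFun h1 1) 0
  have h11 := congrFun (congrFun h1 1) 1
  simp only [Matrix.mul_apply, Fin.sum_univ_two, of_apply, cons_val', cons_val_zero, cons_val_one,
    cons_val_fin_one, zero_mul, one_mul, zero_add, add_zero, mul_zero] at h01 h10 h11
  rw [Units.val_mul, Units.val_mul, gMat_val, gMat_val, beta_val, kz_val, det_mul, det_mul] at hd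
  simp only [det_fin_two_of, mul_zero, mul_one, sub_zero, zero_sub] at hd
  have hu : IsUnit (1 - ϖ * μ * ν) := by
    rw [← residue_ne_zero_iff_isUnit]
    have : residue R ϖ = 0 := by
      simp [residue_eq_zero_iff, hϖ.out.maximalIdeal_eq]
    simp [this]
  have e1 : 0 ≤ -(m + j : ℤ) := by
    apply zpow_nonneg_of_integral F ϖ hu (c := k 0 1)
    rw [map_sub, map_one, map_mul, map_mul]
    rw [← h11] at h01
    rw [_root_.zpow_neg, inv_mul_eq_iff_eq_mul₀ (zpow_ne_zero _ h0), zpow_add₀ h0, zpow_natCast]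
    linear_combination h01
  have e2 : 0 ≤ (n + 1 - j : ℤ) := by
    apply zpow_nonneg_of_integral F ϖ isUnit_one (c := k 1 0)
    rw [map_one, mul_one, zpow_sub₀ h0, div_eq_iff (zpow_ne_zero _ h0)]
    rw [zpow_add₀ h0, zpow_one, zpow_natCast]
    linear_combination h10
  have e3 : (n + 1 - (m + 2 * j) : ℤ) = 0 := by
    apply zpow_eq_zero_of_isUnit F ϖ isUnit_one (isUnit_det' k).neg
    rw [map_one, mul_one, zpow_sub₀ h0, div_eq_iff (zpow_ne_zero _ h0)]
    rw [zpow_add₀ h0, zpow_one, zpow_natCast, two_mul, zpow_add₀ h0, zpow_add₀ h0, zpow_natCast,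
      map_neg, map_sub, map_mul, map_mul]
    linear_combination -hd
  omega

/-- Every nonzero element of `F` is a power of `ϖ` times a unit. -/
theorem exists_zpow_mul_unit {x : F} (hx : x ≠ 0) :
    ∃ (j : ℤ) (v : R), IsUnit v ∧ x = algebraMap R F ϖ ^ j * algebraMap R F v := by
  obtain ⟨a, b, hb, rfl⟩ := IsFractionRing.div_surjective (A := R) x
  have hb' : b ≠ 0 := nonZeroDivisors.ne_zero hb
  have ha' : a ≠ 0 := by
    rintro rfl
    simp at hx
  obtain ⟨n, u, rfl⟩ := IsDiscreteValuationRing.eq_unit_mul_pow_irreducible ha' hϖ.out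
  obtain ⟨m, v, rfl⟩ := IsDiscreteValuationRing.eq_unit_mul_pow_irreducible hb' hϖ.out
  have h0 := unif_ne_zero F ϖ
  refine ⟨n - m, (u * v⁻¹ : Rˣ), Units.isUnit _, ?_⟩
  have hv : algebraMap R F (v : R) * algebraMap R F ((v⁻¹ : Rˣ) : R) = 1 := by
    rw [← map_mul, Units.mul_inv, map_one]
  have hv0 : algebraMap R F (v : R) ≠ 0 := left_ne_zero_of_mul_eq_one hv
  rw [div_eq_iff (by simpa using hb'), zpow_sub₀ h0, Units.val_mul, map_mul, map_mul, map_mul,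
    map_pow, map_pow, zpow_natCast, zpow_natCast]
  field_simp
  linear_combination -hv

theorem exists_mul_or_exists_mul (a b : F) :
    (∃ c : R, b = algebraMap R F c * a) ∨ ∃ c : R, a = algebraMap R F c * b := by
  by_cases ha : a = 0
  · exact Or.inr ⟨0, by simp [ha]⟩
  by_cases hb : b = 0
  · exact Or.inl ⟨0, by simp [hb]⟩
  rcases ValuationRing.isInteger_or_isInteger R (b / a) with ⟨c, hc⟩ | ⟨c, hc⟩
  · exact Or.inl ⟨c, by rw [hc]; field_simp⟩
  · exact Or.inr ⟨c, by rw [hc]; field_simp⟩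

/-- The cosets `(ϖ^n μ; 0 1) KZ`: they consist of the matrices whose lower right entry divides
all others, up to the right multiplication by elements of `KZ`. -/
theorem exists_gMat_mul_kz_of_dvd (h : GL (Fin 2) F) {a b c : R}
    (h00 : h 0 0 = algebraMap R F a * h 1 1) (h01 : h 0 1 = algebraMap R F b * h 1 1)
    (h10 : h 1 0 = algebraMap R F c * h 1 1) :
    ∃ (n : ℕ) (μ : R) (k : GL (Fin 2) R) (j : ℤ), h = gMat F ϖ n μ * kz F ϖ k j := by
  have hdet : h.val.det ≠ 0 := (GeneralLinearGroup.det h).ne_zero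
  have h11 : h 1 1 ≠ 0 := by
    intro h0
    apply hdet
    rw [det_fin_two, h01, h0]
    ring
  obtain ⟨j, v, hv, hj⟩ := exists_zpow_mul_unit F ϖ h11
  have hne : a - b * c ≠ 0 := by
    intro h0
    apply hdet
    rw [det_fin_two, h00, h01, h10]
    have : algebraMap R F a - algebraMap R F b * algebraMap R F c = 0 := by
      rw [← map_mul, ← map_sub, h0, map_zero]
    linear_combination (h 1 1 * h 1 1) * this
  obtain ⟨n, u, hu⟩ := IsDiscreteValuationRing.eq_unit_mul_pow_irreducible hne hϖ.out
  refine ⟨n, b, GeneralLinearGroup.mk'' !![u * v, 0; c * v, v] ?_, j, Units.ext ?_⟩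
  · rw [det_fin_two_of]
    simpa using (u.isUnit.mul hv).mul hv
  · have ha : algebraMap R F a = algebraMap R F (u : R) * algebraMap R F ϖ ^ n +
        algebraMap R F b * algebraMap R F c := by
      rw [← map_mul, ← map_pow, ← map_mul, ← map_add, ← hu]
      congr 1
      ring
    rw [Units.val_mul, gMat_val, kz_val, eta_fin_two h.val, h00, h01, h10, ha, hj]
    ext i j
    fin_cases i <;> fin_cases j <;>
      simp [Matrix.mul_apply, Fin.sum_univ_two] <;> ring

theorem exists_beta_mul_gMat_mul_kz_of_dvd (h : GL (Fin 2) F) {a b c : R}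
    (h00 : h 0 0 = algebraMap R F a * h 0 1)
    (h11 : h 1 1 = algebraMap R F b * (algebraMap R F ϖ * h 0 1))
    (h10 : h 1 0 = algebraMap R F c * (algebraMap R F ϖ * h 0 1)) :
    ∃ (n : ℕ) (μ : R) (k : GL (Fin 2) R) (j : ℤ), h = beta F ϖ * gMat F ϖ n μ * kz F ϖ k j := by
  obtain ⟨n, μ, k, j, hk⟩ := exists_gMat_mul_kz_of_dvd F ϖ (beta F ϖ * h) (a := c) (b := b) (c := a)
    (by simp [beta_val, Matrix.mul_apply, Fin.sum_univ_two, h10])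
    (by simp [beta_val, Matrix.mul_apply, Fin.sum_univ_two, h11])
    (by simp [beta_val, Matrix.mul_apply, Fin.sum_univ_two, h00]; ring)
  refine ⟨n, μ, k, -1 + j, ?_⟩
  have h1 : kz F ϖ k (-1 + j) = (piScalar F ϖ)⁻¹ * kz F ϖ k j := by
    rw [kz, kz, _root_.zpow_add, _root_.zpow_neg_one, mul_assoc]
  have h2 : Commute (piScalar F ϖ)⁻¹ (gMat F ϖ n μ) :=
    (show Commute (piScalar F ϖ) (gMat F ϖ n μ) from piScalar_comm F ϖ _).inv_left
  rw [h1, ← mul_assoc, mul_assoc (beta F ϖ), ← h2.eq, mul_assoc, mul_assoc, ← hk, ← beta_mul_beta]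
  group

/-- Every element of `G` lies in a coset `(ϖ^n μ; 0 1) KZ` or `β (ϖ^n μ; 0 1) KZ`. -/
theorem exists_coset (h : GL (Fin 2) F) :
    ∃ (n : ℕ) (μ : R) (k : GL (Fin 2) R) (j : ℤ), h = gMat F ϖ n μ * kz F ϖ k j ∨
      h = beta F ϖ * gMat F ϖ n μ * kz F ϖ k j := by
  have h0 := unif_ne_zero F ϖ
  -- up to a swap of the columns the lower right entry divides the lower left entry
  wlog hz : ∃ c : R, h 1 0 = algebraMap R F c * h 1 1 generalizing h
  · obtain ⟨n, μ, k, j, hk⟩ := this (h * inclK R F (weyl R)) (by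
      have := (exists_mul_or_exists_mul F (h 1 0) (h 1 1) (R := R)).resolve_right hz
      simpa [inclK_val, weyl, Matrix.mul_apply, Fin.sum_univ_two] using this)
    refine ⟨n, μ, k * (weyl R)⁻¹, j, ?_⟩
    have e : kz F ϖ (k * (weyl R)⁻¹) j = kz F ϖ k j * (inclK R F (weyl R))⁻¹ := by
      rw [← map_inv, ← kz_zero F ϖ, kz_mul, add_zero]
    rw [e, ← mul_assoc, ← mul_assoc, eq_mul_inv_iff_mul_eq, eq_mul_inv_iff_mul_eq]
    exact hk
  obtain ⟨c, hc⟩ := hz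
  have hdet : h.val.det ≠ 0 := (GeneralLinearGroup.det h).ne_zero
  -- if an entry `y` of the first row is not a multiple of the entry `t`, then `ϖ y` divides `t`
  have hstrict : ∀ y : F, (¬ ∃ s : R, y = algebraMap R F s * h 1 1) →
      ∃ s : R, h 1 1 = algebraMap R F s * (algebraMap R F ϖ * y) := by
    intro y hy
    obtain ⟨s, hs⟩ := (exists_mul_or_exists_mul F y (h 1 1) (R := R)).resolve_right hy
    have hs' : ¬ IsUnit s := by
      rintro ⟨u, rfl⟩
      refine hy ⟨(u⁻¹ : Rˣ), ?_⟩
      rw [hs, ← mul_assoc, ← map_mul, Units.inv_mul, map_one, one_mul]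
    have : ϖ ∣ s := by
      rw [← mem_nonunits_iff, ← mem_maximalIdeal, hϖ.out.maximalIdeal_eq,
        Ideal.mem_span_singleton] at hs'
      exact hs'
    obtain ⟨s', rfl⟩ := this
    exact ⟨s', by rw [hs, map_mul]; ring⟩
  by_cases hx : ∃ a : R, h 0 0 = algebraMap R F a * h 1 1
  · by_cases hy : ∃ b : R, h 0 1 = algebraMap R F b * h 1 1
    · obtain ⟨a, ha⟩ := hx
      obtain ⟨b, hb⟩ := hy
      obtain ⟨n, μ, k, j, hk⟩ := exists_gMat_mul_kz_of_dvd F ϖ h ha hb hc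
      exact ⟨n, μ, k, j, Or.inl hk⟩
    · obtain ⟨a, ha⟩ := hx
      obtain ⟨s, hs⟩ := hstrict _ hy
      obtain ⟨n, μ, k, j, hk⟩ := exists_beta_mul_gMat_mul_kz_of_dvd F ϖ h (a := a * s * ϖ) (b := s)
        (c := c * s) (by rw [ha, hs]; simp only [map_mul]; ring) hs
        (by rw [hc, hs]; simp only [map_mul]; ring)
      exact ⟨n, μ, k, j, Or.inr hk⟩
  · obtain ⟨s, hs⟩ := hstrict _ hx
    rcases exists_mul_or_exists_mul F (h 0 0) (h 0 1) (R := R) with ⟨b, hb⟩ | ⟨b, hb⟩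
    · obtain ⟨n, μ, k, j, hk⟩ := exists_beta_mul_gMat_mul_kz_of_dvd F ϖ (h * inclK R F (weyl R))
        (a := b) (b := c * s) (c := s)
        (by simpa [inclK_val, weyl, Matrix.mul_apply, Fin.sum_univ_two] using hb)
        (by simp [inclK_val, weyl, Matrix.mul_apply, Fin.sum_univ_two]; rw [hc, hs]; ring)
        (by simpa [inclK_val, weyl, Matrix.mul_apply, Fin.sum_univ_two] using hs)
      refine ⟨n, μ, k * (weyl R)⁻¹, j, Or.inr ?_⟩
      have e : kz F ϖ (k * (weyl R)⁻¹) j = kz F ϖ k j * (inclK R F (weyl R))⁻¹ := by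
        rw [← map_inv, ← kz_zero F ϖ, kz_mul, add_zero]
      rw [e, ← mul_assoc, eq_mul_inv_iff_mul_eq]
      exact hk
    · obtain ⟨n, μ, k, j, hk⟩ := exists_beta_mul_gMat_mul_kz_of_dvd F ϖ h (a := b) (b := s * b)
        (c := c * s * b) hb (by rw [hs, hb]; simp only [map_mul]; ring)
        (by rw [hc, hs, hb]; simp only [map_mul]; ring)
      exact ⟨n, μ, k, j, Or.inr hk⟩

end Cosets

/-! ### Elements of the compact induction as functions on the vertices -/

section Hat

variable {R : Type*} [CommRing R] [IsDomain R] [IsDiscreteValuationRing R]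
  [HenselianLocalRing R] [Finite (ResidueField R)]
  (F : Type*) [Field F] [Algebra R F] [IsFractionRing R F] (ϖ : R) [hϖ : Fact (Irreducible ϖ)]
  (E : Type*) [Field E] [Algebra (ResidueField R) E] (p : ℕ) [hp : Fact p.Prime] [CharP E p]
  {f : ℕ} (r : Fin f → ℕ) (w : ℕ)

/-- The values of `φ` at the vertices `(ϖ^n μ; 0 1) KZ` of one half of the tree. Here `μ` is any
element of `R`; the dependence of the value on `μ` modulo `ϖ ^ n` is given by `hat_add_mul`. -/
def hat : ind F ϖ E p r w →ₗ[E] ℕ → R → Weight E r where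
  toFun φ n μ := φ.1 (gMat F ϖ n μ)⁻¹
  map_add' _ _ := rfl
  map_smul' _ _ := rfl

/-- The action of `β`, which exchanges the two halves of the tree. -/
def flip : ind F ϖ E p r w →ₗ[E] ind F ϖ E p r w := indRep F ϖ E p r w (beta F ϖ)

variable {F ϖ E p r w}

theorem hat_apply (φ : ind F ϖ E p r w) (n : ℕ) (μ : R) :
    hat F ϖ E p r w φ n μ = φ.1 (gMat F ϖ n μ)⁻¹ := rfl

theorem hat_flip_apply (φ : ind F ϖ E p r w) (n : ℕ) (μ : R) :
    hat F ϖ E p r w (flip F ϖ E p r w φ) n μ = φ.1 ((gMat F ϖ n μ)⁻¹ * beta F ϖ) := rfl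

theorem ind_kz (φ : ind F ϖ E p r w) (k : GL (Fin 2) R) (n : ℤ) (g : GL (Fin 2) F) :
    φ.1 (kz F ϖ k n * g) = sigma E p r w k (φ.1 g) := φ.2.1 k n g

theorem ind_inclK (φ : ind F ϖ E p r w) (k : GL (Fin 2) R) (g : GL (Fin 2) F) :
    φ.1 (inclK R F k * g) = sigma E p r w k (φ.1 g) := by rw [← kz_zero F ϖ, ind_kz]

theorem ind_piScalar_zpow (φ : ind F ϖ E p r w) (n : ℤ) (g : GL (Fin 2) F) :
    φ.1 (piScalar F ϖ ^ n * g) = φ.1 g := by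
  have := ind_kz φ 1 n g
  rwa [kz, map_one, mul_one, map_one] at this

theorem flip_flip (φ : ind F ϖ E p r w) : flip F ϖ E p r w (flip F ϖ E p r w φ) = φ := by
  refine Subtype.ext (funext fun g => ?_)
  change φ.1 (g * beta F ϖ * beta F ϖ) = φ.1 g
  rw [mul_assoc, beta_mul_beta, ← piScalar_comm, ← ind_piScalar_zpow φ 1 g, zpow_one]

theorem flip_hecke (φ : ind F ϖ E p r w) :
    flip F ϖ E p r w (hecke F ϖ E p r w φ) = hecke F ϖ E p r w (flip F ϖ E p r w φ) :=
  (hecke_indRep F ϖ E p r w _ φ).symm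

theorem hat_add_mul (φ : ind F ϖ E p r w) (n : ℕ) (μ c : R) :
    hat F ϖ E p r w φ n (μ + ϖ ^ n * c) = sigma E p r w (upper (-c)) (hat F ϖ E p r w φ n μ) := by
  rw [hat_apply, gMat_add_mul, _root_.mul_inv_rev, ← map_inv, upper_inv, ind_inclK]
  rfl

/-- An element of the compact induction is determined by its values on both halves of the tree. -/
theorem ind_ext {φ φ' : ind F ϖ E p r w} (h : hat F ϖ E p r w φ = hat F ϖ E p r w φ')
    (h' : hat F ϖ E p r w (flip F ϖ E p r w φ) = hat F ϖ E p r w (flip F ϖ E p r w φ')) :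
    φ = φ' := by
  refine Subtype.ext (funext fun g => ?_)
  obtain ⟨n, μ, k, j, hg | hg⟩ := exists_coset F ϖ g⁻¹
  · rw [inv_eq_iff_eq_inv, _root_.mul_inv_rev, kz_inv] at hg
    rw [hg, ind_kz, ind_kz, ← hat_apply, ← hat_apply, h]
  · have hb : (beta F ϖ)⁻¹ = piScalar F ϖ ^ (-1 : ℤ) * beta F ϖ := by
      rw [← beta_mul_beta, _root_.zpow_neg_one]
      group
    rw [inv_eq_iff_eq_inv, _root_.mul_inv_rev, _root_.mul_inv_rev, kz_inv, hb] at hg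
    rw [hg, ind_kz, ind_kz, ← mul_assoc _ (piScalar F ϖ ^ (-1 : ℤ)), ← piScalar_zpow_comm,
      mul_assoc,
      ind_piScalar_zpow, ind_piScalar_zpow, ← hat_flip_apply, ← hat_flip_apply, h']

/-- Finite support modulo `KZ` means that only finitely many levels are nonzero. -/
theorem exists_hat_eq_zero (φ : ind F ϖ E p r w) :
    ∃ N, ∀ n, N < n → hat F ϖ E p r w φ n = 0 := by
  classical
  obtain ⟨S, hS⟩ := φ.2.2
  let lev : GL (Fin 2) F → ℕ := fun s =>
    if h : ∃ (n : ℕ) (μ : R) (k : GL (Fin 2) R) (j : ℤ), (gMat F ϖ n μ)⁻¹ = kz F ϖ k j * s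
      then h.choose else 0
  refine ⟨S.sup lev, fun n hn => ?_⟩
  by_contra h
  obtain ⟨μ, hμ⟩ := Function.ne_iff.1 h
  obtain ⟨s, hs, k, j, hkj⟩ := hS _ hμ
  have hex : ∃ (n : ℕ) (μ : R) (k : GL (Fin 2) R) (j : ℤ), (gMat F ϖ n μ)⁻¹ = kz F ϖ k j * s :=
    ⟨n, μ, k, j, hkj⟩
  have hl : lev s = hex.choose := dif_pos hex
  obtain ⟨μ', k', j', h'⟩ := hex.choose_spec
  have : n = lev s := by
    rw [hl]
    have hs' : s = (kz F ϖ k' j')⁻¹ * (gMat F ϖ hex.choose μ')⁻¹ := by rw [h']; group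
    rw [hs'] at hkj
    refine (gMat_eq_gMat_mul_kz F ϖ (μ := μ) (ν := μ') (k := k * k'⁻¹) (j := j + -j') ?_).1
    rw [← kz_mul, ← kz_inv]
    calc gMat F ϖ hex.choose μ' =
        gMat F ϖ n μ * (gMat F ϖ n μ)⁻¹ * gMat F ϖ hex.choose μ' := by group
      _ = _ := by rw [hkj]; group
  have := Finset.le_sup (f := lev) hs
  omega

/-- The terms of `T` that come from the vertices one step further away from the edge. -/
def inward (n : ℕ) (ψ : R → Weight E r) (μ : R) : Weight E r :=
  ∑ c : ResidueField R, evY E r (ψ (μ + ϖ ^ n * teich c)) • sigma E p r w (upper (teich c))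
    (yTop E r)

/-- The term of `T` that comes from the vertex one step closer to the edge. -/
def outward (ψ : R → Weight E r) (μ : R) : Weight E r := evX E r (ψ μ) • xTop E r

theorem hecke_apply (φ : ind F ϖ E p r w) (g : GL (Fin 2) F) :
    (hecke F ϖ E p r w φ).1 g = heckeFun F ϖ E p r w φ.1 g := rfl

theorem sum_hat_hecke (φ : ind F ϖ E p r w) (n : ℕ) (μ : R) :
    ∑ c : ResidueField R, sigma E p r w (upper (teich c))
      (projY E r (φ.1 ((gMat F ϖ 1 (teich c))⁻¹ * (gMat F ϖ n μ)⁻¹))) =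
    inward (ϖ := ϖ) (p := p) (w := w) n (hat F ϖ E p r w φ (n + 1)) μ := by
  refine Finset.sum_congr rfl fun c _ => ?_
  rw [← _root_.mul_inv_rev, gMat_mul_gMat_one, ← hat_apply, projY, LinearMap.smulRight_apply,
    map_smul]

/-- The operator `T` on a positive level. -/
theorem hat_hecke_succ (φ : ind F ϖ E p r w) (n : ℕ) (μ : R) :
    hat F ϖ E p r w (hecke F ϖ E p r w φ) (n + 1) μ =
      inward (ϖ := ϖ) (p := p) (w := w) (n + 1) (hat F ϖ E p r w φ (n + 2)) μ +
        outward (hat F ϖ E p r w φ n) μ := by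
  rw [hat_apply, hecke_apply, heckeFun, sum_hat_hecke, ← _root_.mul_inv_rev, gMat_succ_mul_alpha,
    piScalar_comm, _root_.mul_inv_rev]
  have := ind_piScalar_zpow φ (-1) (gMat F ϖ n μ)⁻¹
  rw [_root_.zpow_neg_one] at this
  rw [this]
  rfl

/-- On level zero, the vertex one step closer to the edge is the other end of the edge, and its
value is read off from `flip φ`. -/
theorem hat_hecke_zero (φ : ind F ϖ E p r w) (μ : R) :
    hat F ϖ E p r w (hecke F ϖ E p r w φ) 0 μ =
      inward (ϖ := ϖ) (p := p) (w := w) 0 (hat F ϖ E p r w φ 1) μ +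
        ((-1) ^ w * evY E r (hat F ϖ E p r w (flip F ϖ E p r w φ) 0 0)) • xTop E r := by
  rw [hat_apply, hecke_apply, heckeFun, sum_hat_hecke, ← _root_.mul_inv_rev, gMat_zero_mul_alpha,
    _root_.mul_inv_rev, ← map_inv, ind_inclK, projX, LinearMap.smulRight_apply]
  congr 2
  have h1 : φ.1 (beta F ϖ)⁻¹ = hat F ϖ E p r w (flip F ϖ E p r w φ) 0 0 := by
    have h2 := ind_piScalar_zpow φ (-1) (beta F ϖ)
    rw [hat_flip_apply, gMat_zero, upper_zero, map_one, inv_one, one_mul, ← h2, ← beta_mul_beta,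
      _root_.zpow_neg_one]
    group
  have h3 : (weyl R)⁻¹ = weyl R := by
    rw [inv_eq_iff_mul_eq_one]
    ext i j
    fin_cases i <;> fin_cases j <;> simp [weyl, Matrix.mul_apply, Fin.sum_univ_two]
  rw [h1, _root_.mul_inv_rev, h3, upper_inv, map_mul, Module.End.mul_apply,
    sigma_upper_of_residue_eq_zero E p r w (by simp [residue_unif]), evX_sigma_weyl]

/-! ### The Iwahori action on the vertices -/

/-- The fractional linear transformation by `k⁻¹`, for `k ∈ I`. -/
def mob (k : GL (Fin 2) R) (μ : R) : R :=
  (k 1 1 * μ - k 0 1) * Ring.inverse (k 0 0 - k 1 0 * μ)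

theorem residue_mul_ne_zero {k : GL (Fin 2) R} (hk : k ∈ iwahori R) :
    residue R (k 0 0) * residue R (k 1 1) ≠ 0 := by
  have h : IsUnit (k 0 0 * k 1 1 - k 0 1 * k 1 0) := isUnit_det' k
  have h10 : residue R (k 1 0) = 0 := hk
  rw [← residue_ne_zero_iff_isUnit] at h
  simpa [h10] using h

theorem isUnit_denom {k : GL (Fin 2) R} (hk : k ∈ iwahori R) (μ : R) :
    IsUnit (k 0 0 - k 1 0 * μ) := by
  have h10 : residue R (k 1 0) = 0 := hk
  rw [← residue_ne_zero_iff_isUnit]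
  simpa [h10] using left_ne_zero_of_mul (residue_mul_ne_zero hk)

theorem mob_mul {k : GL (Fin 2) R} (hk : k ∈ iwahori R) (μ : R) :
    mob k μ * (k 0 0 - k 1 0 * μ) = k 1 1 * μ - k 0 1 := by
  rw [mob, mul_assoc, Ring.inverse_mul_cancel _ (isUnit_denom hk μ), mul_one]

theorem inv_gMat_mul_inclK (n : ℕ) {k : GL (Fin 2) R} (hk : k ∈ iwahori R) (μ : R) :
    ∃ k' : GL (Fin 2) R, (residue R (k' 0 0) = residue R (k 0 0) ∧ residue R (k' 0 1) = 0 ∧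
      residue R (k' 1 0) = 0 ∧ residue R (k' 1 1) = residue R (k 1 1)) ∧
      (gMat F ϖ n μ)⁻¹ * inclK R F k = inclK R F k' * (gMat F ϖ n (mob k μ))⁻¹ := by
  have h10 : residue R (k 1 0) = 0 := hk
  have hm := mob_mul hk μ
  refine ⟨GeneralLinearGroup.mk'' !![k 0 0 - k 1 0 * μ, 0; k 1 0 * ϖ ^ n, k 1 0 * mob k μ + k 1 1]
    ?_, ⟨?_, ?_, ?_, ?_⟩, ?_⟩
  · convert! isUnit_det' k using 1
    rw [det_fin_two_of]
    linear_combination k 1 0 * hm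
  · simp [h10]
  · simp
  · simp [h10]
  · simp [h10]
  · have hm' := congrArg (algebraMap R F) hm
    simp only [map_mul, map_sub] at hm'
    rw [inv_mul_eq_iff_eq_mul, ← mul_assoc, eq_mul_inv_iff_mul_eq]
    ext i j
    fin_cases i <;> fin_cases j <;>
      simp [inclK_val, gMat_val, Matrix.mul_apply, Fin.sum_univ_two]
    · ring
    · linear_combination hm'

/-- The diagonal part of an element of the Iwahori subgroup. -/
def iwahoriDiag (k : iwahori R) : GL (Fin 2) R :=
  GeneralLinearGroup.mk'' !![k.1 0 0, 0; 0, k.1 1 1] (by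
    rw [det_fin_two_of, ← residue_ne_zero_iff_isUnit]
    simpa using residue_mul_ne_zero k.2)

/-- `k ∈ I` acts on the values at the vertices by a fractional linear transformation and through
its diagonal part. -/
theorem hat_iwahori (k : iwahori R) (φ : ind F ϖ E p r w) (n : ℕ) (μ : R) :
    hat F ϖ E p r w (indRep F ϖ E p r w (inclK R F k) φ) n μ =
      sigma E p r w (iwahoriDiag k) (hat F ϖ E p r w φ n (mob k.1 μ)) := by
  obtain ⟨k', ⟨h00, h01, h10, h11⟩, hk'⟩ := inv_gMat_mul_inclK (F := F) (ϖ := ϖ) n k.2 μ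
  change φ.1 ((gMat F ϖ n μ)⁻¹ * inclK R F k) = _
  rw [hk', ind_inclK, hat_apply]
  refine congrFun (congrArg _ (sigma_congr E p r w fun i j => ?_)) _
  fin_cases i <;> fin_cases j <;> simp [iwahoriDiag, h00, h01, h10, h11]

/-- `β` normalizes `I` and `I(1)`. -/
theorem exists_conj_beta (k : iwahori R) : ∃ k' : iwahori R,
    (∀ φ : ind F ϖ E p r w, indRep F ϖ E p r w (inclK R F k) (flip F ϖ E p r w φ) =
      flip F ϖ E p r w (indRep F ϖ E p r w (inclK R F k') φ)) ∧
    (k.1 ∈ iwahoriOne R → k'.1 ∈ iwahoriOne R) ∧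
    ϖ * k'.1 0 1 = k.1 1 0 := by
  obtain ⟨c, hc⟩ := (residue_eq_zero_iff_dvd ϖ (k.1 1 0)).1 k.2
  refine ⟨⟨GeneralLinearGroup.mk'' !![k.1 1 1, c; ϖ * k.1 0 1, k.1 0 0] ?_, ?_⟩, fun φ => ?_, ?_,
    ?_⟩
  · convert! isUnit_det' k.1 using 1
    rw [det_fin_two_of, hc]
    ring
  · change residue R (ϖ * k.1 0 1) = 0
    rw [map_mul, residue_unif, zero_mul]
  · rw [flip, ← Module.End.mul_apply, ← Module.End.mul_apply, ← map_mul, ← map_mul]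
    refine congrFun (congrArg _ (congrArg _ (Units.ext ?_))) φ
    rw [Units.val_mul, Units.val_mul, inclK_val, inclK_val, beta_val]
    ext i j
    fin_cases i <;> fin_cases j <;>
      simp [Matrix.mul_apply, Fin.sum_univ_two, hc, mul_comm]
  · rintro ⟨-, h1, h2⟩
    refine ⟨?_, h2, h1⟩
    change residue R (ϖ * k.1 0 1) = 0
    rw [map_mul, residue_unif, zero_mul]
  · exact hc.symm

/-! ### Sections at a given distance -/

variable (ϖ E p r w) in
/-- The functions on `R` that describe the values of an element of the compact induction at the
vertices `(ϖ^n μ; 0 1) KZ` for fixed `n`. -/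
def sections (n : ℕ) : Submodule E (R → Weight E r) where
  carrier := {ψ | ∀ μ c, ψ (μ + ϖ ^ n * c) = sigma E p r w (upper (-c)) (ψ μ)}
  zero_mem' := fun μ c => by simp
  add_mem' := fun ha hb μ c => by rw [Pi.add_apply, ha, hb, Pi.add_apply, map_add]
  smul_mem' := fun a ψ hψ μ c => by rw [Pi.smul_apply, hψ, Pi.smul_apply, map_smul]

theorem hat_mem_sections (φ : ind F ϖ E p r w) (n : ℕ) :
    hat F ϖ E p r w φ n ∈ sections ϖ E p r w n := fun μ c => hat_add_mul φ n μ c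

theorem tens_add (g : GL (Fin 2) F) (v v' : Weight E r) :
    tens F ϖ E p r w g (v + v') = tens F ϖ E p r w g v + tens F ϖ E p r w g v' :=
  Subtype.ext (funext fun _ => map_add _ _ _)

theorem tens_smul (g : GL (Fin 2) F) (c : E) (v : Weight E r) :
    tens F ϖ E p r w g (c • v) = c • tens F ϖ E p r w g v :=
  Subtype.ext (funext fun _ => map_smul _ _ _)

variable (F ϖ E p r w) in
/-- The element of the compact induction with given values at the vertices `(ϖ^n μ; 0 1) KZ`,
`μ ∈ I_n`, and zero elsewhere. -/
def lift (n : ℕ) : (R → Weight E r) →ₗ[E] ind F ϖ E p r w where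
  toFun ψ := ∑ d : Fin n → ResidueField R,
    tens F ϖ E p r w (gMat F ϖ n (digitElt ϖ d)) (ψ (digitElt ϖ d))
  map_add' ψ ψ' := by simp only [Pi.add_apply, tens_add, Finset.sum_add_distrib]
  map_smul' c ψ := by simp only [Pi.smul_apply, tens_smul, Finset.smul_sum, RingHom.id_apply]

theorem sigmaKZ_eq_zero {g : GL (Fin 2) F} (h : ∀ (k : GL (Fin 2) R) (n : ℤ), g ≠ kz F ϖ k n) :
    sigmaKZ F ϖ E p r w g = 0 := dif_neg fun ⟨k, n, h'⟩ => h k n h'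

theorem lift_apply (n : ℕ) (ψ : R → Weight E r) (x : GL (Fin 2) F) :
    (lift F ϖ E p r w n ψ).1 x = ∑ d : Fin n → ResidueField R,
      sigmaKZ F ϖ E p r w (x * gMat F ϖ n (digitElt ϖ d)) (ψ (digitElt ϖ d)) := by
  have h : ∀ (s : Finset (Fin n → ResidueField R)) (g : (Fin n → ResidueField R) →
      ind F ϖ E p r w), (∑ d ∈ s, g d).1 x = ∑ d ∈ s, (g d).1 x := fun s g => by
    rw [Submodule.coe_sum, Finset.sum_apply]
  exact h _ _

theorem hat_lift {n : ℕ} {ψ : R → Weight E r} (hψ : ψ ∈ sections ϖ E p r w n) (m : ℕ) :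
    hat F ϖ E p r w (lift F ϖ E p r w n ψ) m = if m = n then ψ else 0 := by
  funext μ
  rw [hat_apply, lift_apply]
  by_cases hmn : m = n
  · subst hmn
    rw [if_pos rfl, Finset.sum_eq_single fun i : Fin m => digit ϖ i μ]
    · change sigmaKZ F ϖ E p r w ((gMat F ϖ m μ)⁻¹ * gMat F ϖ m (low ϖ m μ)) (ψ (low ϖ m μ)) = _
      have h1 : low ϖ m μ = μ + ϖ ^ m * -tail ϖ m μ := by
        conv_rhs => rw [← low_add_tail ϖ m μ, tail_add_mul, tail_low]
        ring
      rw [h1, gMat_add_mul, inv_mul_cancel_left, ← kz_zero F ϖ, sigmaKZ_kz, hψ,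
        ← sigma_upper_add, add_neg_cancel, upper_zero, map_one, Module.End.one_apply]
    · intro d _ hd
      rw [sigmaKZ_eq_zero, LinearMap.zero_apply]
      intro k j h
      rw [inv_mul_eq_iff_eq_mul] at h
      apply hd
      rw [← digitElt_eq_iff, ← dvd_neg, neg_sub]
      exact (gMat_eq_gMat_mul_kz F ϖ h).2
    · simp
  · rw [if_neg hmn]
    refine Finset.sum_eq_zero fun d _ => ?_
    rw [sigmaKZ_eq_zero, LinearMap.zero_apply]
    intro k j h
    rw [inv_mul_eq_iff_eq_mul] at h
    exact hmn (gMat_eq_gMat_mul_kz F ϖ h).1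

theorem hat_flip_lift (n : ℕ) (ψ : R → Weight E r) (m : ℕ) :
    hat F ϖ E p r w (flip F ϖ E p r w (lift F ϖ E p r w n ψ)) m = 0 := by
  funext μ
  rw [hat_flip_apply, lift_apply]
  refine Finset.sum_eq_zero fun d _ => ?_
  rw [sigmaKZ_eq_zero, LinearMap.zero_apply]
  intro k j h
  rw [mul_assoc, inv_mul_eq_iff_eq_mul] at h
  exact beta_mul_gMat_ne F ϖ h

theorem outward_mem_sections (n : ℕ) {ψ : R → Weight E r} (hψ : ψ ∈ sections ϖ E p r w n) :
    outward ψ ∈ sections ϖ E p r w (n + 1) := by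
  intro μ c
  rw [outward, outward, map_smul, sigma_upper_xTop, pow_succ, mul_assoc, hψ,
    sigma_upper_of_residue_eq_zero]
  simp [residue_unif]

/-- If the part of `T` that points towards the edge vanishes, then `T` only moves sections
outwards. -/
theorem hecke_lift {n : ℕ} {ψ : R → Weight E r} (hψ : ψ ∈ sections ϖ E p r w n)
    (h0 : n = 0 → evY E r (ψ 0) = 0)
    (h1 : ∀ m, n = m + 1 → ∀ μ, inward (ϖ := ϖ) (p := p) (w := w) m ψ μ = 0) :
    hecke F ϖ E p r w (lift F ϖ E p r w n ψ) = lift F ϖ E p r w (n + 1) (outward ψ) := by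
  have hin : ∀ m (μ : R), inward (ϖ := ϖ) (p := p) (w := w) m (0 : R → Weight E r) μ = 0 :=
    fun m μ => Finset.sum_eq_zero fun c _ => by rw [Pi.zero_apply, map_zero, zero_smul]
  have hin' : ∀ m μ, inward (ϖ := ϖ) (p := p) (w := w) m
      (hat F ϖ E p r w (lift F ϖ E p r w n ψ) (m + 1)) μ = 0 := fun m μ => by
    rw [hat_lift hψ]
    split_ifs with h
    · exact h1 m h.symm μ
    · exact hin m μ
  have hout : outward (0 : R → Weight E r) = 0 := funext fun μ => by
    rw [outward, Pi.zero_apply, map_zero, zero_smul]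
  apply ind_ext
  · funext m μ
    rw [hat_lift (outward_mem_sections n hψ)]
    cases m with
    | zero =>
      rw [hat_hecke_zero, hin' 0, hat_flip_lift, Pi.zero_apply, map_zero, mul_zero, zero_smul,
        zero_add, if_neg (Nat.succ_ne_zero n).symm]
      rfl
    | succ m =>
      rw [hat_hecke_succ, hin' (m + 1), zero_add, hat_lift hψ]
      by_cases h : m = n
      · rw [if_pos h, if_pos (by rw [h])]
      · rw [if_neg h, if_neg (by omega), hout]
  · funext m μ
    rw [flip_hecke, hat_flip_lift]
    cases m with
    | zero =>
      rw [hat_hecke_zero, hat_flip_lift, hin, flip_flip, hat_lift hψ, zero_add]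
      split_ifs with h
      · rw [h0 h.symm, mul_zero, zero_smul]
        rfl
      · rw [Pi.zero_apply, map_zero, mul_zero, zero_smul]
        rfl
    | succ m =>
      rw [hat_hecke_succ, hat_flip_lift, hat_flip_lift, hin, hout, zero_add]

end Hat

/-! ### The fractional linear action on digits -/

section Mob

variable {R : Type*} [CommRing R] [IsDomain R] [IsDiscreteValuationRing R]
  [HenselianLocalRing R] [Finite (ResidueField R)] (ϖ : R) [hϖ : Fact (Irreducible ϖ)]

/-- The difference quotient `δ` of a fractional linear transformation is its determinant divided by
both denominators. -/
theorem exists_mob_add (k : iwahori R) (μ h : R) : ∃ δ : R, mob k.1 (μ + h) = mob k.1 μ + h * δ ∧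
    δ * ((k.1 0 0 - k.1 1 0 * μ) * (k.1 0 0 - k.1 1 0 * (μ + h))) =
      k.1 0 0 * k.1 1 1 - k.1 0 1 * k.1 1 0 := by
  have h1 := mob_mul k.2 μ
  have h2 := mob_mul k.2 (μ + h)
  have u1 := isUnit_denom k.2 μ
  have u2 := isUnit_denom k.2 (μ + h)
  obtain ⟨v, hv⟩ := (u1.mul u2)
  have hv' : (v : R) * (v⁻¹ : Rˣ) = 1 := v.mul_inv
  refine ⟨(k.1 0 0 * k.1 1 1 - k.1 0 1 * k.1 1 0) * (v⁻¹ : Rˣ), ?_, ?_⟩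
  · apply (u1.mul u2).mul_right_cancel
    rw [hv] at hv'
    linear_combination (k.1 0 0 - k.1 1 0 * μ) * h2 - (k.1 0 0 - k.1 1 0 * (μ + h)) * h1 -
      h * (k.1 0 0 * k.1 1 1 - k.1 0 1 * k.1 1 0) * hv'
  · rw [← hv, mul_assoc, mul_comm _ (v : R), hv', mul_one]

theorem residue_denom (k : iwahori R) (μ : R) :
    residue R (k.1 0 0 - k.1 1 0 * μ) = residue R (k.1 0 0) := by
  have : residue R (k.1 1 0) = 0 := k.2
  simp [this]

theorem residue_deriv (k : iwahori R) {μ μ' δ : R}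
    (h : δ * ((k.1 0 0 - k.1 1 0 * μ) * (k.1 0 0 - k.1 1 0 * μ')) =
      k.1 0 0 * k.1 1 1 - k.1 0 1 * k.1 1 0) :
    residue R δ = residue R (k.1 1 1) / residue R (k.1 0 0) := by
  have h1 := congrArg (residue R) h
  have h10 : residue R (k.1 1 0) = 0 := k.2
  have h00 := left_ne_zero_of_mul (residue_mul_ne_zero k.2)
  rw [map_mul, map_mul, residue_denom, residue_denom, map_sub, map_mul, map_mul, h10, mul_zero,
    sub_zero] at h1
  rw [eq_div_iff h00]
  apply mul_left_cancel₀ h00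
  linear_combination h1

theorem digit_mob_add (k : iwahori R) (n : ℕ) (μ y : R) :
    digit ϖ n (mob k.1 (μ + ϖ ^ n * y)) =
      digit ϖ n (mob k.1 μ) + residue R (k.1 1 1) / residue R (k.1 0 0) * residue R y := by
  obtain ⟨δ, h1, h2⟩ := exists_mob_add k μ (ϖ ^ n * y)
  rw [h1, mul_assoc, digit_add_mul, map_mul, residue_deriv k h2, mul_comm (residue R y)]

theorem digit_mob (k : iwahori R) (n : ℕ) (μ : R) :
    digit ϖ n (mob k.1 μ) = residue R (k.1 1 1) / residue R (k.1 0 0) * digit ϖ n μ +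
      digit ϖ n (mob k.1 (low ϖ n μ)) := by
  conv_lhs => rw [← low_add_tail ϖ n μ, digit_mob_add]
  rw [add_comm]
  rfl

/-- In the ramified case the digits modulo `ϖ ^ 2` add without carry, so that the second digit is a
derivation, and the digit at `ϖ ^ (n + 1)` of a fractional linear transform is a quadratic function
of the digit at `ϖ ^ n`. -/
theorem exists_digit_mob_eq_quadratic (hc : ∀ a b : ResidueField R, carry ϖ a b = 0) (k : iwahori R)
    (n : ℕ) (ν : R) : ∃ q₀ q₁ q₂ : ResidueField R, ∀ a : ResidueField R,
      digit ϖ (n + 1) (mob k.1 (ν + ϖ ^ n * teich a)) = q₀ + q₁ * a + q₂ * a ^ 2 := by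
  set a₀ := residue R (k.1 0 0) with ha₀
  set ρ := residue R (k.1 1 1) / a₀ with hρ
  have h00 : a₀ ≠ 0 := left_ne_zero_of_mul (residue_mul_ne_zero k.2)
  refine ⟨digit ϖ 1 (tail ϖ n (mob k.1 ν)),
    (digit ϖ 1 (k.1 0 0 * k.1 1 1 - k.1 0 1 * k.1 1 0) -
      ρ * a₀ * (2 * digit ϖ 1 (k.1 0 0 - k.1 1 0 * ν))) / a₀ ^ 2,
    ρ * a₀ * digit ϖ 1 (k.1 1 0 * ϖ ^ n) / a₀ ^ 2, fun a => ?_⟩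
  obtain ⟨δ, h1, h2⟩ := exists_mob_add k ν (ϖ ^ n * teich a)
  have e1 : digit ϖ (n + 1) (mob k.1 (ν + ϖ ^ n * teich a)) =
      digit ϖ 1 (tail ϖ n (mob k.1 ν)) + a * digit ϖ 1 δ := by
    rw [h1, mul_assoc, add_comm n, ← digit_tail, tail_add_mul, digit_one_add, hc, add_zero,
      digit_one_mul, digit_one_teich, mul_zero, add_zero, residue_teich]
  have e2 : digit ϖ 1 (k.1 0 0 - k.1 1 0 * ν) =
      digit ϖ 1 (k.1 0 0 - k.1 1 0 * (ν + ϖ ^ n * teich a)) + a * digit ϖ 1 (k.1 1 0 * ϖ ^ n) := by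
    have : k.1 0 0 - k.1 1 0 * ν =
        k.1 0 0 - k.1 1 0 * (ν + ϖ ^ n * teich a) + teich a * (k.1 1 0 * ϖ ^ n) := by ring
    rw [this, digit_one_add, hc, add_zero, digit_one_mul, digit_one_teich, mul_zero, add_zero,
      residue_teich]
  have e3 := congrArg (digit ϖ 1) h2
  rw [digit_one_mul, digit_one_mul, map_mul, residue_denom, residue_denom, residue_deriv k h2,
    ← ha₀, ← hρ] at e3
  rw [e1]
  field_simp
  linear_combination a * e3 + a * ρ * a₀ * e2

end Mob

/-! ### Polynomial sections -/

section Sections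

variable {R : Type*} [CommRing R] [IsDomain R] [IsDiscreteValuationRing R]
  [HenselianLocalRing R] [Finite (ResidueField R)]
  {F : Type*} [Field F] [Algebra R F] [IsFractionRing R F] {ϖ : R} [hϖ : Fact (Irreducible ϖ)]
  {E : Type*} [Field E] [Algebra (ResidueField R) E] {p : ℕ} [hp : Fact p.Prime] [CharP E p]
  {f : ℕ} {r : Fin f → ℕ} {w : ℕ}

theorem neg_pow_prime_pow (x : E) (n : ℕ) : (-x) ^ p ^ n = -x ^ p ^ n := by
  rw [← iterateFrobenius_def, ← iterateFrobenius_def, map_neg]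

theorem evX_add_mul {n : ℕ} {ψ : R → Weight E r} (hψ : ψ ∈ sections ϖ E p r w n) (ν : R)
    (a : ResidueField R) : evX E r (ψ (ν + ϖ ^ n * teich a)) = genFun (R := R) E p r w (ψ ν) a := by
  rw [hψ, genFun_apply]

theorem evY_add_mul {n : ℕ} {ψ : R → Weight E r} (hψ : ψ ∈ sections ϖ E p r w n) (ν c : R) :
    evY E r (ψ (ν + ϖ ^ n * c)) = evY E r (ψ ν) := by
  rw [hψ, evY_sigma_upper]

/-- A section is prescribed by the polynomial functions `a ↦ evX (ψ (ν + ϖ^n [a]))`. -/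
theorem exists_section (hq : Nat.card (ResidueField R) = p ^ f) (hr : ∀ j, r j < p) (n : ℕ)
    (H : R → ResidueField R → E) (hH : ∀ ν, H ν ∈ polySpace E p hq r) :
    ∃ ψ ∈ sections ϖ E p r w n, (∀ μ, evX E r (ψ μ) = H (low ϖ n μ) (digit ϖ n μ)) ∧
      ∀ μ, evY E r (ψ μ) =
        (-1) ^ (∑ j, r j) * coef E p hq (fun j => ⟨r j, hr j⟩) (H (low ϖ n μ)) := by
  refine ⟨fun μ => sigma E p r w (upper (-tail ϖ n μ)) (vec E p hq hr (H (low ϖ n μ))),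
    fun μ c => ?_, fun μ => ?_, fun μ => ?_⟩
  · simp only [low_add_mul, tail_add_mul]
    rw [← sigma_upper_add, neg_add_rev]
  · simp only [evX_sigma_upper, genFun_vec E p w hq hr (hH _), map_neg, neg_neg]
    rfl
  · simp only [evY_sigma_upper, evY_vec E p hq hr (hH _)]

variable (ϖ E r) in
/-- The section with `lift (n + 1) (sSec n l) = s_{n+1}^{p^l (r_l + 1)}`. -/
def sSec (n : ℕ) (l : Fin f) (p : ℕ) (μ : R) : Weight E r :=
  (algebraMap (ResidueField R) E (digit ϖ n μ) ^ p ^ (l : ℕ)) ^ (r l + 1) • xTop E r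

variable (ϖ E r) in
/-- The section with `lift n (tSec n k) = t_n^k`. -/
def tSec (n : ℕ) (k : Fin f) (p : ℕ) (μ : R) : Weight E r :=
  xyTop E r k - algebraMap (ResidueField R) E (digit ϖ n μ) ^ p ^ (k : ℕ) • xTop E r

theorem sSec_mem (n : ℕ) (l : Fin f) : sSec ϖ E r n l p ∈ sections ϖ E p r w (n + 1) := by
  intro μ c
  rw [sSec, sSec, map_smul, sigma_upper_xTop, digit_add_mul_of_lt ϖ (Nat.lt_succ_self n)]

theorem sigma_upper_xyTop (hq : Nat.card (ResidueField R) = p ^ f) (hr : ∀ j, r j < p)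
    (hr0 : ∀ j, 0 < r j) (c : R) (k : Fin f) :
    sigma E p r w (upper c) (xyTop E r k) =
      xyTop E r k + algebraMap (ResidueField R) E (residue R c) ^ p ^ (k : ℕ) • xTop E r := by
  apply genFun_injective (R := R) E p w hq hr
  funext a
  rw [genFun_sigma_upper, map_add, map_smul, Pi.add_apply, Pi.smul_apply, genFun_xTop,
    genFun_xyTop E p w hr0, genFun_xyTop E p w hr0, map_sub, sub_pow_char_pow, smul_eq_mul]
  ring

theorem tSec_mem (hq : Nat.card (ResidueField R) = p ^ f) (hr : ∀ j, r j < p) (hr0 : ∀ j, 0 < r j)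
    (n : ℕ) (k : Fin f) : tSec ϖ E r n k p ∈ sections ϖ E p r w n := by
  intro μ c
  rw [tSec, tSec, map_sub, map_smul, sigma_upper_xTop, sigma_upper_xyTop hq hr hr0,
    digit_add_mul, map_add, add_pow_char_pow, map_neg, map_neg, neg_pow_prime_pow]
  module

theorem sElt_eq (n : ℕ) (l : Fin f) : sElt F ϖ E p r w (n + 1) (p ^ (l : ℕ) * (r l + 1)) =
    lift F ϖ E p r w (n + 1) (sSec ϖ E r n l p) := by
  refine Finset.sum_congr rfl fun d _ => ?_
  have h : lastDigit d = digit ϖ n (digitElt ϖ d) := by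
    rw [lastDigit, dif_pos n.succ_pos]
    exact (digit_digitElt ϖ d (Fin.last n)).symm
  rw [sSec, h, pow_mul]

theorem tElt_eq (n : ℕ) (k : Fin f) : tElt F ϖ E p r w n k =
    lift F ϖ E p r w n (tSec ϖ E r n k p) := by
  refine Finset.sum_congr rfl fun d _ => ?_
  rw [tSec, digit_self_digitElt, map_zero, zero_pow (pow_ne_zero _ hp.out.ne_zero), zero_smul,
    sub_zero]

theorem indRep_lift (k : iwahori R) {n : ℕ} {ψ : R → Weight E r}
    (hψ : ψ ∈ sections ϖ E p r w n) {ψ' : R → Weight E r} (hψ' : ψ' ∈ sections ϖ E p r w n)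
    (h : ∀ μ, sigma E p r w (iwahoriDiag k) (ψ (mob k.1 μ)) = ψ' μ) :
    indRep F ϖ E p r w (inclK R F k) (lift F ϖ E p r w n ψ) = lift F ϖ E p r w n ψ' := by
  apply ind_ext
  · funext m μ
    rw [hat_iwahori, hat_lift hψ, hat_lift hψ']
    split_ifs
    · exact h μ
    · rw [Pi.zero_apply, map_zero, Pi.zero_apply]
  · obtain ⟨k', hk', -⟩ := exists_conj_beta (F := F) (ϖ := ϖ) (E := E) (p := p) (r := r) (w := w) k
    have h1 := hk' (flip F ϖ E p r w (lift F ϖ E p r w n ψ))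
    rw [flip_flip] at h1
    rw [h1, flip_flip]
    funext m μ
    rw [hat_iwahori, hat_flip_lift, hat_flip_lift, Pi.zero_apply, map_zero, Pi.zero_apply]

variable (E p r w) in
/-- The character by which `I` acts on the line of `⨂_j x_j^{r_j}`. -/
def chi (k : iwahori R) : E :=
  red E (iwahoriDiag k).val.det ^ w * ∏ j : Fin f, (red E (k.1 0 0) ^ p ^ (j : ℕ)) ^ r j

theorem chi_eq_one {k : iwahori R} (hk : k.1 ∈ iwahoriOne R) : chi E p r w k = 1 := by
  obtain ⟨-, h00, h11⟩ := hk
  have h1 : residue R (iwahoriDiag k).val.det = 1 := by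
    rw [iwahoriDiag, GeneralLinearGroup.val_mk'', det_fin_two_of]
    simp [h00, h11]
  simp [chi, red_apply, h1, h00]

theorem sigma_diag_xTop (k : iwahori R) :
    sigma E p r w (iwahoriDiag k) (xTop E r) = chi E p r w k • xTop E r := by
  rw [sigma_xTop]
  · rfl
  · simp [iwahoriDiag]

theorem sigma_diag_xyTop (hq : Nat.card (ResidueField R) = p ^ f) (hr : ∀ j, r j < p)
    (hr0 : ∀ j, 0 < r j) (k : iwahori R) (l : Fin f) :
    sigma E p r w (iwahoriDiag k) (xyTop E r l) = (chi E p r w k * algebraMap (ResidueField R) E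
      (residue R (k.1 1 1) / residue R (k.1 0 0)) ^ p ^ (l : ℕ)) • xyTop E r l := by
  apply genFun_injective (R := R) E p w hq hr
  funext a
  have h01 : residue R ((iwahoriDiag k) 0 1) = 0 := by simp [iwahoriDiag]
  have h10 : residue R ((iwahoriDiag k) 1 0) = 0 := by simp [iwahoriDiag]
  rw [genFun_sigma_diag (R := R) E p w _ h01 h10, map_smul,
    Pi.smul_apply, genFun_xyTop E p w hr0, genFun_xyTop E p w hr0, map_mul, mul_pow, smul_eq_mul]
  simp only [chi, iwahoriDiag, GeneralLinearGroup.val_mk'', of_apply, cons_val', cons_val_zero,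
    cons_val_one, cons_val_fin_one]
  ring

/-! ### Eigenvectors -/

variable (F ϖ E p r w) in
/-- `φ` is, modulo the image of `T`, an eigenvector of `I` that is fixed by `I(1)`. -/
def IsEigen (φ : ind F ϖ E p r w) : Prop := ∀ k : iwahori R, ∃ c : E, (k.1 ∈ iwahoriOne R → c = 1) ∧
  indRep F ϖ E p r w (inclK R F k) φ - c • φ ∈ LinearMap.range (hecke F ϖ E p r w)

theorem IsEigen.flip {φ : ind F ϖ E p r w} (h : IsEigen F ϖ E p r w φ) :
    IsEigen F ϖ E p r w (ModPGL2.flip F ϖ E p r w φ) := by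
  intro k
  obtain ⟨k', h1, h2, -⟩ := exists_conj_beta (F := F) (ϖ := ϖ) (E := E) (p := p) (r := r) (w := w) k
  obtain ⟨c, hc, ψ, hψ⟩ := h k'
  refine ⟨c, fun hk => hc (h2 hk), ModPGL2.flip F ϖ E p r w ψ, ?_⟩
  rw [h1, ← map_smul, ← map_sub, ← hψ, flip_hecke]

theorem inward_eq_zero {ψ : R → Weight E r} (h : ∀ μ, evY E r (ψ μ) = 0) (n : ℕ) (μ : R) :
    inward (ϖ := ϖ) (p := p) (w := w) n ψ μ = 0 :=
  Finset.sum_eq_zero fun c _ => by rw [h, zero_smul]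

/-- The coefficients of the difference of two powers with exponent `r_l + 1`. -/
theorem sub_pow_mem_polySpace (hq : Nat.card (ResidueField R) = p ^ f) (hr : ∀ j, r j < p)
    (l : Fin f) (A B : E) :
    (fun a : ResidueField R => (A * algebraMap (ResidueField R) E a ^ p ^ (l : ℕ) + B) ^ (r l + 1) -
      (A * algebraMap (ResidueField R) E a ^ p ^ (l : ℕ)) ^ (r l + 1)) ∈ polySpace E p hq r ∧
    coef E p hq (fun j => ⟨r j, hr j⟩) (fun a : ResidueField R =>
      (A * algebraMap (ResidueField R) E a ^ p ^ (l : ℕ) + B) ^ (r l + 1) -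
      (A * algebraMap (ResidueField R) E a ^ p ^ (l : ℕ)) ^ (r l + 1)) =
      if r = Pi.single l (r l) then ((r l + 1 : ℕ) : E) * A ^ r l * B else 0 := by
  have h : (fun a : ResidueField R => (A * algebraMap (ResidueField R) E a ^ p ^ (l : ℕ) + B) ^
    (r l + 1) -
      (A * algebraMap (ResidueField R) E a ^ p ^ (l : ℕ)) ^ (r l + 1)) =
      ∑ i ∈ Finset.range (r l + 1), (A ^ i * B ^ (r l + 1 - i) * ((r l + 1).choose i : E)) •
        (fun a : ResidueField R => (algebraMap (ResidueField R) E a ^ p ^ (l : ℕ)) ^ i) := by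
    funext a
    rw [add_pow, Finset.sum_range_succ, Finset.sum_apply]
    simp only [Nat.choose_self, Nat.cast_one, mul_one, Nat.sub_self, pow_zero, add_sub_cancel_right,
      Pi.smul_apply, smul_eq_mul, mul_pow]
    exact Finset.sum_congr rfl fun i _ => by ring
  rw [h]
  refine ⟨Submodule.sum_mem _ fun i hi => Submodule.smul_mem _ _ (pow_mem_polySpace E p hq
    (Nat.lt_succ_iff.1 (Finset.mem_range.1 hi)) (hr l)), ?_⟩
  rw [map_sum, Finset.sum_eq_single (r l)]
  · rw [map_smul, coef_pow E p hq l (hr l), smul_eq_mul, Nat.choose_succ_self_right,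
      Nat.add_sub_cancel_left, pow_one, mul_ite, mul_one, mul_zero]
    exact if_congr Iff.rfl (by ring) rfl
  · intro i hi hne
    rw [map_smul, coef_pow E p hq l ((Finset.mem_range.1 hi).trans_le (hr l)), if_neg, smul_zero]
    intro h'
    have : r l = (Pi.single l i : Fin f → ℕ) l := congrFun h' l
    rw [Pi.single_eq_same] at this
    exact hne this.symm
  · simp

/-- When `f = 1`, sums of the vectors `(1 [c]; 0 1) y^r` with coefficients that are quadratic in `c`
vanish, since the sum of a polynomial of degree less than `q - 1` over all elements of the residue
field is zero. -/
theorem sum_quadratic_smul_yTop {r : Fin 1 → ℕ} (hq : Nat.card (ResidueField R) = p ^ 1)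
    (hr : r 0 + 3 < p) (q₀ q₁ q₂ : E) :
    ∑ c : ResidueField R, (q₀ + q₁ * algebraMap (ResidueField R) E c +
      q₂ * algebraMap (ResidueField R) E c ^ 2) • sigma E p r w (upper (teich c : R)) (yTop E r)
        = 0 := by
  have hr' : ∀ j : Fin 1, r j < p := fun j => by
    rw [Subsingleton.elim j 0]
    omega
  apply genFun_injective (R := R) E p w hq hr'
  funext a
  have hy : ∀ b : ResidueField R, genFun (R := R) E p r w (yTop E r) b =
      (-1) ^ r 0 * algebraMap (ResidueField R) E b ^ r 0 := fun b => by
    rw [yTop, genFun_mono]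
    simp [monom]
  rw [map_sum, Finset.sum_apply, map_zero, Pi.zero_apply]
  have hcard : Fintype.card (ResidueField R) = p := by
    rw [← Nat.card_eq_fintype_card, hq, pow_one]
  set P : Polynomial E := (Polynomial.C q₀ + Polynomial.C q₁ * Polynomial.X +
    Polynomial.C q₂ * Polynomial.X ^ 2) * (Polynomial.C ((-1) ^ r 0) *
      (Polynomial.C (algebraMap (ResidueField R) E a) - Polynomial.X) ^ r 0) with hP
  have hdeg : P.natDegree < Fintype.card (ResidueField R) - 1 := by
    have : P.natDegree ≤ 2 + r 0 := by
      rw [hP]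
      compute_degree
    omega
  have h := sum_eval_eq E P hdeg.le
  rw [Polynomial.coeff_eq_zero_of_natDegree_lt hdeg, neg_zero] at h
  rw [← h]
  refine Finset.sum_congr rfl fun c _ => ?_
  rw [map_smul, Pi.smul_apply, genFun_sigma_upper, residue_teich, hy, hP, smul_eq_mul, map_sub]
  simp

/-- If two sections on level `n + 1` differ, up to a scalar, by the outward image of a section `ψ`
without inward part, the corresponding elements differ by `T ψ`. -/
theorem sub_mem_range_of_outward {n : ℕ} {φ φ' ψ : R → Weight E r} {c : E}
    (hψ : ψ ∈ sections ϖ E p r w n)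
    (h0 : n = 0 → evY E r (ψ 0) = 0)
    (h1 : ∀ m, n = m + 1 → ∀ μ, inward (ϖ := ϖ) (p := p) (w := w) m ψ μ = 0)
    (h : ∀ μ, φ' μ = c • φ μ + outward ψ μ) :
    lift F ϖ E p r w (n + 1) φ' - c • lift F ϖ E p r w (n + 1) φ ∈
      LinearMap.range (hecke F ϖ E p r w) := by
  refine ⟨lift F ϖ E p r w n ψ, ?_⟩
  rw [hecke_lift hψ h0 h1, ← map_smul, ← map_sub]
  congr 1
  funext μ
  rw [Pi.sub_apply, h, Pi.smul_apply, add_sub_cancel_left]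

/-- `s_{n+1}^{p^l (r_l + 1)}` is an eigenvector, if either `f > 1` or `f = 1`, `n ≥ 1` and `F` is
ramified. -/
theorem isEigen_sElt (hq : Nat.card (ResidueField R) = p ^ f) (hr : ∀ j, 2 < r j ∧ r j + 3 < p)
    (n : ℕ) (l : Fin f)
    (H : 1 < f ∨ f = 1 ∧ 0 < n ∧ ∀ a b : ResidueField R, carry ϖ a b = 0) :
    IsEigen F ϖ E p r w (sElt F ϖ E p r w (n + 1) (p ^ (l : ℕ) * (r l + 1))) := by
  intro k
  have hr' : ∀ j, r j < p := fun j => by have := (hr j).2; omega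
  set ρ := residue R (k.1 1 1) / residue R (k.1 0 0) with hρ
  set g : R → ResidueField R := fun ν => digit ϖ n (mob k.1 ν) with hg
  set A : E := algebraMap (ResidueField R) E ρ ^ p ^ (l : ℕ) with hA
  set B : R → E := fun ν => algebraMap (ResidueField R) E (g ν) ^ p ^ (l : ℕ) with hB
  have hpoly := fun ν => sub_pow_mem_polySpace (R := R) hq hr' l A (B ν)
  obtain ⟨ψ, hψ, hX, hY⟩ := exists_section (ϖ := ϖ) (w := w) hq hr' n
    (fun ν => chi E p r w k • _) (fun ν => Submodule.smul_mem _ _ (hpoly ν).1)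
  refine ⟨chi E p r w k * A ^ (r l + 1), fun hk => ?_, ?_⟩
  · rw [chi_eq_one hk, hA, hρ, hk.2.1, hk.2.2]
    simp
  have hmem : (fun μ => (chi E p r w k * (algebraMap (ResidueField R) E (digit ϖ n (mob k.1 μ)) ^
      p ^ (l : ℕ)) ^ (r l + 1)) • xTop E r) ∈ sections ϖ E p r w (n + 1) := by
    intro μ c
    have := digit_mob_add ϖ k n μ (ϖ * c)
    rw [← mul_assoc, ← pow_succ, map_mul, residue_unif ϖ, zero_mul, mul_zero, add_zero] at this
    simp only [this]
    rw [map_smul, sigma_upper_xTop]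
  rw [sElt_eq, indRep_lift k (sSec_mem n l) hmem (fun μ => by
    rw [sSec, map_smul, sigma_diag_xTop, smul_smul, mul_comm])]
  refine sub_mem_range_of_outward hψ ?_ ?_ fun μ => ?_
  · rintro rfl
    obtain H | H := H
    · rw [hY, map_smul, (hpoly _).2, if_neg, smul_zero, mul_zero]
      intro h
      obtain ⟨j, hj⟩ := Fintype.exists_ne_of_one_lt_card (by simpa using H) l
      have h1 := congrFun h j
      rw [Pi.single_eq_of_ne hj] at h1
      have := (hr j).1
      omega
    · exact absurd H.2.1 (lt_irrefl 0)
  · rintro m rfl μ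
    obtain H | ⟨rfl, -, H⟩ := H
    · refine inward_eq_zero (fun μ => ?_) _ _
      rw [hY, map_smul, (hpoly _).2, if_neg, smul_zero, mul_zero]
      intro h
      obtain ⟨j, hj⟩ := Fintype.exists_ne_of_one_lt_card (by simpa using H) l
      have h1 := congrFun h j
      rw [Pi.single_eq_of_ne hj] at h1
      have := (hr j).1
      omega
    · obtain ⟨q₀, q₁, q₂, hqd⟩ := exists_digit_mob_eq_quadratic ϖ H k m (low ϖ m μ)
      have hr1 : r = Pi.single l (r l) := by
        funext j
        rw [Subsingleton.elim j l, Pi.single_eq_same]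
      have hl : l = 0 := Subsingleton.elim _ _
      set b := digit ϖ m μ with hb
      set Q : E := (-1) ^ (∑ j, r j) * (chi E p r w k * ((r l + 1 : ℕ) * A ^ r l)) with hQ
      rw [← sum_quadratic_smul_yTop (R := R) (w := w) hq (hr 0).2
        (Q * algebraMap (ResidueField R) E (q₀ + q₁ * b + q₂ * b ^ 2))
        (Q * algebraMap (ResidueField R) E (q₁ + 2 * q₂ * b))
          (Q * algebraMap (ResidueField R) E q₂)]
      refine Finset.sum_congr rfl fun c _ => ?_
      congr 1
      have hlow : low ϖ (m + 1) (μ + ϖ ^ m * teich c) = low ϖ m μ + ϖ ^ m * teich (b + c) := by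
        rw [low_succ, low_add_mul, digit_add_mul, residue_teich]
      rw [hY, map_smul, (hpoly _).2, if_pos hr1, hB, hlow, hg]
      simp only [hqd]
      rw [hQ, smul_eq_mul, show p ^ (l : ℕ) = 1 by rw [hl]; simp, pow_one]
      simp only [map_add, map_mul, map_pow, map_ofNat]
      ring
  · simp only [outward, hX, sSec, smul_smul, ← add_smul, Pi.smul_apply, smul_eq_mul]
    congr 1
    rw [digit_mob, map_add, map_mul, add_pow_char_pow, mul_pow, ← hρ, ← hA]
    simp only [hB, hg, mul_pow]
    ring

/-- `t_{n+1}^l` is an eigenvector if `F` is ramified. -/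
theorem isEigen_tElt (hq : Nat.card (ResidueField R) = p ^ f) (hr : ∀ j, 2 < r j ∧ r j + 3 < p)
    (hc : ∀ a b : ResidueField R, carry ϖ a b = 0) (n : ℕ) (l : Fin f) :
    IsEigen F ϖ E p r w (tElt F ϖ E p r w (n + 1) l) := by
  intro k
  have hr' : ∀ j, r j < p := fun j => by have := (hr j).2; omega
  have hr0 : ∀ j, 0 < r j := fun j => by have := (hr j).1; omega
  set ρ := residue R (k.1 1 1) / residue R (k.1 0 0) with hρ
  set A : E := algebraMap (ResidueField R) E ρ ^ p ^ (l : ℕ) with hA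
  choose q₀ q₁ q₂ hqd using exists_digit_mob_eq_quadratic ϖ hc k n
  set c₀ : R → E := fun ν => -(chi E p r w k * algebraMap (ResidueField R) E (q₀ ν) ^ p ^ (l : ℕ))
  set c₁ : R → E := fun ν => -(chi E p r w k * algebraMap (ResidueField R) E (q₁ ν) ^ p ^ (l : ℕ))
  set c₂ : R → E := fun ν => -(chi E p r w k * algebraMap (ResidueField R) E (q₂ ν) ^ p ^ (l : ℕ))
  set X : ℕ → ResidueField R → E := fun i a => (algebraMap (ResidueField R) E a ^ p ^ (l : ℕ)) ^ i
    with hX'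
  have hXmem : ∀ i ≤ 2, X i ∈ polySpace E p hq r := fun i hi =>
    pow_mem_polySpace E p hq (by have := (hr l).1; omega) (hr' l)
  have hXco : ∀ i ≤ 2, coef E p hq (fun j => ⟨r j, hr' j⟩) (X i) = 0 := fun i hi => by
    have h2 := (hr l).1
    have h3 := (hr l).2
    rw [hX', coef_pow E p hq l (by omega), if_neg]
    intro h'
    have : r l = (Pi.single l i : Fin f → ℕ) l := congrFun h' l
    rw [Pi.single_eq_same] at this
    omega
  obtain ⟨ψ, hψ, hX, hY⟩ := exists_section (ϖ := ϖ) (w := w) hq hr' n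
    (fun ν => c₀ ν • X 0 + c₁ ν • X 1 + c₂ ν • X 2)
    (fun ν => Submodule.add_mem _ (Submodule.add_mem _ (Submodule.smul_mem _ _ (hXmem 0 (by omega)))
      (Submodule.smul_mem _ _ (hXmem 1 (by omega)))) (Submodule.smul_mem _ _ (hXmem 2 le_rfl)))
  have hY0 : ∀ μ, evY E r (ψ μ) = 0 := fun μ => by
    rw [hY, map_add, map_add, map_smul, map_smul, map_smul, hXco 0 (by omega), hXco 1 (by omega),
      hXco 2 le_rfl]
    simp
  refine ⟨chi E p r w k * A, fun hk => ?_, ?_⟩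
  · rw [chi_eq_one hk, hA, hρ, hk.2.1, hk.2.2]
    simp
  have hmem : (fun μ => (chi E p r w k * A) • xyTop E r l - (chi E p r w k *
      algebraMap (ResidueField R) E (digit ϖ (n + 1) (mob k.1 μ)) ^ p ^ (l : ℕ)) • xTop E r) ∈
      sections ϖ E p r w (n + 1) := by
    intro μ c
    simp only [digit_mob_add, ← hρ]
    rw [map_sub, map_smul, map_smul, sigma_upper_xTop, sigma_upper_xyTop hq hr' hr0, map_add,
      map_mul, add_pow_char_pow, mul_pow, map_neg, map_neg, neg_pow_prime_pow, ← hA]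
    module
  rw [tElt_eq, indRep_lift k (tSec_mem hq hr' hr0 (n + 1) l) hmem (fun μ => by
    rw [tSec, map_sub, map_smul, sigma_diag_xTop, sigma_diag_xyTop hq hr' hr0, smul_smul, mul_comm
      (chi E p r w k) (algebraMap _ E (digit _ _ _) ^ _)])]
  refine sub_mem_range_of_outward hψ (fun _ => hY0 0) (fun m _ μ => inward_eq_zero hY0 m μ)
    fun μ => ?_
  simp only [outward, hX, tSec]
  have e : algebraMap (ResidueField R) E (digit ϖ (n + 1) (mob k.1 μ)) ^ p ^ (l : ℕ) =
      A * algebraMap (ResidueField R) E (digit ϖ (n + 1) μ) ^ p ^ (l : ℕ) +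
      (algebraMap (ResidueField R) E (q₀ (low ϖ n μ)) ^ p ^ (l : ℕ) * X 0 (digit ϖ n μ) +
      algebraMap (ResidueField R) E (q₁ (low ϖ n μ)) ^ p ^ (l : ℕ) * X 1 (digit ϖ n μ) +
      algebraMap (ResidueField R) E (q₂ (low ϖ n μ)) ^ p ^ (l : ℕ) * X 2 (digit ϖ n μ)) := by
    rw [digit_mob, low_succ, hqd]
    simp only [map_add, map_mul, add_pow_char_pow, mul_pow, map_pow, ← hρ, ← hA, hX']
    ring
  rw [e]
  simp only [Pi.add_apply, Pi.smul_apply, smul_eq_mul, c₀, c₁, c₂]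
  module

theorem lift_zero (v : Weight E r) :
    lift F ϖ E p r w 0 (fun _ : R => v) = tens F ϖ E p r w 1 v := by
  change ∑ d : Fin 0 → ResidueField R, _ = _
  have h : ∀ d : Fin 0 → ResidueField R, digitElt ϖ d = 0 := fun d => by simp [digitElt]
  simp only [h, gMat_zero, upper_zero, map_one]
  simp

theorem isEigen_one : IsEigen F ϖ E p r w (tens F ϖ E p r w 1 (xTop E r)) := by
  intro k
  refine ⟨chi E p r w k, fun hk => chi_eq_one hk, ?_⟩
  have hx : (fun _ : R => xTop E r) ∈ sections ϖ E p r w 0 := fun μ c => by rw [sigma_upper_xTop]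
  rw [← lift_zero, indRep_lift k hx (Submodule.smul_mem _ (chi E p r w k) hx)
    (fun μ => sigma_diag_xTop k),
    map_smul, sub_self]
  exact zero_mem _

end Sections

/-! ### The structure of the outermost level -/

section Top

variable {R : Type*} [CommRing R] [IsDomain R] [IsDiscreteValuationRing R]
  [HenselianLocalRing R] [Finite (ResidueField R)] {ϖ : R} [hϖ : Fact (Irreducible ϖ)]
  {E : Type*} [Field E] [Algebra (ResidueField R) E] {p : ℕ} [hp : Fact p.Prime] [CharP E p]
  {f : ℕ} {r : Fin f → ℕ} {w : ℕ}

/-- The index `k - 1` modulo `f`; twisting by Frobenius `f - 1` times and then `k` times is the same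
as twisting `k - 1` times. -/
def cyclicPred (k : Fin f) : Fin f :=
  if (k : ℕ) = 0 then ⟨f - 1, by have := k.2; omega⟩ else ⟨k - 1, by have := k.2; omega⟩

theorem cyclicPred_injective : Function.Injective (cyclicPred : Fin f → Fin f) := by
  intro k l h
  have hk := k.2
  have hl := l.2
  rw [Fin.ext_iff, cyclicPred, cyclicPred] at h
  rw [Fin.ext_iff]
  split_ifs at h <;> simp only at h <;> omega

theorem pow_pow_cyclicPred (hq : Nat.card (ResidueField R) = p ^ f) (k : Fin f)
    (x : ResidueField R) : (x ^ p ^ (f - 1)) ^ p ^ (k : ℕ) = x ^ p ^ (cyclicPred k : ℕ) := by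
  have hk := k.2
  rw [← pow_mul, ← pow_add, cyclicPred]
  split_ifs with h
  · rw [h, add_zero]
  · have : f - 1 + (k : ℕ) = f + (k - 1) := by omega
    rw [this, pow_add, pow_mul, ← hq, Nat.card_eq_fintype_card, FiniteField.pow_card]

theorem algebraMap_carry_pow [CharP (ResidueField R) p]
    (hq : Nat.card (ResidueField R) = p ^ f) {ε : R} (hε : (p : R) = ϖ * ε) (k : Fin f)
    (a b : ResidueField R) :
    algebraMap (ResidueField R) E (carry ϖ a b) ^ p ^ (k : ℕ) =
      ∑ i ∈ Finset.Ioo 0 p, (-(algebraMap (ResidueField R) E (residue R ε) ^ p ^ (k : ℕ)) *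
        (algebraMap (ResidueField R) E b ^ p ^ (cyclicPred k : ℕ)) ^ (p - i) *
        ((p.choose i / p : ℕ) : E) ^ p ^ (k : ℕ)) *
        (algebraMap (ResidueField R) E a ^ p ^ (cyclicPred k : ℕ)) ^ i := by
  have hk := k.2
  rw [carry_eq ϖ p f (by omega) hq ε hε, map_mul, map_neg, mul_pow, neg_pow_prime_pow, map_sum,
    sum_pow_char_pow, Finset.mul_sum]
  refine Finset.sum_congr rfl fun i _ => ?_
  simp only [map_mul, mul_pow, map_pow, map_natCast]
  have h : ∀ (x : ResidueField R) (j : ℕ), ((algebraMap (ResidueField R) E x ^ p ^ (f - 1)) ^ j) ^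
      p ^ (k : ℕ) = (algebraMap (ResidueField R) E x ^ p ^ (cyclicPred k : ℕ)) ^ j := fun x j => by
    rw [← pow_mul, mul_comm j, pow_mul, ← map_pow, ← map_pow, pow_pow_cyclicPred hq, map_pow]
  rw [h, h]
  ring

/-- The multi-index `n e_l`. -/
def singleIdx (l : Fin f) (n : ℕ) (hn : n < p) : Fin f → Fin p := fun m =>
  ⟨(Pi.single l n : Fin f → ℕ) m, by
    rw [Pi.single_apply]
    split_ifs
    exacts [hn, hp.out.pos]⟩

theorem singleIdx_coe (l : Fin f) (n : ℕ) (hn : n < p) :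
    (fun m => (singleIdx l n hn m : ℕ)) = Pi.single l n := rfl

theorem single_eq_single_iff {m l : Fin f} {i j : ℕ} (hi : i ≠ 0) :
    (Pi.single m i : Fin f → ℕ) = Pi.single l j ↔ m = l ∧ i = j := by
  constructor
  · intro h
    have h1 := congrFun h m
    rw [Pi.single_eq_same, Pi.single_apply] at h1
    split_ifs at h1 with h2
    · exact ⟨h2, h1⟩
    · exact absurd h1 hi
  · rintro ⟨rfl, rfl⟩
    rfl

/-- In the unramified case no `t`-component can occur: comparing the coefficients of
`a ^ ((p - 1) p^(k - 1)) b ^ (p^(k - 1))`, those of the carry are nonzero, whereas those of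
`A (a + b) - A a` are zero, since the binomial coefficient of `p` and `p - 1` is. -/
theorem eq_zero_of_translate_sub_carry [CharP (ResidueField R) p]
    (hq : Nat.card (ResidueField R) = p ^ f) (hr : ∀ j, r j + 1 < p) {ε : R}
    (hε : (p : R) = ϖ * ε) (h0 : residue R ε ≠ 0) (A : ResidueField R → E) (B : Fin f → E)
    (H : ∀ b, (fun a => A (a + b) - A a -
      ∑ k, B k * algebraMap (ResidueField R) E (carry ϖ a b) ^ p ^ (k : ℕ)) ∈ polySpace E p hq r) :
    B = 0 := by
  funext k₀
  have hp2 := hp.out.two_le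
  set m₀ := cyclicPred k₀
  set i₀ : Fin f → Fin p := singleIdx m₀ (p - 1) (by omega) with hi₀
  set ε' := algebraMap (ResidueField R) E (residue R ε) ^ p ^ (k₀ : ℕ) with hε'
  have hchoose : p.choose (p - 1) / p = 1 := by
    rw [Nat.choose_symm_of_eq_add (show p = (p - 1) + 1 by omega), Nat.choose_one_right,
      Nat.div_self hp.out.pos]
  have h1 : ∀ b, coef E p hq i₀ (fun a => A (a + b)) =
      coef E p hq i₀ A - B k₀ * ε' * (algebraMap (ResidueField R) E b ^ p ^ (m₀ : ℕ)) ^ 1 := by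
    intro b
    have hb := H b i₀ ⟨m₀, by
      simp only [hi₀, singleIdx, Pi.single_eq_same]
      have := hr m₀
      omega⟩
    have e : (fun a => A (a + b) - A a -
        ∑ k, B k * algebraMap (ResidueField R) E (carry ϖ a b) ^ p ^ (k : ℕ)) =
        (fun a => A (a + b)) - A - ∑ k, ∑ i ∈ Finset.Ioo 0 p, (B k *
          (-(algebraMap (ResidueField R) E (residue R ε) ^ p ^ (k : ℕ)) *
          (algebraMap (ResidueField R) E b ^ p ^ (cyclicPred k : ℕ)) ^ (p - i) *
          ((p.choose i / p : ℕ) : E) ^ p ^ (k : ℕ))) •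
        (fun a => (algebraMap (ResidueField R) E a ^ p ^ (cyclicPred k : ℕ)) ^ i) := by
      funext a
      simp only [Pi.sub_apply, Finset.sum_apply, Pi.smul_apply, smul_eq_mul,
        algebraMap_carry_pow hq hε, Finset.mul_sum, mul_assoc]
    rw [e, map_sub, map_sub, map_sum, Finset.sum_eq_single k₀, map_sum,
      Finset.sum_eq_single (p - 1)] at hb
    · rw [map_smul, coef_pow E p hq _ (by omega), if_pos (singleIdx_coe _ _ _), hchoose,
      Nat.cast_one, one_pow,
        show p - (p - 1) = 1 by omega, smul_eq_mul] at hb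
      linear_combination hb
    · intro i hi hne
      rw [map_smul, coef_pow E p hq _ (Finset.mem_Ioo.1 hi).2, if_neg, smul_zero]
      intro h
      exact hne ((single_eq_single_iff (by omega)).1 h).2.symm
    · intro h
      exact absurd (Finset.mem_Ioo.2 ⟨by omega, by omega⟩) h
    · intro k _ hk
      rw [map_sum]
      refine Finset.sum_eq_zero fun i hi => ?_
      rw [map_smul, coef_pow E p hq _ (Finset.mem_Ioo.1 hi).2, if_neg, smul_zero]
      intro h
      exact hk (cyclicPred_injective ((single_eq_single_iff (by omega)).1 h).1.symm)
    · simp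
  set i₁ : Fin f → Fin p := singleIdx m₀ 1 (by omega) with hi₁
  have h2 : coef E p hq i₁ (fun b => coef E p hq i₀ (fun a => A (a + b))) = 0 := by
    have e : (fun b => coef E p hq i₀ (fun a => A (a + b))) = ∑ j : Fin f → Fin p,
        (coef E p hq j A * ∏ m, ((j m : ℕ).choose (i₀ m) : E)) •
          (monom E p (fun m => (((fun m => ⟨(j m : ℕ) - i₀ m, by have := (j m).2; omega⟩) :
            Fin f → Fin p) m : ℕ)) : ResidueField R → E) := by
      funext b
      rw [coef_translate, Finset.sum_apply]
      exact Finset.sum_congr rfl fun j _ => by rw [Pi.smul_apply, smul_eq_mul, mul_assoc]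
    rw [e, map_sum]
    refine Finset.sum_eq_zero fun j _ => ?_
    rw [map_smul, coef_monom, if_neg, smul_zero]
    intro h
    have h3 : (j m₀ : ℕ) - i₀ m₀ = i₁ m₀ := congrArg Fin.val (congrFun h m₀)
    simp only [hi₀, hi₁, singleIdx, Pi.single_eq_same] at h3
    have := (j m₀).2
    omega
  have h3 : (fun b => coef E p hq i₀ (fun a => A (a + b))) = (fun _ => coef E p hq i₀ A) -
      (B k₀ * ε') • (fun b => (algebraMap (ResidueField R) E b ^ p ^ (m₀ : ℕ)) ^ 1) := by
    funext b
    rw [h1]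
    rfl
  rw [h3, map_sub, map_smul, coef_const, coef_pow E p hq _ (by omega), if_neg,
    if_pos (singleIdx_coe _ _ _), zero_sub, smul_eq_mul, mul_one, neg_eq_zero] at h2
  · refine (mul_eq_zero.1 h2).resolve_right (pow_ne_zero _ ?_)
    rwa [Ne, map_eq_zero]
  · intro h
    have := h m₀
    simp [hi₁, singleIdx] at this

theorem evX_xyTop (hr0 : ∀ j, 0 < r j) (k : Fin f) : evX E r (xyTop E r k) = 0 := by
  change aeval _ (∏ j, X (j, 0) ^ _ *
    X (j, 1) ^ ((Pi.single k 1 : (j : Fin f) → Fin (r j + 1)) j : ℕ)) = 0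
  rw [map_prod]
  refine Finset.prod_eq_zero (Finset.mem_univ k) ?_
  rw [val_single_one hr0]
  simp

theorem eq_zero_of_smul_xTop_add (hq : Nat.card (ResidueField R) = p ^ f)
    (hr0 : ∀ j, 0 < r j) {a : E} {B : Fin f → E}
    (h : a • xTop E r + ∑ k, B k • xyTop E r k = 0) : a = 0 ∧ B = 0 := by
  have ha : a = 0 := by
    have := congrArg (evX E r) h
    simpa [map_sum, evX_xTop, evX_xyTop hr0] using this
  refine ⟨ha, funext fun k => ?_⟩
  rw [ha, zero_smul, zero_add] at h
  have hp2 := hp.out.two_le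
  have hxy : ∀ k', genFun (R := R) E p r 0 (xyTop E r k') =
      -(fun a => (algebraMap (ResidueField R) E a ^ p ^ (k' : ℕ)) ^ 1) := fun k' =>
      funext fun a => by
    rw [genFun_xyTop E p 0 hr0, Pi.neg_apply, pow_one]
  have h1 := congrArg (coef E p hq (singleIdx k 1 (by omega)))
    (congrArg (genFun (R := R) E p r 0) h)
  rw [map_zero, map_zero, map_sum, map_sum, Finset.sum_eq_single k] at h1
  · rw [map_smul, map_smul, hxy, map_neg, coef_pow E p hq _ (by omega),
      if_pos (singleIdx_coe _ _ _), smul_neg, neg_eq_zero, smul_eq_mul, mul_one] at h1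
    exact h1
  · intro b _ hb
    rw [map_smul, map_smul, hxy, map_neg, coef_pow E p hq _ (by omega), if_neg, neg_zero, smul_zero]
    exact fun h' => hb ((single_eq_single_iff one_ne_zero).1 h').1.symm
  · simp

/-- If all translates of a section on level `N + 1` differ from it by the outward image of a section
on level `N`, then the section itself is the outward image of a section on level `N` up to a
combination of `s_{N+1}^{p^l (r_l + 1)}` and `t_{N+1}^k`; if `F` is unramified, the latter do not
occur. -/
theorem exists_eq_outward_add [CharP (ResidueField R) p]
    (hq : Nat.card (ResidueField R) = p ^ f) (hr : ∀ j, 0 < r j ∧ r j + 1 < p) {ε : R}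
    (hε : (p : R) = ϖ * ε) (N : ℕ) {Φ : R → Weight E r} (hΦ : Φ ∈ sections ϖ E p r w (N + 1))
    (H : ∀ b, ∃ ψ ∈ sections ϖ E p r w N, ∀ μ, Φ (μ + b) - Φ μ = outward ψ μ) :
    ∃ ψ ∈ sections ϖ E p r w N, ∃ A B : Fin f → E,
      (∀ μ, Φ μ = outward ψ μ + ∑ l, A l • sSec ϖ E r N l p μ +
        ∑ k, B k • tSec ϖ E r (N + 1) k p μ) ∧ (residue R ε ≠ 0 → B = 0) := by
  have hr' : ∀ j, r j < p := fun j => by have := (hr j).2; omega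
  have hr0 : ∀ j, 0 < r j := fun j => (hr j).1
  have hp2 := hp.out.two_le
  have hΦc : ∀ μ c, Φ (μ + ϖ ^ (N + 1) * c) = sigma E p r w (upper (-c)) (Φ μ) := hΦ
  -- every value is a combination of the vectors `x` and `x^{r_k - 1} y`
  have h1 : ∀ μ, ∃ (a : E) (B : Fin f → E), Φ μ = a • xTop E r + ∑ k, B k • xyTop E r k :=
    fun μ => exists_eq_of_sigma_upper_sub E p w hq hr' hr0 (Φ μ) fun c => by
      obtain ⟨ψ, -, h⟩ := H (ϖ ^ (N + 1) * -c)
      have h' := h μ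
      rw [hΦc, neg_neg] at h'
      exact ⟨_, h'⟩
  choose a Bμ haB using h1
  obtain ⟨B, hB⟩ : ∃ B, B = Bμ 0 := ⟨_, rfl⟩
  have hBμ : ∀ μ, Bμ μ = B := fun μ => by
    obtain ⟨ψ, -, h⟩ := H μ
    have h' : (a μ - a 0 - evX E r (ψ 0)) • xTop E r + ∑ k, (Bμ μ - B) k • xyTop E r k = 0 := by
      have h' := h 0
      rw [zero_add, haB, haB 0, ← hB, outward] at h'
      simp only [Pi.sub_apply, sub_smul, Finset.sum_sub_distrib]
      rw [← sub_eq_zero.2 h']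
      abel
    exact sub_eq_zero.1 (eq_zero_of_smul_xTop_add hq hr0 h').2
  simp only [hBμ] at haB
  have hxne : ∀ {c d : E} {v : Weight E r}, c • xTop E r + v = d • xTop E r + v → c = d := by
    intro c d v h
    have h' := congrArg (evX E r) (add_right_cancel h)
    rwa [map_smul, map_smul, evX_xTop, smul_eq_mul, smul_eq_mul, mul_one, mul_one] at h'
  -- the coefficient of `x`, made periodic
  set D : R → Fin f → E := fun μ k =>
    algebraMap (ResidueField R) E (digit ϖ (N + 1) μ) ^ p ^ (k : ℕ) with hD
  set a' : R → E := fun μ => a μ + ∑ k, B k * D μ k with ha'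
  have haper : ∀ μ c, a' (μ + ϖ ^ (N + 1) * c) = a' μ := by
    intro μ c
    have h := hΦc μ c
    rw [haB, haB μ, map_add, map_smul, sigma_upper_xTop, map_sum] at h
    simp only [map_smul, sigma_upper_xyTop hq hr' hr0, smul_add, Finset.sum_add_distrib, smul_smul,
      ← Finset.sum_smul] at h
    rw [← add_assoc, add_right_comm, ← add_smul] at h
    have h2 := hxne h
    simp only [ha', hD, digit_add_mul, map_add, add_pow_char_pow, mul_add, Finset.sum_add_distrib]
    rw [h2]
    simp only [map_neg, neg_pow_prime_pow, mul_neg, Finset.sum_neg_distrib]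
    ring
  have hΦa' : ∀ μ, Φ μ = a' μ • xTop E r + ∑ k, B k • tSec ϖ E r (N + 1) k p μ := by
    intro μ
    rw [haB, ha']
    simp only [tSec, smul_sub, Finset.sum_sub_distrib, add_smul, Finset.sum_smul, smul_smul, hD]
    abel
  have hdiff : ∀ b, ∃ ψ ∈ sections ϖ E p r w N, ∀ μ, a' (μ + b) - a' μ -
      ∑ k, B k * (D (μ + b) k - D μ k) = evX E r (ψ μ) := by
    intro b
    obtain ⟨ψ, hψ, h⟩ := H b
    refine ⟨ψ, hψ, fun μ => ?_⟩
    have h' := h μ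
    rw [haB, haB μ, add_sub_add_right_eq_sub, ← sub_smul, outward] at h'
    have h2 := congrArg (evX E r) h'
    rw [map_smul, map_smul, evX_xTop, smul_eq_mul, smul_eq_mul, mul_one, mul_one] at h2
    rw [← h2]
    simp only [ha', mul_sub, Finset.sum_sub_distrib]
    ring
  -- the dependence on the digit at `ϖ ^ N`
  set AA : R → ResidueField R → E := fun ν x => a' (low ϖ N ν + ϖ ^ N * teich x) with hAA
  have hdig : ∀ (ν : R) (y : R), digit ϖ (N + 1) (low ϖ N ν + ϖ ^ N * y) = digit ϖ 1 y := by
    intro ν y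
    rw [add_comm N, ← digit_tail, tail_add_mul, tail_low, zero_add]
  have hgen : ∀ {ψ : R → Weight E r}, ψ ∈ sections ϖ E p r w N → ∀ ν,
      (fun x => evX E r (ψ (ν + ϖ ^ N * teich x))) ∈ polySpace E p hq r := by
    intro ψ hψ ν
    have : (fun x => evX E r (ψ (ν + ϖ ^ N * teich x))) = genFun (R := R) E p r w (ψ ν) :=
      funext fun x => evX_add_mul hψ ν x
    rw [this]
    exact genFun_mem E p w hq hr' _
  have hstar : ∀ ν b, (fun x => AA ν (x + b) - AA ν x - ∑ k, B k *
      algebraMap (ResidueField R) E (carry ϖ x b) ^ p ^ (k : ℕ)) ∈ polySpace E p hq r := by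
    intro ν b
    obtain ⟨ψ, hψ, h⟩ := hdiff (ϖ ^ N * teich b)
    convert hgen hψ (low ϖ N ν) using 1
    funext x
    rw [← h, add_assoc, ← mul_add]
    have e1 : a' (low ϖ N ν + ϖ ^ N * (teich x + teich b)) = AA ν (x + b) := by
      have : low ϖ N ν + ϖ ^ N * (teich x + teich b) = low ϖ N ν + ϖ ^ N * teich (x + b) +
          ϖ ^ (N + 1) * shift ϖ (teich x + teich b) := by
        have := shift_spec ϖ (teich x + teich b)
        rw [map_add, residue_teich, residue_teich] at this
        rw [pow_succ]
        linear_combination ϖ ^ N * this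
      rw [this, haper]
    rw [e1]
    simp only [hD, hdig, digit_one_teich, map_zero]
    congr 1
    refine Finset.sum_congr rfl fun k _ => ?_
    rw [zero_pow (pow_ne_zero _ hp.out.ne_zero), sub_zero]
    rfl
  have hB0 : residue R ε ≠ 0 → B = 0 := fun h =>
    eq_zero_of_translate_sub_carry hq (fun j => (hr j).2) hε h (AA 0) B (hstar 0)
  have hcarry : ∀ x b, ∑ k, B k *
      algebraMap (ResidueField R) E (carry ϖ x b) ^ p ^ (k : ℕ) = 0 := by
    intro x b
    by_cases h : residue R ε = 0
    · refine Finset.sum_eq_zero fun k _ => ?_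
      have hk := k.2
      rw [carry_eq_zero ϖ p f (by omega) hq ε hε h, map_zero,
        zero_pow (pow_ne_zero _ hp.out.ne_zero), mul_zero]
    · rw [hB0 h]
      simp
  -- the coefficients of the monomials that are not accounted for by sections on level `N`
  have hlt : ∀ l, r l + 1 < p := fun l => (hr l).2
  set A : Fin f → E := fun l => coef E p hq (singleIdx l (r l + 1) (hlt l)) (AA 0) with hA
  have hindep : ∀ ν l, coef E p hq (singleIdx l (r l + 1) (hlt l)) (AA ν) = A l := by
    intro ν l
    obtain ⟨ψ, hψ, h⟩ := hdiff (low ϖ N ν - low ϖ N 0)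
    have h2 := hgen hψ (low ϖ N 0) (singleIdx l (r l + 1) (hlt l)) ⟨l, by simp [singleIdx]⟩
    have e : (fun x => evX E r (ψ (low ϖ N 0 + ϖ ^ N * teich x))) = AA ν - AA 0 := by
      funext x
      have e1 : low ϖ N 0 + ϖ ^ N * teich x + (low ϖ N ν - low ϖ N 0) =
        low ϖ N ν + ϖ ^ N * teich x := by ring
      rw [← h, e1]
      simp only [hD, hdig, sub_self, mul_zero, Finset.sum_const_zero, sub_zero]
      rfl
    rw [e, map_sub] at h2
    exact sub_eq_zero.1 h2
  have hmem : ∀ ν, AA ν - ∑ l, A l • (fun x => (algebraMap (ResidueField R) E x ^ p ^ (l : ℕ)) ^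
      (r l + 1)) ∈ polySpace E p hq r := by
    intro ν i hi
    rw [map_sub, map_sum]
    by_cases hl : ∃ l, (fun m => (i m : ℕ)) = Pi.single l (r l + 1)
    · obtain ⟨l, hl⟩ := hl
      have hil : i = singleIdx l (r l + 1) (hlt l) := funext fun m => Fin.ext (congrFun hl m)
      rw [Finset.sum_eq_single l]
      · rw [map_smul, coef_pow E p hq _ (hlt l), if_pos hl, hil, hindep, smul_eq_mul, mul_one,
          sub_self]
      · intro m _ hm
        rw [map_smul, coef_pow E p hq _ (hlt m), if_neg, smul_zero]
        rw [hl]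
        exact fun h => hm ((single_eq_single_iff (Nat.succ_ne_zero _)).1 h).1.symm
      · simp
    · have hl' : ∀ l, (fun m => (i m : ℕ)) ≠ Pi.single l (r l + 1) := fun l h => hl ⟨l, h⟩
      rw [coef_eq_zero_of_translate_sub_mem E p hq r (AA ν) (fun b => ?_) i hi hl', zero_sub,
        neg_eq_zero]
      · refine Finset.sum_eq_zero fun l _ => ?_
        rw [map_smul, coef_pow E p hq _ (hlt l), if_neg (hl' l), smul_zero]
      · have := hstar ν b
        simp only [hcarry, sub_zero] at this
        exact this
  obtain ⟨ψ, hψ, hX, -⟩ := exists_section (ϖ := ϖ) (w := w) hq hr' N _ hmem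
  refine ⟨ψ, hψ, A, B, fun μ => ?_, hB0⟩
  rw [hΦa', outward, hX]
  congr 1
  simp only [sSec, smul_smul, ← Finset.sum_smul, ← add_smul]
  congr 1
  have e : AA (low ϖ N μ) (digit ϖ N μ) = a' μ := by
    rw [hAA]
    simp only [low_low, ← low_succ]
    conv_rhs => rw [← low_add_tail ϖ (N + 1) μ, haper]
  rw [Pi.sub_apply, e, Finset.sum_apply]
  simp only [Pi.smul_apply, smul_eq_mul, sub_add_cancel]

end Top

/-! ### Generation of the invariants -/

section Spanning

variable {R : Type*} [CommRing R] [IsDomain R] [IsDiscreteValuationRing R]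
  [HenselianLocalRing R] [Finite (ResidueField R)]
  {F : Type*} [Field F] [Algebra R F] [IsFractionRing R F] {ϖ : R} [hϖ : Fact (Irreducible ϖ)]
  {E : Type*} [Field E] [Algebra (ResidueField R) E] {p : ℕ} [hp : Fact p.Prime] [CharP E p]
  {f : ℕ} {r : Fin f → ℕ} {w : ℕ}

variable (F ϖ E p r w) in
/-- The elements of the compact induction whose images modulo `T` are invariant under `I(1)`. -/
def invMod : Submodule E (ind F ϖ E p r w) where
  carrier := {φ | ∀ k : iwahori R, k.1 ∈ iwahoriOne R →
    indRep F ϖ E p r w (inclK R F k) φ - φ ∈ LinearMap.range (hecke F ϖ E p r w)}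
  zero_mem' := fun k _ => by
    rw [map_zero, sub_zero]
    exact zero_mem _
  add_mem' := fun ha hb k hk => by
    rw [map_add, add_sub_add_comm]
    exact add_mem (ha k hk) (hb k hk)
  smul_mem' := fun c φ hφ k hk => by
    have h := Submodule.smul_mem _ c (hφ k hk)
    rw [smul_sub] at h
    rwa [map_smul]

theorem IsEigen.mem_invMod {φ : ind F ϖ E p r w} (h : IsEigen F ϖ E p r w φ) :
    φ ∈ invMod F ϖ E p r w := fun k hk => by
  obtain ⟨c, hc, h'⟩ := h k
  rwa [hc hk, one_smul] at h'

theorem range_hecke_le_invMod :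
    LinearMap.range (hecke F ϖ E p r w) ≤ invMod F ϖ E p r w := by
  rintro _ ⟨φ, rfl⟩ k -
  exact ⟨indRep F ϖ E p r w (inclK R F k) φ - φ, by rw [map_sub, hecke_indRep]⟩

theorem flip_mem_invMod {φ : ind F ϖ E p r w} (h : φ ∈ invMod F ϖ E p r w) :
    flip F ϖ E p r w φ ∈ invMod F ϖ E p r w := fun k hk => by
  obtain ⟨k', h1, h2, -⟩ := exists_conj_beta (F := F) (ϖ := ϖ) (E := E) (p := p) (r := r) (w := w) k
  obtain ⟨ψ, hψ⟩ := h k' (h2 hk)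
  exact ⟨flip F ϖ E p r w ψ, by rw [h1, ← map_sub, ← hψ, flip_hecke]⟩

/-- `φ` vanishes at all vertices on one side of the edge at distance more than `N`. -/
def VanishesBeyond (N : ℕ) (φ : ind F ϖ E p r w) : Prop := ∀ n, N < n → hat F ϖ E p r w φ n = 0

theorem VanishesBeyond.sub {N : ℕ} {φ φ' : ind F ϖ E p r w} (h : VanishesBeyond N φ)
    (h' : VanishesBeyond N φ') : VanishesBeyond N (φ - φ') := fun n hn => by
  rw [map_sub, Pi.sub_apply, h n hn, h' n hn, sub_zero]

theorem VanishesBeyond.indRep {N : ℕ} {φ : ind F ϖ E p r w} (h : VanishesBeyond N φ)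
    (k : iwahori R) : VanishesBeyond N (indRep F ϖ E p r w (inclK R F k) φ) := fun n hn => by
  funext μ
  rw [hat_iwahori, h n hn, Pi.zero_apply, map_zero, Pi.zero_apply]

/-- `(1 b; 0 1)` as an element of `I`. -/
def upperIwahori (b : R) : iwahori R := ⟨upper b, by
  change residue R (upper b 1 0) = 0
  simp [upper]⟩

theorem upperIwahori_mem (b : R) : (upperIwahori b).1 ∈ iwahoriOne R := by
  refine ⟨?_, ?_, ?_⟩ <;> simp [upperIwahori, upper]

theorem hat_upper (b : R) (φ : ind F ϖ E p r w) (n : ℕ) (μ : R) :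
    hat F ϖ E p r w (indRep F ϖ E p r w (inclK R F (upperIwahori b)) φ) n μ =
      hat F ϖ E p r w φ n (μ - b) := by
  have h : mob (upperIwahori b).1 μ = μ - b := by
    have := mob_mul (upperIwahori b).2 μ
    simpa [upperIwahori, upper] using this
  have h1 : sigma E p r w (iwahoriDiag (upperIwahori b)) = 1 := by
    rw [← map_one (sigma (R := R) E p r w)]
    apply sigma_congr
    intro i j
    fin_cases i <;> fin_cases j <;> simp [iwahoriDiag, upperIwahori, upper]
  rw [hat_iwahori, h, h1, Module.End.one_apply]

theorem inward_zero (n : ℕ) (μ : R) :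
    inward (ϖ := ϖ) (p := p) (w := w) n (0 : R → Weight E r) μ = 0 :=
  inward_eq_zero (fun μ => by rw [Pi.zero_apply, map_zero]) n μ

theorem outward_zero : outward (0 : R → Weight E r) = 0 := funext fun μ => by
  rw [outward, Pi.zero_apply, map_zero, zero_smul]

/-- The operator `T` moves the outermost level outwards by one, injectively. -/
theorem hat_eq_zero_of_hecke (hq : Nat.card (ResidueField R) = p ^ f) (hr : ∀ j, r j < p)
    {N : ℕ} {ψ : ind F ϖ E p r w} (h : VanishesBeyond N (hecke F ϖ E p r w ψ)) {n : ℕ}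
    (hn : N ≤ n) : hat F ϖ E p r w ψ n = 0 := by
  obtain ⟨M, hM⟩ := exists_hat_eq_zero ψ
  suffices ∀ d n, N ≤ n → M < n + d → hat F ϖ E p r w ψ n = 0 from this (M + 1) n hn (by omega)
  intro d
  induction d with
  | zero => exact fun n _ hn => hM n hn
  | succ d ih =>
    intro n hn hd
    funext μ
    apply genFun_injective (R := R) E p w hq hr
    funext a
    rw [← evX_add_mul (hat_mem_sections ψ n), Pi.zero_apply, map_zero, Pi.zero_apply]
    have h1 := congrFun (h (n + 1) (by omega)) (μ + ϖ ^ n * teich a)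
    rw [hat_hecke_succ, ih (n + 2) (by omega) (by omega), inward_zero, zero_add, outward] at h1
    have h2 := congrArg (evX E r) h1
    rwa [map_smul, evX_xTop, smul_eq_mul, mul_one, Pi.zero_apply, map_zero] at h2

theorem hat_hecke_of_vanishesBeyond {N : ℕ} {ψ : ind F ϖ E p r w} (h : VanishesBeyond N ψ) (μ : R) :
    hat F ϖ E p r w (hecke F ϖ E p r w ψ) (N + 1) μ = outward (hat F ϖ E p r w ψ N) μ := by
  rw [hat_hecke_succ, h _ (by omega), inward_zero, zero_add]

theorem VanishesBeyond.hecke {N : ℕ} {ψ : ind F ϖ E p r w} (h : VanishesBeyond N ψ) :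
    VanishesBeyond (N + 1) (hecke F ϖ E p r w ψ) := fun n hn => by
  obtain ⟨n, rfl⟩ := Nat.exists_eq_succ_of_ne_zero (show n ≠ 0 by omega)
  funext μ
  rw [hat_hecke_succ, h _ (by omega), h _ (by omega), inward_zero, outward_zero, zero_add]

theorem evY_hat_hecke (hr0 : ∀ j, 0 < r j) (hf : 0 < f) (ψ : ind F ϖ E p r w) (n : ℕ) (μ : R) :
    evY E r (hat F ϖ E p r w (hecke F ϖ E p r w ψ) n μ) =
      ∑ c : ResidueField R, evY E r (hat F ϖ E p r w ψ (n + 1) (μ + ϖ ^ n * teich c)) := by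
  have h : ∀ v : R → Weight E r, evY E r (inward (ϖ := ϖ) (p := p) (w := w) n v μ) =
      ∑ c : ResidueField R, evY E r (v (μ + ϖ ^ n * teich c)) := fun v => by
    rw [inward, map_sum]
    exact Finset.sum_congr rfl fun c _ => by
      rw [map_smul, evY_sigma_upper, evY_yTop, smul_eq_mul, mul_one]
  cases n with
  | zero =>
    rw [hat_hecke_zero, map_add, map_smul, evY_xTop E (hr0 ⟨0, hf⟩), smul_zero, add_zero, h]
  | succ n =>
    rw [hat_hecke_succ, map_add, outward, map_smul, evY_xTop E (hr0 ⟨0, hf⟩), smul_zero, add_zero,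
      h]

/-- Invariance modulo `T` under `(1, -b; 0, 1)`, read on the levels of both halves of the tree: on
the other half, the conjugate by `β` is a lower triangular element of `I(1)`. -/
theorem exists_hecke_eq_of_mem_invMod {φ : ind F ϖ E p r w} (h : φ ∈ invMod F ϖ E p r w) (b : R) :
    ∃ ψ, (∀ n μ, hat F ϖ E p r w φ n (μ + b) - hat F ϖ E p r w φ n μ =
      hat F ϖ E p r w (hecke F ϖ E p r w ψ) n μ) ∧
      (∀ N, VanishesBeyond N φ → VanishesBeyond N (hecke F ϖ E p r w ψ)) ∧
      ∃ k : iwahori R, k.1 ∈ iwahoriOne R ∧ k.1 0 1 = 0 ∧ hecke F ϖ E p r w (flip F ϖ E p r w ψ) =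
        indRep F ϖ E p r w (inclK R F k) (flip F ϖ E p r w φ) - flip F ϖ E p r w φ := by
  obtain ⟨ψ, hψ⟩ := h (upperIwahori (-b)) (upperIwahori_mem _)
  refine ⟨ψ, fun n μ => ?_, fun N hN => ?_, ?_⟩
  · rw [hψ, map_sub, Pi.sub_apply, Pi.sub_apply, hat_upper, sub_neg_eq_add]
  · rw [hψ]
    exact (hN.indRep _).sub hN
  · obtain ⟨k', h1, h2, h3⟩ := exists_conj_beta (F := F) (ϖ := ϖ) (E := E) (p := p) (r := r)
      (w := w) (upperIwahori (-b))
    refine ⟨k', h2 (upperIwahori_mem _), ?_, ?_⟩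
    · have h4 : (upperIwahori (-b)).1 1 0 = 0 := by simp [upperIwahori, upper]
      rw [h4] at h3
      exact (mul_eq_zero.1 h3).resolve_left hϖ.out.ne_zero
    · have h4 := h1 (flip F ϖ E p r w φ)
      rw [flip_flip] at h4
      rw [← flip_hecke, hψ, map_sub, h4, flip_flip]

/-- Lower triangular elements of `I(1)` act trivially on the values at the origin. -/
theorem hat_zero_of_lower {k : iwahori R} (hk : k.1 ∈ iwahoriOne R) (h01 : k.1 0 1 = 0)
    (φ : ind F ϖ E p r w) : hat F ϖ E p r w (indRep F ϖ E p r w (inclK R F k) φ) 0 0 =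
      hat F ϖ E p r w φ 0 0 := by
  have h : mob k.1 0 = 0 := by
    have := mob_mul k.2 0
    rw [mul_zero (k.1 1 1), h01, sub_zero] at this
    exact (mul_eq_zero.1 this).resolve_right (isUnit_denom k.2 0).ne_zero
  have h1 : sigma E p r w (iwahoriDiag k) = 1 := by
    rw [← map_one (sigma (R := R) E p r w)]
    apply sigma_congr
    intro i j
    fin_cases i <;> fin_cases j <;> simp [iwahoriDiag, hk.2.1, hk.2.2]
  rw [hat_iwahori, h, h1, Module.End.one_apply]

/-- Of the terms `(p choose i) / p * a ^ i * b ^ (p - i)` of the carry only `i = p - 1` has a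
nonzero sum over `a`. -/
theorem sum_carry [CharP (ResidueField R) p] (hq : Nat.card (ResidueField R) = p ^ 1) {ε : R}
    (hε : (p : R) = ϖ * ε) (b : ResidueField R) :
    ∑ a : ResidueField R, carry ϖ a b = residue R ε * b := by
  have hp2 := hp.out.two_le
  have hcard : Fintype.card (ResidueField R) = p := by
    rw [← Nat.card_eq_fintype_card, hq, pow_one]
  have hsum : ∀ i ∈ Finset.Ioo 0 p, ∑ a : ResidueField R, a ^ i = if i = p - 1 then -1 else 0 := by
    intro i hi
    have := sum_eval_eq (k := ResidueField R) (ResidueField R) (Polynomial.X ^ i) (by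
      rw [Polynomial.natDegree_X_pow, hcard]
      have := (Finset.mem_Ioo.1 hi).2
      omega)
    rw [Polynomial.coeff_X_pow, hcard] at this
    simp only [Polynomial.eval_pow, Polynomial.eval_X, Algebra.algebraMap_self,
      RingHom.id_apply] at this
    rw [this]
    by_cases h : i = p - 1
    · rw [if_pos h, if_pos h.symm]
    · rw [if_neg h, if_neg (Ne.symm h), neg_zero]
  have hchoose : p.choose (p - 1) / p = 1 := by
    rw [Nat.choose_symm_of_eq_add (show p = (p - 1) + 1 by omega), Nat.choose_one_right,
      Nat.div_self hp.out.pos]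
  simp only [carry_eq ϖ p 1 one_pos hq ε hε]
  rw [← Finset.mul_sum, Finset.sum_comm]
  simp only [Nat.sub_self, pow_zero, pow_one, ← Finset.sum_mul]
  rw [Finset.sum_eq_single (p - 1)]
  · rw [hsum _ (Finset.mem_Ioo.2 ⟨by omega, by omega⟩), if_pos rfl, hchoose, Nat.cast_one,
      show p - (p - 1) = 1 by omega]
    ring
  · intro i hi hne
    rw [hsum i hi, if_neg hne, zero_mul, zero_mul]
  · intro h
    exact absurd (Finset.mem_Ioo.2 ⟨by omega, by omega⟩) h

/-- The top coefficient of the polynomial `A ((a + C) ^ (r + 1) - a ^ (r + 1))`, whose degree is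
`r`. -/
theorem evY_of_genFun_eq_sub_pow {r : Fin 1 → ℕ} (hq : Nat.card (ResidueField R) = p ^ 1)
    (hr : ∀ j, r j < p) (v : Weight E r) (A C : E)
    (h : ∀ a : ResidueField R, genFun (R := R) E p r w v a =
      A * ((algebraMap (ResidueField R) E a + C) ^ (r 0 + 1) -
        algebraMap (ResidueField R) E a ^ (r 0 + 1))) :
    evY E r v = (-1) ^ (∑ j, r j) * (A * ((r 0 + 1 : ℕ) * C)) := by
  have h1 : genFun (R := R) E p r w v = A • fun a : ResidueField R =>
      (1 * algebraMap (ResidueField R) E a ^ p ^ ((0 : Fin 1) : ℕ) + C) ^ (r 0 + 1) -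
        (1 * algebraMap (ResidueField R) E a ^ p ^ ((0 : Fin 1) : ℕ)) ^ (r 0 + 1) := by
    funext a
    rw [h]
    simp
  rw [evY_eq_coef E p w hq hr, h1, map_smul, (sub_pow_mem_polySpace hq hr 0 1 C).2, if_pos]
  · simp
  · funext j
    rw [Subsingleton.elim j 0, Pi.single_eq_same]

theorem natCast_succ_ne_zero {n : ℕ} (h : n + 1 < p) : ((n + 1 : ℕ) : E) ≠ 0 := by
  rw [Ne, CharP.cast_eq_zero_iff E p]
  exact fun h' => absurd (Nat.le_of_dvd n.succ_pos h') (by omega)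

/-- For `F` unramified with `f = 1`, no `s`-component occurs on level `M + 2`: the element
`(1, ϖ ^ M; 0, 1)` acts on it with carries, and the resulting terms would show up on level `M`. -/
theorem coeff_sSec_eq_zero_of_unramified [CharP (ResidueField R) p] {r : Fin 1 → ℕ}
    (hq : Nat.card (ResidueField R) = p ^ 1) (hr : ∀ j, 0 < r j ∧ r j + 1 < p) {ε : R}
    (hε : (p : R) = ϖ * ε) (hε0 : residue R ε ≠ 0) {φ : ind F ϖ E p r w}
    (hφ : φ ∈ invMod F ϖ E p r w) {M : ℕ} (hM : VanishesBeyond (M + 2) φ) {A : E}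
    (h : ∀ μ, hat F ϖ E p r w φ (M + 2) μ = A • sSec ϖ E r (M + 1) 0 p μ) : A = 0 := by
  have hr' : ∀ j, r j < p := fun j => by have := (hr j).2; omega
  obtain ⟨ψ, h1, h2, -⟩ := exists_hecke_eq_of_mem_invMod hφ (ϖ ^ M * teich 1)
  have hψ : VanishesBeyond (M + 1) ψ := fun n hn => hat_eq_zero_of_hecke hq hr' (h2 _ hM) hn
  set ν := low ϖ M 0
  have hdig : ∀ y, digit ϖ (M + 1) (ν + ϖ ^ M * y) = digit ϖ 1 y := fun y => by
    rw [add_comm M, ← digit_tail, tail_add_mul, tail_low, zero_add]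
  have h3 : ∀ κ : ResidueField R, evY E r (hat F ϖ E p r w ψ (M + 1) (ν + ϖ ^ M * teich κ)) =
      (-1) ^ (∑ j, r j) * (A * ((r 0 + 1 : ℕ) * algebraMap (ResidueField R) E (carry ϖ κ 1))) := by
    intro κ
    refine evY_of_genFun_eq_sub_pow (w := w) hq hr' _ _ _ fun a => ?_
    rw [← evX_add_mul (hat_mem_sections ψ (M + 1))]
    have e := congrArg (evX E r) (h1 (M + 2) (ν + ϖ ^ M * teich κ + ϖ ^ (M + 1) * teich a))
    rw [hat_hecke_of_vanishesBeyond hψ, outward, map_smul, evX_xTop, smul_eq_mul, mul_one, h, h,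
      map_sub, map_smul, map_smul, sSec, sSec, map_smul, map_smul, evX_xTop] at e
    rw [← e]
    have e1 : ν + ϖ ^ M * teich κ + ϖ ^ (M + 1) * teich a + ϖ ^ M * teich 1 =
        ν + ϖ ^ M * (teich κ + teich 1 + ϖ * teich a) := by ring
    have e2 : ν + ϖ ^ M * teich κ + ϖ ^ (M + 1) * teich a =
        ν + ϖ ^ M * (teich κ + ϖ * teich a) := by ring
    rw [e1, e2, hdig, hdig, digit_one_add_mul, digit_one_add_mul, digit_one_teich, residue_teich,
      zero_add, map_add, add_comm (algebraMap _ E (digit ϖ 1 _))]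
    simp [mul_sub, carry]
  have h4 := congrArg (evY E r) (h1 M ν)
  rw [evY_hat_hecke (fun j => (hr j).1) one_pos, map_sub, evY_add_mul (hat_mem_sections φ M),
    sub_self] at h4
  simp only [h3] at h4
  rw [← Finset.mul_sum, ← Finset.mul_sum, ← Finset.mul_sum, ← map_sum, sum_carry hq hε,
    mul_one] at h4
  have h5 := (mul_eq_zero.1 h4.symm).resolve_left (pow_ne_zero _ (neg_ne_zero.2 one_ne_zero))
  refine (mul_eq_zero.1 h5).resolve_right (mul_ne_zero (natCast_succ_ne_zero (p := p) (hr 0).2) ?_)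
  rwa [Ne, map_eq_zero]

/-- For `f = 1`, no `s`-component occurs on level one, as soon as the support is contained in the
levels up to one on both sides of the edge. -/
theorem coeff_sSec_zero_eq_zero {r : Fin 1 → ℕ}
    (hq : Nat.card (ResidueField R) = p ^ 1) (hr : ∀ j, 0 < r j ∧ r j + 1 < p)
    {φ : ind F ϖ E p r w} (hφ : φ ∈ invMod F ϖ E p r w) (h1 : VanishesBeyond 1 φ)
    (h2 : VanishesBeyond 1 (flip F ϖ E p r w φ)) {A B : E}
    (h : ∀ μ, hat F ϖ E p r w φ 1 μ = A • sSec ϖ E r 0 0 p μ + B • tSec ϖ E r 1 0 p μ)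
    (hB : ∀ a b : ResidueField R, B * algebraMap (ResidueField R) E (carry ϖ a b) = 0) : A = 0 := by
  have hr' : ∀ j, r j < p := fun j => by have := (hr j).2; omega
  obtain ⟨ψ, h3, h4, k, hk, hk0, h5⟩ := exists_hecke_eq_of_mem_invMod hφ (teich 1)
  have hψ : VanishesBeyond 0 ψ := fun n hn => hat_eq_zero_of_hecke hq hr' (h4 _ h1) hn
  have h6 : VanishesBeyond 1 (hecke F ϖ E p r w (flip F ϖ E p r w ψ)) := by
    rw [h5]
    exact (h2.indRep k).sub h2
  have h7 : evY E r (hat F ϖ E p r w ψ 0 0) = 0 := by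
    have e := congrArg (fun x => evX E r (hat F ϖ E p r w x 0 0)) h5
    simp only [map_sub, Pi.sub_apply] at e
    rw [hat_zero_of_lower hk hk0, sub_self, hat_hecke_zero, flip_flip,
      hat_eq_zero_of_hecke hq hr' h6 le_rfl, inward_zero, zero_add, map_smul, evX_xTop, smul_eq_mul,
      mul_one] at e
    exact (mul_eq_zero.1 e).resolve_left (pow_ne_zero _ (neg_ne_zero.2 one_ne_zero))
  rw [evY_of_genFun_eq_sub_pow hq hr' (w := w) _ A (algebraMap (ResidueField R) E 1)] at h7
  · have h8 := (mul_eq_zero.1 h7).resolve_left (pow_ne_zero _ (neg_ne_zero.2 one_ne_zero))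
    refine (mul_eq_zero.1 h8).resolve_right
      (mul_ne_zero (natCast_succ_ne_zero (p := p) (hr 0).2) ?_)
    rw [map_one]
    exact one_ne_zero
  · intro a
    rw [← evX_add_mul (hat_mem_sections ψ 0)]
    have e := congrArg (evX E r) (h3 1 (teich a))
    rw [hat_hecke_of_vanishesBeyond hψ, outward, map_smul, evX_xTop, smul_eq_mul, mul_one, h, h]
      at e
    rw [zero_add, pow_zero, one_mul, ← e]
    have hxy : ∀ y, evX E r (B • tSec ϖ E r 1 0 p y) = B * evX E r (xyTop E r 0) -
        B * algebraMap (ResidueField R) E (digit ϖ 1 y) := fun y => by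
      rw [tSec, map_smul, map_sub, map_smul, evX_xTop]
      simp [mul_sub]
    simp only [map_sub, map_add, hxy, digit_one_teich, map_zero, mul_zero]
    have e2 := hB a 1
    rw [carry] at e2
    rw [e2]
    simp only [sSec, map_smul, evX_xTop, smul_eq_mul, digit_zero, map_add, residue_teich]
    simp [mul_sub]

/-- A step of the reduction: subtracting an element of `W` lowers the distance of the support. -/
theorem exists_sub_vanishesBeyond [CharP (ResidueField R) p]
    (hq : Nat.card (ResidueField R) = p ^ f) (hr : ∀ j, 0 < r j ∧ r j + 1 < p) {ε : R}
    (hε : (p : R) = ϖ * ε) {W : Submodule E (ind F ϖ E p r w)}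
    (hT : LinearMap.range (hecke F ϖ E p r w) ≤ W)
    (ht : residue R ε ≠ 0 ∨ ∀ n k, tElt F ϖ E p r w (n + 1) k ∈ W)
    (hs : ∀ n, (∀ l : Fin f, sElt F ϖ E p r w (n + 1) (p ^ (l : ℕ) * (r l + 1)) ∈ W) ∨
      f = 1 ∧ (n = 0 ∨ residue R ε ≠ 0)) {φ : ind F ϖ E p r w} (hφ : φ ∈ invMod F ϖ E p r w)
    {N M : ℕ} (h1 : VanishesBeyond (N + 1) φ) (h2 : VanishesBeyond M (flip F ϖ E p r w φ))
    (hNM : N = 0 → M ≤ 1) : ∃ ω ∈ W, VanishesBeyond N (φ - ω) ∧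
      VanishesBeyond M (flip F ϖ E p r w (φ - ω)) := by
  have hr' : ∀ j, r j < p := fun j => by have := (hr j).2; omega
  have hr0 : ∀ j, 0 < r j := fun j => (hr j).1
  obtain ⟨ψ, hψ, A, B, hAB, hB0⟩ := exists_eq_outward_add hq hr hε N
    (hat_mem_sections φ (N + 1)) fun b => by
      obtain ⟨χ, hχ1, hχ2, -⟩ := exists_hecke_eq_of_mem_invMod hφ b
      refine ⟨_, hat_mem_sections χ N, fun μ => ?_⟩
      rw [hχ1, hat_hecke_of_vanishesBeyond]
      exact fun n hn => hat_eq_zero_of_hecke hq hr' (hχ2 _ h1) hn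
  set φ' := φ - hecke F ϖ E p r w (lift F ϖ E p r w N ψ) with hφ'
  have hφ'inv : φ' ∈ invMod F ϖ E p r w := sub_mem hφ (range_hecke_le_invMod ⟨_, rfl⟩)
  have hlift : VanishesBeyond N (lift F ϖ E p r w N ψ) := fun n hn => by
    rw [hat_lift hψ, if_neg (by omega)]
  have h1' : VanishesBeyond (N + 1) φ' := h1.sub hlift.hecke
  have h2' : VanishesBeyond M (flip F ϖ E p r w φ') := by
    rw [hφ', map_sub, flip_hecke]
    refine h2.sub fun n hn => ?_
    obtain ⟨n, rfl⟩ := Nat.exists_eq_succ_of_ne_zero (show n ≠ 0 by omega)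
    funext μ
    rw [hat_hecke_succ, hat_flip_lift, hat_flip_lift, inward_zero, outward_zero, zero_add]
  have htop : ∀ μ, hat F ϖ E p r w φ' (N + 1) μ = ∑ l, A l • sSec ϖ E r N l p μ +
        ∑ k, B k • tSec ϖ E r (N + 1) k p μ := by
    intro μ
    rw [hφ', map_sub, Pi.sub_apply, Pi.sub_apply, hat_hecke_of_vanishesBeyond hlift, hat_lift hψ,
      if_pos rfl, hAB]
    abel
  have hBW : ∑ k, B k • tElt F ϖ E p r w (N + 1) k ∈ W := by
    refine sum_mem fun k _ => ?_
    obtain h | h := ht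
    · rw [hB0 h, Pi.zero_apply, zero_smul]
      exact zero_mem _
    · exact W.smul_mem _ (h N k)
  have hAW : ∑ l : Fin f, A l • sElt F ϖ E p r w (N + 1) (p ^ (l : ℕ) * (r l + 1)) ∈ W := by
    refine sum_mem fun l _ => ?_
    obtain h | ⟨rfl, h⟩ := hs N
    · exact W.smul_mem _ (h l)
    · suffices A l = 0 by
        rw [this, zero_smul]
        exact zero_mem _
      rw [Subsingleton.elim l 0]
      simp only [Fin.sum_univ_one] at htop
      cases N with
      | zero =>
        refine coeff_sSec_zero_eq_zero hq hr hφ'inv h1' (fun n hn => h2' n ?_) htop fun a b => ?_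
        · have := hNM rfl
          omega
        · by_cases h0 : residue R ε = 0
          · rw [carry_eq_zero ϖ p 1 one_pos hq ε hε h0, map_zero, mul_zero]
          · rw [hB0 h0, Pi.zero_apply, zero_mul]
      | succ N =>
        have h0 := h.resolve_left N.succ_ne_zero
        refine coeff_sSec_eq_zero_of_unramified hq hr hε h0 hφ'inv h1' fun μ => ?_
        rw [htop, hB0 h0, Pi.zero_apply, zero_smul, add_zero]
  refine ⟨hecke F ϖ E p r w (lift F ϖ E p r w N ψ) +
    (∑ l : Fin f, A l • sElt F ϖ E p r w (N + 1) (p ^ (l : ℕ) * (r l + 1)) +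
      ∑ k, B k • tElt F ϖ E p r w (N + 1) k), add_mem (hT ⟨_, rfl⟩) (add_mem hAW hBW), ?_, ?_⟩
  · intro n hn
    rw [← sub_sub, ← hφ']
    simp only [sElt_eq, tElt_eq, map_sub, map_add, map_sum, map_smul]
    funext μ
    simp only [Pi.sub_apply, Pi.add_apply, Finset.sum_apply, Pi.smul_apply, hat_lift (sSec_mem N _),
      hat_lift (tSec_mem hq hr' hr0 (N + 1) _)]
    by_cases h : n = N + 1
    · subst h
      simp only [if_pos, htop, sub_self, Pi.zero_apply]
    · simp only [if_neg h, Pi.zero_apply, smul_zero, Finset.sum_const_zero, add_zero, sub_zero]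
      rw [h1' n (by omega), Pi.zero_apply]
  · intro n hn
    rw [← sub_sub, ← hφ']
    simp only [sElt_eq, tElt_eq, map_sub, map_add, map_sum, map_smul]
    simp only [Pi.sub_apply, Pi.add_apply, Finset.sum_apply, Pi.smul_apply, hat_flip_lift,
      smul_zero,
      Finset.sum_const_zero, add_zero, sub_zero]
    exact h2' n hn

theorem exists_eq_smul_one_add (hq : Nat.card (ResidueField R) = p ^ f) (hr : ∀ j, r j < p)
    {φ : ind F ϖ E p r w} (hφ : φ ∈ invMod F ϖ E p r w) (h1 : VanishesBeyond 0 φ)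
    (h2 : VanishesBeyond 0 (flip F ϖ E p r w φ)) :
    ∃ a a' : E, φ = a • tens F ϖ E p r w 1 (xTop E r) +
      a' • flip F ϖ E p r w (tens F ϖ E p r w 1 (xTop E r)) := by
  have key : ∀ φ : ind F ϖ E p r w, φ ∈ invMod F ϖ E p r w → VanishesBeyond 0 φ →
      VanishesBeyond 0 (flip F ϖ E p r w φ) → ∃ a : E, ∀ μ, hat F ϖ E p r w φ 0 μ =
        a • xTop E r := by
    intro φ hφ h1 h2
    obtain ⟨a, ha⟩ := exists_eq_smul_xTop E p w hq hr (hat F ϖ E p r w φ 0 0) fun c => by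
      obtain ⟨ψ, h3, h4, k, hk, hk0, h5⟩ := exists_hecke_eq_of_mem_invMod hφ (-c)
      have h6 : VanishesBeyond 0 (hecke F ϖ E p r w (flip F ϖ E p r w ψ)) := by
        rw [h5]
        exact (h2.indRep k).sub h2
      have h7 := h3 0 0
      rw [hat_hecke_zero, hat_eq_zero_of_hecke hq hr (h4 _ h1) (Nat.zero_le _),
        hat_eq_zero_of_hecke hq hr h6 le_rfl, inward_zero, Pi.zero_apply, map_zero, mul_zero,
        zero_smul, add_zero, sub_eq_zero] at h7
      have h8 := hat_add_mul φ 0 0 (-c)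
      rw [pow_zero, one_mul, neg_neg] at h8
      rw [← h8, h7]
    refine ⟨a, fun μ => ?_⟩
    have h8 := hat_add_mul φ 0 0 μ
    rw [pow_zero, one_mul, zero_add] at h8
    rw [h8, ha, map_smul, sigma_upper_xTop]
  obtain ⟨a, ha⟩ := key φ hφ h1 h2
  obtain ⟨a', ha'⟩ := key _ (flip_mem_invMod hφ) h2 (by rwa [flip_flip])
  have hx : (fun _ : R => xTop E r) ∈ sections ϖ E p r w 0 := fun μ c => by rw [sigma_upper_xTop]
  refine ⟨a, a', ?_⟩
  rw [← lift_zero]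
  apply ind_ext
  · funext n μ
    rw [map_add, map_smul, map_smul, Pi.add_apply, Pi.add_apply, Pi.smul_apply, Pi.smul_apply,
      Pi.smul_apply, Pi.smul_apply, hat_flip_lift, hat_lift hx, Pi.zero_apply, smul_zero, add_zero]
    split_ifs with h
    · rw [h, ha]
    · rw [h1 n (by omega), Pi.zero_apply, smul_zero]
  · funext n μ
    rw [map_add, map_smul, map_smul, flip_flip, map_add, map_smul, map_smul, Pi.add_apply,
      Pi.add_apply, Pi.smul_apply, Pi.smul_apply, Pi.smul_apply, Pi.smul_apply, hat_flip_lift,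
      hat_lift hx, Pi.zero_apply, smul_zero, zero_add]
    split_ifs with h
    · rw [h, ha']
    · rw [h2 n (by omega), Pi.zero_apply, smul_zero]

/-- All `I(1)`-invariants modulo `T` lie in any subspace `W` of the invariants that contains the
expected elements. -/
theorem mem_of_mem_invMod [CharP (ResidueField R) p]
    (hq : Nat.card (ResidueField R) = p ^ f) (hr : ∀ j, 0 < r j ∧ r j + 1 < p) {ε : R}
    (hε : (p : R) = ϖ * ε) {W : Submodule E (ind F ϖ E p r w)}
    (hT : LinearMap.range (hecke F ϖ E p r w) ≤ W) (hW : W ≤ invMod F ϖ E p r w)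
    (hflip : ∀ φ ∈ W, flip F ϖ E p r w φ ∈ W)
    (ht : residue R ε ≠ 0 ∨ ∀ n k, tElt F ϖ E p r w (n + 1) k ∈ W)
    (hs : ∀ n, (∀ l : Fin f, sElt F ϖ E p r w (n + 1) (p ^ (l : ℕ) * (r l + 1)) ∈ W) ∨
      f = 1 ∧ (n = 0 ∨ residue R ε ≠ 0))
    (h1 : tens F ϖ E p r w 1 (xTop E r) ∈ W) {φ : ind F ϖ E p r w}
    (hφ : φ ∈ invMod F ϖ E p r w) : φ ∈ W := by
  have step := fun (φ : ind F ϖ E p r w) hφ N M h1 h2 hNM =>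
    exists_sub_vanishesBeyond (φ := φ) (N := N) (M := M) hq hr hε hT ht hs hφ h1 h2 hNM
  have hW' : ∀ {φ ω : ind F ϖ E p r w}, φ ∈ invMod F ϖ E p r w → ω ∈ W →
      φ - ω ∈ invMod F ϖ E p r w := fun hφ hω => sub_mem hφ (hW hω)
  have hback : ∀ {φ ω : ind F ϖ E p r w}, ω ∈ W → φ - ω ∈ W → φ ∈ W := fun hω h => by
    have := add_mem h hω
    rwa [sub_add_cancel] at this
  have hfb : ∀ {φ : ind F ϖ E p r w}, flip F ϖ E p r w φ ∈ W → φ ∈ W := fun h => by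
    have := hflip _ h
    rwa [flip_flip] at this
  have base : ∀ φ ∈ invMod F ϖ E p r w, VanishesBeyond 0 φ →
      VanishesBeyond 0 (flip F ϖ E p r w φ) → φ ∈ W := by
    intro φ hφ h2 h3
    obtain ⟨a, a', rfl⟩ := exists_eq_smul_one_add hq (fun j => by have := (hr j).2; omega) hφ h2 h3
    exact add_mem (W.smul_mem _ h1) (W.smul_mem _ (hflip _ h1))
  have c01 : ∀ φ ∈ invMod F ϖ E p r w, VanishesBeyond 1 φ →
      VanishesBeyond 0 (flip F ϖ E p r w φ) → φ ∈ W := by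
    intro φ hφ h2 h3
    obtain ⟨ω, hω, h4, h5⟩ := step φ hφ 0 0 h2 h3 (fun _ => zero_le_one)
    exact hback hω (base _ (hW' hφ hω) h4 h5)
  have c11 : ∀ φ ∈ invMod F ϖ E p r w, VanishesBeyond 1 φ →
      VanishesBeyond 1 (flip F ϖ E p r w φ) → φ ∈ W := by
    intro φ hφ h2 h3
    obtain ⟨ω, hω, h4, h5⟩ := step φ hφ 0 1 h2 h3 (fun _ => le_rfl)
    refine hback hω (hfb (c01 _ (flip_mem_invMod (hW' hφ hω)) h5 ?_))
    rwa [flip_flip]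
  have cN1 : ∀ N, ∀ φ ∈ invMod F ϖ E p r w, VanishesBeyond (N + 1) φ →
      VanishesBeyond 1 (flip F ϖ E p r w φ) → φ ∈ W := by
    intro N
    induction N with
    | zero => exact c11
    | succ N ih =>
      intro φ hφ h2 h3
      obtain ⟨ω, hω, h4, h5⟩ := step φ hφ (N + 1) 1 h2 h3 (fun _ => le_rfl)
      exact hback hω (ih _ (hW' hφ hω) h4 h5)
  have cNM : ∀ M N, ∀ φ ∈ invMod F ϖ E p r w, VanishesBeyond (N + 1) φ →
      VanishesBeyond (M + 1) (flip F ϖ E p r w φ) → φ ∈ W := by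
    intro M N
    induction N with
    | zero =>
      intro φ hφ h2 h3
      exact hfb (cN1 M _ (flip_mem_invMod hφ) h3 (by rwa [flip_flip]))
    | succ N ih =>
      intro φ hφ h2 h3
      obtain ⟨ω, hω, h4, h5⟩ := step φ hφ (N + 1) (M + 1) h2 h3
        (fun h => absurd h N.succ_ne_zero)
      exact hback hω (ih _ (hW' hφ hω) h4 h5)
  obtain ⟨N, hN⟩ := exists_hat_eq_zero φ
  obtain ⟨M, hM⟩ := exists_hat_eq_zero (flip F ϖ E p r w φ)
  exact cNM M N φ hφ (fun n hn => hN n (by omega)) (fun n hn => hM n (by omega))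

end Spanning

/-! ### Linear independence -/

section Independence

variable {R : Type*} [CommRing R] [IsDomain R] [IsDiscreteValuationRing R]
  [HenselianLocalRing R] [Finite (ResidueField R)]
  {F : Type*} [Field F] [Algebra R F] [IsFractionRing R F] {ϖ : R} [hϖ : Fact (Irreducible ϖ)]
  {E : Type*} [Field E] [Algebra (ResidueField R) E] {p : ℕ} [hp : Fact p.Prime] [CharP E p]
  {f : ℕ} {r : Fin f → ℕ} {w : ℕ}

/-- The outward image of a section is linearly independent of the sections
`s_{N+1}^{p^l (r_l + 1)}` and `t_{N+1}^k`. -/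
theorem eq_zero_of_outward_eq (hq : Nat.card (ResidueField R) = p ^ f)
    (hr : ∀ j, 0 < r j ∧ r j + 1 < p) {N : ℕ} {ψ : R → Weight E r} (hψ : ψ ∈ sections ϖ E p r w N)
    {A B : Fin f → E} (h : ∀ μ, outward ψ μ = ∑ l, A l • sSec ϖ E r N l p μ +
      ∑ k, B k • tSec ϖ E r (N + 1) k p μ) : ψ = 0 ∧ A = 0 ∧ B = 0 := by
  have hr' : ∀ j, r j < p := fun j => by have := (hr j).2; omega
  have hr0 : ∀ j, 0 < r j := fun j => (hr j).1
  have hB : B = 0 := by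
    refine (eq_zero_of_smul_xTop_add (R := R) hq hr0 (a := (∑ l, A l * (algebraMap
      (ResidueField R) E (digit ϖ N 0) ^ p ^ (l : ℕ)) ^ (r l + 1)) - (∑ k, B k * algebraMap
      (ResidueField R) E (digit ϖ (N + 1) 0) ^ p ^ (k : ℕ)) - evX E r (ψ 0)) ?_).2
    have h' := h 0
    rw [outward] at h'
    rw [sub_smul, h']
    simp only [sSec, tSec, smul_sub, Finset.sum_sub_distrib, sub_smul, Finset.sum_smul, smul_smul]
    abel
  subst hB
  have h1 : ∀ ν, genFun (R := R) E p r w (ψ (low ϖ N ν)) = ∑ l, A l • fun a : ResidueField R =>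
      (algebraMap (ResidueField R) E a ^ p ^ (l : ℕ)) ^ (r l + 1) := by
    intro ν
    funext a
    have h2 := congrArg (evX E r) (h (low ϖ N ν + ϖ ^ N * teich a))
    rw [outward, map_smul, evX_xTop, smul_eq_mul, mul_one, evX_add_mul hψ] at h2
    rw [h2, map_add, map_sum, map_sum, Finset.sum_apply]
    simp only [Pi.zero_apply, zero_smul, map_zero, Finset.sum_const_zero, add_zero, sSec, map_smul,
      evX_xTop, digit_add_mul, digit_low, zero_add, residue_teich, Pi.smul_apply, smul_eq_mul,
      mul_one]
  have hA : A = 0 := by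
    funext l
    have h2 := genFun_mem (R := R) E p w hq hr' (ψ (low ϖ N 0)) (singleIdx l (r l + 1) (hr l).2)
      ⟨l, by simp [singleIdx]⟩
    rw [h1, map_sum, Finset.sum_eq_single l] at h2
    · rwa [map_smul, coef_pow E p hq _ (hr l).2, if_pos (singleIdx_coe _ _ _), smul_eq_mul,
        mul_one] at h2
    · intro m _ hm
      rw [map_smul, coef_pow E p hq _ (hr m).2, if_neg, smul_zero]
      exact fun h' => hm ((single_eq_single_iff (Nat.succ_ne_zero _)).1 h').1.symm
    · simp
  refine ⟨funext fun μ => ?_, hA, rfl⟩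
  apply genFun_injective (R := R) E p w hq hr'
  have h2 := hψ (low ϖ N μ) (tail ϖ N μ)
  rw [low_add_tail] at h2
  funext a
  rw [h2, genFun_sigma_upper, h1, hA]
  simp

theorem eq_zero_of_hat_hecke_eq (hq : Nat.card (ResidueField R) = p ^ f)
    (hr : ∀ j, 0 < r j ∧ r j + 1 < p) {ψ : ind F ϖ E p r w} {A B : ℕ → Fin f → E}
    (h : ∀ n μ, hat F ϖ E p r w (hecke F ϖ E p r w ψ) (n + 1) μ =
      ∑ l, A n l • sSec ϖ E r n l p μ + ∑ k, B n k • tSec ϖ E r (n + 1) k p μ) (n : ℕ) :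
    hat F ϖ E p r w ψ n = 0 ∧ A n = 0 ∧ B n = 0 := by
  obtain ⟨M, hM⟩ := exists_hat_eq_zero ψ
  have step : ∀ n, hat F ϖ E p r w ψ (n + 2) = 0 →
      hat F ϖ E p r w ψ n = 0 ∧ A n = 0 ∧ B n = 0 := fun n hn =>
    eq_zero_of_outward_eq hq hr (hat_mem_sections ψ n) fun μ => by
      rw [← h, hat_hecke_succ, hn, inward_zero, zero_add]
  have h0 : ∀ d n, M < n + d → hat F ϖ E p r w ψ n = 0 := by
    intro d
    induction d with
    | zero => exact fun n hn => hM n hn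
    | succ d ih => exact fun n hn => (step n (ih (n + 2) (by omega))).1
  exact step n (h0 (M + 1) _ (by omega))

theorem sigmaKZ_mul_inclK (x : GL (Fin 2) F) (k : GL (Fin 2) R) (v : Weight E r) :
    sigmaKZ F ϖ E p r w (x * inclK R F k) v = sigmaKZ F ϖ E p r w x (sigma E p r w k v) := by
  by_cases h : ∃ (l : GL (Fin 2) R) (m : ℤ), x = kz F ϖ l m
  · obtain ⟨l, m, rfl⟩ := h
    rw [← kz_zero F ϖ, kz_mul, sigmaKZ_kz, sigmaKZ_kz, map_mul, Module.End.mul_apply]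
  · rw [sigmaKZ_eq_zero fun l m h' => h ⟨l, m, h'⟩, sigmaKZ_eq_zero, LinearMap.zero_apply,
      LinearMap.zero_apply]
    intro l m h'
    refine h ⟨l * k⁻¹, m, ?_⟩
    rw [eq_mul_inv_of_mul_eq h', ← map_inv, ← kz_zero F ϖ, kz_mul, add_zero]

theorem tens_alpha_yTop : tens F ϖ E p r w (alpha F ϖ) (yTop E r) =
    (-1 : E) ^ w • flip F ϖ E p r w (tens F ϖ E p r w 1 (xTop E r)) := by
  refine Subtype.ext (funext fun x => ?_)
  change sigmaKZ F ϖ E p r w (x * alpha F ϖ) (yTop E r) =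
    (-1 : E) ^ w • sigmaKZ F ϖ E p r w (x * beta F ϖ * 1) (xTop E r)
  rw [← beta_mul_weyl (R := R), ← mul_assoc, sigmaKZ_mul_inclK, sigma_weyl_yTop, map_smul, mul_one]

theorem sElt_zero {k : ℕ} (hk : k ≠ 0) : sElt F ϖ E p r w 0 k = 0 := by
  refine Finset.sum_eq_zero fun d _ => ?_
  rw [lastDigit, dif_neg (lt_irrefl 0), map_zero, zero_pow hk, zero_smul, ← zero_smul E
    (0 : Weight E r),
    tens_smul, zero_smul]

/-- The values at level `n + 1` of a combination of the elements `basisElt`. -/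
theorem hat_linearCombination (hq : Nat.card (ResidueField R) = p ^ f)
    (hr : ∀ j, 0 < r j ∧ r j < p) (c : Label f →₀ E) (n : ℕ) (μ : R) :
    hat F ϖ E p r w (Finsupp.linearCombination E (basisElt F ϖ E p r w) c) (n + 1) μ =
      ∑ l, c (.s (n + 1) l) • sSec ϖ E r n l p μ +
        ∑ k, c (.t (n + 1) k) • tSec ϖ E r (n + 1) k p μ := by
  have hr' : ∀ j, r j < p := fun j => (hr j).2
  have hr0 : ∀ j, 0 < r j := fun j => (hr j).1
  classical
  induction c using Finsupp.induction_linear with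
  | zero => simp
  | add c c' h h' =>
    rw [map_add, map_add, Pi.add_apply, Pi.add_apply, h, h']
    simp only [Finsupp.add_apply, add_smul, Finset.sum_add_distrib]
    abel
  | single i a =>
    have hx : (fun _ : R => xTop E r) ∈ sections ϖ E p r w 0 := fun μ c => by rw [sigma_upper_xTop]
    have hp0 : ∀ l : Fin f, p ^ (l : ℕ) * (r l + 1) ≠ 0 := fun l =>
      mul_ne_zero (pow_ne_zero _ hp.out.ne_zero) (Nat.succ_ne_zero _)
    have hβ : ∀ φ, indRep F ϖ E p r w (beta F ϖ) φ = flip F ϖ E p r w φ := fun φ => rfl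
    rw [Finsupp.linearCombination_single]
    cases i with
    | s m l =>
      cases m with
      | zero => simp [basisElt, sElt_zero (hp0 l)]
      | succ m =>
        by_cases h : n = m
        · simp [basisElt, sElt_eq, hat_lift (sSec_mem m l), h, Finsupp.single_apply, ite_smul]
        · simp [basisElt, sElt_eq, hat_lift (sSec_mem m l), h]
    | bs m l =>
      cases m with
      | zero => simp [basisElt, sElt_zero (hp0 l)]
      | succ m => simp [basisElt, hβ, sElt_eq, hat_flip_lift]
    | t m k =>
      by_cases h : n + 1 = m
      · subst h
        simp [basisElt, tElt_eq, hat_lift (tSec_mem hq hr' hr0 _ k), Finsupp.single_apply, ite_smul]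
      · simp [basisElt, tElt_eq, hat_lift (tSec_mem hq hr' hr0 m k), h]
    | bt m k => simp [basisElt, hβ, tElt_eq, hat_flip_lift]
    | one => simp [basisElt, ← lift_zero, hat_lift hx]
    | alpha =>
      simp [basisElt, tens_alpha_yTop, ← lift_zero, hat_flip_lift]

theorem evX_hat_linearCombination (hq : Nat.card (ResidueField R) = p ^ f)
    (hr : ∀ j, 0 < r j ∧ r j < p) (c : Label f →₀ E) :
    evX E r (hat F ϖ E p r w (Finsupp.linearCombination E (basisElt F ϖ E p r w) c) 0 0) =
      c .one := by
  have hr' : ∀ j, r j < p := fun j => (hr j).2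
  have hr0 : ∀ j, 0 < r j := fun j => (hr j).1
  classical
  induction c using Finsupp.induction_linear with
  | zero => simp
  | add c c' h h' => rw [map_add, map_add, Pi.add_apply, Pi.add_apply, map_add, h, h']; rfl
  | single i a =>
    have hx : (fun _ : R => xTop E r) ∈ sections ϖ E p r w 0 := fun μ c => by rw [sigma_upper_xTop]
    have hp0 : ∀ l : Fin f, p ^ (l : ℕ) * (r l + 1) ≠ 0 := fun l =>
      mul_ne_zero (pow_ne_zero _ hp.out.ne_zero) (Nat.succ_ne_zero _)
    have hβ : ∀ φ, indRep F ϖ E p r w (beta F ϖ) φ = flip F ϖ E p r w φ := fun φ => rfl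
    rw [Finsupp.linearCombination_single]
    cases i with
    | s m l =>
      cases m with
      | zero => simp [basisElt, sElt_zero (hp0 l)]
      | succ m => simp [basisElt, sElt_eq, hat_lift (sSec_mem m l)]
    | bs m l =>
      cases m with
      | zero => simp [basisElt, sElt_zero (hp0 l)]
      | succ m => simp [basisElt, hβ, sElt_eq, hat_flip_lift]
    | t m k =>
      by_cases h : m = 0
      · subst h
        simp [basisElt, tElt_eq, hat_lift (tSec_mem hq hr' hr0 _ k), tSec,
          evX_xyTop hr0, digit_zero, zero_pow (pow_ne_zero _ hp.out.ne_zero)]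
      · simp [basisElt, tElt_eq, hat_lift (tSec_mem hq hr' hr0 m k), Ne.symm h]
    | bt m k => simp [basisElt, hβ, tElt_eq, hat_flip_lift]
    | one => simp [basisElt, ← lift_zero, hat_lift hx, evX_xTop]
    | alpha =>
      simp [basisElt, tens_alpha_yTop, ← lift_zero, hat_flip_lift]

/-- The involution of the labels that corresponds to `β`. -/
def Label.swap : Label f → Label f
  | .s n l => .bs n l
  | .bs n l => .s n l
  | .t n k => .bt n k
  | .bt n k => .t n k
  | .one => .alpha
  | .alpha => .one

theorem Label.swap_injective : Function.Injective (Label.swap : Label f → Label f) :=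
  Function.LeftInverse.injective (g := Label.swap) fun i => by cases i <;> rfl

/-- The scalar `1` or `(-1)^w` by which `flip (basisElt i)` and `basisElt i.swap` differ. -/
theorem exists_flip_basisElt (i : Label f) : ∃ u : E, u ≠ 0 ∧
    flip F ϖ E p r w (basisElt F ϖ E p r w i) = u • basisElt F ϖ E p r w i.swap := by
  have hu : ((-1 : E) ^ w) ≠ 0 := pow_ne_zero _ (neg_ne_zero.2 one_ne_zero)
  have hu2 : ((-1 : E) ^ w) * (-1) ^ w = 1 := by rw [← mul_pow]; simp
  cases i with
  | one => exact ⟨_, hu, by rw [Label.swap, basisElt, basisElt, tens_alpha_yTop, smul_smul, hu2,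
    one_smul]⟩
  | alpha => exact ⟨_, hu, by rw [Label.swap, basisElt, basisElt, tens_alpha_yTop, map_smul,
    flip_flip]⟩
  | s n l => exact ⟨1, one_ne_zero, by rw [one_smul]; rfl⟩
  | t n l => exact ⟨1, one_ne_zero, by rw [one_smul]; rfl⟩
  | bs n l => exact ⟨1, one_ne_zero, by rw [one_smul]; exact flip_flip _⟩
  | bt n l => exact ⟨1, one_ne_zero, by rw [one_smul]; exact flip_flip _⟩

/-- Independence modulo `T`: a relation is a preimage under `T`, to which the comparison of positive
levels applies on both halves of the tree; level zero then leaves the two labels `one` and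
`alpha`. -/
theorem linearIndepOn_basisElt (hq : Nat.card (ResidueField R) = p ^ f)
    (hr : ∀ j, 0 < r j ∧ r j + 1 < p) :
    LinearIndepOn E (fun i =>
      (Submodule.Quotient.mk (basisElt F ϖ E p r w i) : indModT F ϖ E p r w))
      (labelsS f 1 ∪ {Label.one, Label.alpha} ∪ labelsT f 1) := by
  have hr1 : ∀ j, 0 < r j ∧ r j < p := fun j => ⟨(hr j).1, by have := (hr j).2; omega⟩
  -- the coefficients of the labels on one side of the edge vanish
  have key : ∀ (c : Label f →₀ E) (ψ : ind F ϖ E p r w),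
      Finsupp.linearCombination E (basisElt F ϖ E p r w) c = hecke F ϖ E p r w ψ →
      (∀ n, hat F ϖ E p r w ψ n = 0) ∧ ∀ n l, c (.s (n + 1) l) = 0 ∧ c (.t (n + 1) l) = 0 := by
    intro c ψ h
    have h1 := eq_zero_of_hat_hecke_eq hq hr (ψ := ψ) (A := fun n l => c (.s (n + 1) l))
      (B := fun n k => c (.t (n + 1) k)) fun n μ => by rw [← h, hat_linearCombination hq hr1]
    exact ⟨fun n => (h1 n).1, fun n l => ⟨congrFun (h1 n).2.1 l, congrFun (h1 n).2.2 l⟩⟩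
  choose u hu0 hu using exists_flip_basisElt (F := F) (ϖ := ϖ) (E := E) (p := p) (r := r) (w := w)
  have hswap : ∀ (c : Label f →₀ E) (i : Label f), Finsupp.linearCombination E
      (fun i : Label f => Finsupp.single i.swap (u i)) c i.swap = u i * c i := by
    intro c i
    classical
    induction c using Finsupp.induction_linear with
    | zero => simp
    | add c₁ c₂ h₁ h₂ => rw [map_add, Finsupp.add_apply, h₁, h₂, Finsupp.add_apply, mul_add]
    | single j a =>
      rw [Finsupp.linearCombination_single, Finsupp.smul_apply, Finsupp.single_apply,
        Finsupp.single_apply, Label.swap_injective.eq_iff]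
      split_ifs with h
      · rw [h, smul_eq_mul, mul_comm]
      · simp
  have hflip : ∀ c : Label f →₀ E, Finsupp.linearCombination E (basisElt F ϖ E p r w)
      (Finsupp.linearCombination E (fun i : Label f => Finsupp.single i.swap (u i)) c) =
      flip F ϖ E p r w (Finsupp.linearCombination E (basisElt F ϖ E p r w) c) := by
    intro c
    induction c using Finsupp.induction_linear with
    | zero => simp
    | add c₁ c₂ h₁ h₂ => simp only [map_add, h₁, h₂]
    | single j a =>
      rw [Finsupp.linearCombination_single, map_smul, Finsupp.linearCombination_single,
        Finsupp.linearCombination_single, map_smul, hu]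
  rw [linearIndepOn_iff]
  intro c hc h
  have h1 : Submodule.Quotient.mk (Finsupp.linearCombination E (basisElt F ϖ E p r w) c) =
      (0 : indModT F ϖ E p r w) := by
    rw [← h]
    exact (Submodule.mkQ _).map_finsupp_linearCombination _
  rw [Submodule.Quotient.mk_eq_zero] at h1
  obtain ⟨ψ, hψ⟩ := h1
  set c' : Label f →₀ E := Finsupp.linearCombination E
    (fun i : Label f => Finsupp.single i.swap (u i)) c
  have hc' : ∀ i, c' i.swap = u i * c i := fun i => by
    exact hswap c i
  have hψ' : Finsupp.linearCombination E (basisElt F ϖ E p r w) c' =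
      hecke F ϖ E p r w (flip F ϖ E p r w ψ) := by
    rw [← flip_hecke, hψ, hflip]
  obtain ⟨k1, k2⟩ := key c ψ hψ.symm
  obtain ⟨k3, k4⟩ := key c' _ hψ'
  have hone : c .one = 0 := by
    rw [← evX_hat_linearCombination (F := F) (ϖ := ϖ) (w := w) hq hr1, ← hψ, hat_hecke_zero, k1, k3,
      inward_zero, Pi.zero_apply, map_zero, mul_zero, zero_smul, add_zero, map_zero]
  have halpha : c' .one = 0 := by
    rw [← evX_hat_linearCombination (F := F) (ϖ := ϖ) (w := w) hq hr1, hψ', hat_hecke_zero,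
      flip_flip,
      k1, k3, inward_zero, Pi.zero_apply, map_zero, mul_zero, zero_smul, add_zero, map_zero]
  have hback : ∀ i, c' i.swap = 0 → c i = 0 := fun i hi => by
    rw [hc'] at hi
    exact (mul_eq_zero.1 hi).resolve_left (hu0 i)
  ext i
  by_contra hi
  obtain (⟨n, hn, l, rfl | rfl⟩ | rfl | rfl) | ⟨n, hn, l, rfl | rfl⟩ :=
    (Finsupp.mem_supported _ _).1 hc (Finsupp.mem_support_iff.2 hi)
  · obtain ⟨n, rfl⟩ := Nat.exists_eq_succ_of_ne_zero (show n ≠ 0 by omega)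
    exact hi (k2 n l).1
  · obtain ⟨n, rfl⟩ := Nat.exists_eq_succ_of_ne_zero (show n ≠ 0 by omega)
    exact hi (hback _ (k4 n l).1)
  · exact hi hone
  · exact hi (hback _ halpha)
  · obtain ⟨n, rfl⟩ := Nat.exists_eq_succ_of_ne_zero (show n ≠ 0 by omega)
    exact hi (k2 n l).2
  · obtain ⟨n, rfl⟩ := Nat.exists_eq_succ_of_ne_zero (show n ≠ 0 by omega)
    exact hi (hback _ (k4 n l).2)

end Independence

/-! ### The eigenbasis -/

/-- A vector that is an eigenvector of every element of a group is acted on through a character. -/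
theorem exists_character {E G V : Type*} [Field E] [Group G] [AddCommGroup V] [Module E V]
    (ρ : Representation E G V) (v : V) (h : ∀ g, ∃ c : E, ρ g v = c • v) :
    ∃ χ : G →* Eˣ, ∀ g, ρ g v = (χ g : E) • v := by
  by_cases hv : v = 0
  · exact ⟨1, fun g => by simp [hv]⟩
  choose c hc using h
  refine ⟨MonoidHom.toHomUnits
    { toFun := c
      map_one' := smul_left_injective E hv ?_
      map_mul' := fun g g' => smul_left_injective E hv ?_ }, fun g => hc g⟩
  · simp only [← hc, map_one, Module.End.one_apply, one_smul]
  · simp only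
    rw [← hc, map_mul, Module.End.mul_apply, hc g', map_smul, hc g, smul_smul, mul_comm]

section Labels

variable {f : ℕ}

/-- The labels `one`, `alpha`, all `s n l`, `bs n l` with `S n`, and all `t n k`, `bt n k` with
`T n`. -/
def levelSet (S T : ℕ → Prop) : Set (Label f) := {i | match i with
  | .s n _ => S n
  | .bs n _ => S n
  | .t n _ => T n
  | .bt n _ => T n
  | .one => True
  | .alpha => True}

theorem pair_eq_levelSet :
    ({Label.one, Label.alpha} : Set (Label f)) = levelSet (fun _ => False) fun _ => False := by
  ext i
  cases i <;> simp [levelSet]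

theorem labelsS_union_eq_levelSet (m : ℕ) :
    labelsS f m ∪ {Label.one, Label.alpha} = levelSet (fun n => m ≤ n) fun _ => False := by
  ext i
  cases i <;> simp [levelSet, labelsS]

theorem labelsS_union_labelsT_eq_levelSet (m m' : ℕ) :
    labelsS f m ∪ {Label.one, Label.alpha} ∪ labelsT f m' =
      levelSet (fun n => m ≤ n) fun n => m' ≤ n := by
  ext i
  cases i <;> simp [levelSet, labelsS, labelsT]

theorem levelSet_subset {S T S' T' : ℕ → Prop} (hS : ∀ n, S n → S' n) (hT : ∀ n, T n → T' n) :
    (levelSet S T : Set (Label f)) ⊆ levelSet S' T' := by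
  intro i hi
  cases i <;> simp_all [levelSet]

theorem swap_mem_levelSet {S T : ℕ → Prop} {i : Label f} (hi : i ∈ levelSet S T) :
    i.swap ∈ levelSet S T := by
  cases i <;> simp_all [levelSet, Label.swap]

end Labels

section Basis

variable {R : Type*} [CommRing R] [IsDomain R] [IsDiscreteValuationRing R]
  [HenselianLocalRing R] [Finite (ResidueField R)]
  {F : Type*} [Field F] [Algebra R F] [IsFractionRing R F] {ϖ : R} [hϖ : Fact (Irreducible ϖ)]
  {E : Type*} [Field E] [Algebra (ResidueField R) E] {p : ℕ} [hp : Fact p.Prime] [CharP E p]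
  {f : ℕ} {r : Fin f → ℕ} {w : ℕ}

theorem isEigen_basisElt {S T : ℕ → Prop} (hS : ∀ n, S n → 0 < n) (hT : ∀ n, T n → 0 < n)
    (hs : ∀ n (l : Fin f), S (n + 1) →
      IsEigen F ϖ E p r w (sElt F ϖ E p r w (n + 1) (p ^ (l : ℕ) * (r l + 1))))
    (ht : ∀ n k, T (n + 1) → IsEigen F ϖ E p r w (tElt F ϖ E p r w (n + 1) k))
    {i : Label f} (hi : i ∈ levelSet S T) : IsEigen F ϖ E p r w (basisElt F ϖ E p r w i) := by
  cases i with
  | s n l =>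
    obtain ⟨n, rfl⟩ := Nat.exists_eq_add_of_le' (hS n hi)
    exact hs n l hi
  | t n l =>
    obtain ⟨n, rfl⟩ := Nat.exists_eq_add_of_le' (hT n hi)
    exact ht n l hi
  | bs n l =>
    obtain ⟨n, rfl⟩ := Nat.exists_eq_add_of_le' (hS n hi)
    exact (hs n l hi).flip
  | bt n l =>
    obtain ⟨n, rfl⟩ := Nat.exists_eq_add_of_le' (hT n hi)
    exact (ht n l hi).flip
  | one => exact isEigen_one
  | alpha =>
    intro k
    obtain ⟨c, h1, h2⟩ := (isEigen_one (F := F) (ϖ := ϖ) (E := E) (p := p) (r := r) (w := w)).flip k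
    refine ⟨c, h1, ?_⟩
    have h3 := Submodule.smul_mem _ ((-1 : E) ^ w) h2
    rw [smul_sub] at h3
    rwa [basisElt, tens_alpha_yTop, map_smul, smul_comm c]

/-- A set of labels of eigenvectors that contains all the labels needed to generate the invariants
labels an eigenbasis. The conditions `hs'` and `ht'` say that the `s` and `t` left out do not occur
in any invariant. -/
theorem isIwahoriEigenbasis_levelSet [CharP (ResidueField R) p]
    (hq : Nat.card (ResidueField R) = p ^ f) (hr : ∀ j, 0 < r j ∧ r j + 1 < p) {ε : R}
    (hε : (p : R) = ϖ * ε) {S T : ℕ → Prop} (hS : ∀ n, S n → 0 < n) (hT : ∀ n, T n → 0 < n)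
    (hs : ∀ n (l : Fin f), S (n + 1) →
      IsEigen F ϖ E p r w (sElt F ϖ E p r w (n + 1) (p ^ (l : ℕ) * (r l + 1))))
    (ht : ∀ n k, T (n + 1) → IsEigen F ϖ E p r w (tElt F ϖ E p r w (n + 1) k))
    (hs' : ∀ n, S (n + 1) ∨ f = 1 ∧ (n = 0 ∨ residue R ε ≠ 0))
    (ht' : residue R ε ≠ 0 ∨ ∀ n, T (n + 1)) :
    IsIwahoriEigenbasis F ϖ E p r w (levelSet S T) := by
  set A : Set (Label f) := levelSet S T with hA
  have hE : ∀ i ∈ A, IsEigen F ϖ E p r w (basisElt F ϖ E p r w i) := fun i hi =>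
    isEigen_basisElt hS hT hs ht hi
  have hindep : LinearIndepOn E (fun i => (Submodule.Quotient.mk (basisElt F ϖ E p r w i) :
      indModT F ϖ E p r w)) A := by
    refine (linearIndepOn_basisElt hq hr).mono ?_
    rw [labelsS_union_labelsT_eq_levelSet]
    exact levelSet_subset hS hT
  refine ⟨fun i hi => ?_, hindep, le_antisymm ?_ ?_⟩
  · refine exists_character (((indModTRep F ϖ E p r w).comp (inclK R F)).comp (iwahori R).subtype) _
      fun k => ?_
    obtain ⟨c, -, hc⟩ := hE i hi k
    exact ⟨c, (Submodule.Quotient.eq _).2 hc⟩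
  · rw [Submodule.span_le]
    rintro _ ⟨i, hi, rfl⟩ k
    exact (Submodule.Quotient.eq _).2 ((hE i hi).mem_invMod ⟨k.1, k.2.1⟩ k.2)
  · intro x hx
    obtain ⟨φ, rfl⟩ := Submodule.Quotient.mk_surjective _ x
    set W := (Submodule.span E ((fun i => (Submodule.Quotient.mk (basisElt F ϖ E p r w i) :
      indModT F ϖ E p r w)) '' A)).comap (Submodule.mkQ _) with hW
    have hmem : ∀ i ∈ A, basisElt F ϖ E p r w i ∈ W := fun i hi =>
      Submodule.subset_span ⟨i, hi, rfl⟩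
    have hmk : ∀ ψ : ind F ϖ E p r w, ψ ∈ W ↔ (Submodule.Quotient.mk ψ : indModT F ϖ E p r w) ∈
      Submodule.span E ((fun i => (Submodule.Quotient.mk (basisElt F ϖ E p r w i) :
        indModT F ϖ E p r w)) '' A) := fun ψ => Iff.rfl
    refine mem_of_mem_invMod (W := W) hq hr hε ?_ ?_ ?_ ?_ ?_ (hmem .one trivial) (φ := φ) ?_
    · intro ψ hψ
      rw [hmk, (Submodule.Quotient.mk_eq_zero _).2 hψ]
      exact zero_mem _
    · -- `W` is generated by the labelled elements and the image of `T`
      intro ψ hψ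
      have h2 : Submodule.span E ((fun i => (Submodule.Quotient.mk (basisElt F ϖ E p r w i) :
          indModT F ϖ E p r w)) '' A) ≤ (invMod F ϖ E p r w).map (Submodule.mkQ _) := by
        rw [Submodule.span_le]
        rintro _ ⟨i, hi, rfl⟩
        exact ⟨_, (hE i hi).mem_invMod, rfl⟩
      obtain ⟨ψ', h3, h4⟩ := h2 hψ
      have h5 : ψ - ψ' ∈ LinearMap.range (hecke F ϖ E p r w) := (Submodule.Quotient.eq _).1 h4.symm
      rw [← sub_add_cancel ψ ψ']
      exact add_mem (range_hecke_le_invMod h5) h3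
    · intro ψ hψ
      have h2 : Submodule.span E ((fun i => (Submodule.Quotient.mk (basisElt F ϖ E p r w i) :
          indModT F ϖ E p r w)) '' A) ≤ (Submodule.span E ((fun i => (Submodule.Quotient.mk
            (basisElt F ϖ E p r w i) : indModT F ϖ E p r w)) '' A)).comap
              (indModTRep F ϖ E p r w (beta F ϖ)) := by
        rw [Submodule.span_le]
        rintro _ ⟨i, hi, rfl⟩
        obtain ⟨u, -, hu⟩ := exists_flip_basisElt (F := F) (ϖ := ϖ) (E := E) (p := p) (r := r)
          (w := w) i
        have h3 : flip F ϖ E p r w (basisElt F ϖ E p r w i) ∈ W := by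
          rw [hu]
          exact W.smul_mem _ (hmem _ (swap_mem_levelSet hi))
        exact h3
      exact h2 hψ
    · exact ht'.imp_right fun h n k => hmem (.t (n + 1) k) (h n)
    · exact fun n => (hs' n).imp_left fun h l => hmem (.s (n + 1) l) h
    · exact fun k hk => (Submodule.Quotient.eq _).1 (hx ⟨k.1, hk⟩)

end Basis

end

end ModPGL2

theorem theorem3p9 (p : ℕ) [Fact p.Prime]
    (F : Type*) [Field F] [ValuativeRel F] [TopologicalSpace F] [IsNonarchimedeanLocalField F]
    [Algebra ℚ_[p] F] [ValuativeExtension ℚ_[p] F] [FiniteDimensional ℚ_[p] F]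
    (ϖ : 𝒪[F]) [Fact (Irreducible ϖ)]
    (e f : ℕ) (he : Associated (p : 𝒪[F]) (ϖ ^ e)) (hf : Nat.card 𝓀[F] = p ^ f)
    (E : Type*) [Field E] [Algebra 𝓀[F] E] [IsAlgClosure 𝓀[F] E] [CharP E p]
    (r : Fin f → ℕ) (w : ℕ) (hr : ∀ j, 2 < r j ∧ r j + 3 < p) :
    (e = 1 → f = 1 →
      ModPGL2.IsIwahoriEigenbasis F ϖ E p r w {ModPGL2.Label.one, ModPGL2.Label.alpha}) ∧
    (1 < e → f = 1 →
      ModPGL2.IsIwahoriEigenbasis F ϖ E p r w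
        (ModPGL2.labelsS f 2 ∪ {ModPGL2.Label.one, ModPGL2.Label.alpha} ∪
          ModPGL2.labelsT f 1)) ∧
    (e = 1 → 1 < f →
      ModPGL2.IsIwahoriEigenbasis F ϖ E p r w
        (ModPGL2.labelsS f 1 ∪ {ModPGL2.Label.one, ModPGL2.Label.alpha})) ∧
    (1 < e → 1 < f →
      ModPGL2.IsIwahoriEigenbasis F ϖ E p r w
        (ModPGL2.labelsS f 1 ∪ {ModPGL2.Label.one, ModPGL2.Label.alpha} ∪
          ModPGL2.labelsT f 1)) := by
  have hchar : CharP 𝓀[F] p := (RingHom.charP_iff _ (algebraMap 𝓀[F] E).injective p).2 inferInstance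
  have hr' : ∀ j, 0 < r j ∧ r j + 1 < p := fun j => by have := hr j; omega
  have hirr : Irreducible ϖ := Fact.out
  obtain ⟨v, hv⟩ := he.symm
  -- `p = ϖ ε`, where the residue class of `ε` is nonzero exactly if `e = 1`
  have h1 : e = 1 → ∃ ε : 𝒪[F], (p : 𝒪[F]) = ϖ * ε ∧ IsLocalRing.residue 𝒪[F] ε ≠ 0 := by
    rintro rfl
    refine ⟨v, by rw [← hv, pow_one], ?_⟩
    rw [IsLocalRing.residue_ne_zero_iff_isUnit]
    exact v.isUnit
  have h2 : 1 < e → ∃ ε : 𝒪[F], (p : 𝒪[F]) = ϖ * ε ∧ IsLocalRing.residue 𝒪[F] ε = 0 := by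
    intro he
    obtain ⟨m, rfl⟩ := Nat.exists_eq_add_of_lt he
    refine ⟨ϖ * (ϖ ^ m * v), ?_, ?_⟩
    · rw [← hv]
      ring
    · rw [map_mul, ModPGL2.residue_unif ϖ, zero_mul]
  have hf0 : 0 < f := by
    by_contra h
    rw [Nat.eq_zero_of_not_pos h, pow_zero] at hf
    exact absurd hf (Finite.one_lt_card (α := 𝓀[F])).ne'
  refine ⟨fun he hf1 => ?_, fun he hf1 => ?_, fun he hf1 => ?_, fun he hf1 => ?_⟩
  · obtain ⟨ε, hε, h0⟩ := h1 he
    rw [ModPGL2.pair_eq_levelSet]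
    exact ModPGL2.isIwahoriEigenbasis_levelSet hf hr' hε (fun _ => False.elim) (fun _ => False.elim)
      (fun _ _ => False.elim) (fun _ _ => False.elim) (fun n => Or.inr ⟨hf1, Or.inr h0⟩) (Or.inl h0)
  · obtain ⟨ε, hε, h0⟩ := h2 he
    have hc := ModPGL2.carry_eq_zero ϖ p f hf0 hf ε hε h0
    rw [ModPGL2.labelsS_union_labelsT_eq_levelSet]
    refine ModPGL2.isIwahoriEigenbasis_levelSet hf hr' hε (fun n hn => by omega) (fun n hn => hn)
      (fun n l hn => ModPGL2.isEigen_sElt hf hr n l (Or.inr ⟨hf1, by omega, hc⟩))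
      (fun n k _ => ModPGL2.isEigen_tElt hf hr hc n k) (fun n => ?_) (Or.inr fun n => by omega)
    by_cases hn : n = 0
    · exact Or.inr ⟨hf1, Or.inl hn⟩
    · exact Or.inl (by omega)
  · obtain ⟨ε, hε, h0⟩ := h1 he
    rw [ModPGL2.labelsS_union_eq_levelSet]
    exact ModPGL2.isIwahoriEigenbasis_levelSet hf hr' hε (fun n hn => hn) (fun _ => False.elim)
      (fun n l _ => ModPGL2.isEigen_sElt hf hr n l (Or.inl hf1)) (fun _ _ => False.elim)
      (fun n => Or.inl (by omega)) (Or.inl h0)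
  · obtain ⟨ε, hε, h0⟩ := h2 he
    have hc := ModPGL2.carry_eq_zero ϖ p f hf0 hf ε hε h0
    rw [ModPGL2.labelsS_union_labelsT_eq_levelSet]
    exact ModPGL2.isIwahoriEigenbasis_levelSet hf hr' hε (fun n hn => hn) (fun n hn => hn)
      (fun n l _ => ModPGL2.isEigen_sElt hf hr n l (Or.inl hf1))
      (fun n k _ => ModPGL2.isEigen_tElt hf hr hc n k) (fun n => Or.inl (by omega))
      (Or.inr fun n => by omega)
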